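/- Let $q$ be an odd prime power, $G=SL_2(\mathbb F_q)$, and let $\psi\colon\mathbb F_q\to\mathbb C^\times$ be a non-trivial additive character. Representations are complex, "irrep" means irreducible representation, and $\widehat H$ denotes the set of isomorphism classes of irreps of a finite group $H$. *Tensor rank.* An irrep of $G$ lies in $F^k$ ($k\ge 0$) if it occurs in an $\ell$-fold tensor product, $\ell\le k$, of the four irreps of $G$ of dimensions $\frac{q\pm1}{2}$ (the $0$-fold product is the trivial representation; for $q=3$ the four irreps are, among those of dimensions $1,2$, the ones that occur in the oscillator representations of $SL_2(\mathbb F_3)$). It has tensor rank $k$ if it lies in $F^k$ but not in $F^{j}$ for $j<k$. Let $\widehat G_k\subset\widehat G$ be the set of irreps of tensor rank $k$. *Oscillator representation.* Let $k\in\{0,1,2\}$, let $\beta$ be a non-degenerate symmetric bilinear form on $U=\mathbb F_q^k$, and let $O_\beta$ be its isometry group. Let $V=\mathbb F_q^2$ with basis $e_0,e_1$ and symplectic form $\langle v,v'\rangle=v_0v_1'-v_1v_0'$, so that $W=U\otimes V$ is a symplectic space with the form $\beta\otimes\langle\,,\rangle$, on which $O_\beta$ and $G$ act by commuting symplectic automorphisms.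 Let $H=W\times\mathbb F_q$ be the Heisenberg group, $(w,z)(w',z')=(w+w',z+z'+\frac12\langle w,w'\rangle)$, and let $\pi$ be its representation with central character $\psi$ on the functions on $U$ given, for $w=x\otimes e_0+y\otimes e_1$, by $(\pi(w,z)f)(u)=\psi\big(z-\beta(x,u)-\tfrac12\beta(x,y)\big)f(u+y)$. The oscillator representation $\omega_{U\otimes V}$ is the unique representation $\omega$ of $Sp(W)$ on the functions on $U$ such that $\omega(g)\pi(w,z)\omega(g)^{-1}=\pi(gw,z)$ for all $g\in Sp(W)$, $(w,z)\in H$, and such that an element of $Sp(W)$ of the form $x\otimes e_0+y\otimes e_1\mapsto (x+Ay)\otimes e_0+y\otimes e_1$ acts by $f(u)\mapsto\psi(\tfrac12\beta(Au,u))f(u)$. (The last condition matters only for $k=1$, $q=3$.) Let $\omega_{U\otimes V,k}$ be the $k$-spectrum, i.e. the sum of the isotypic components in $\omega_{U\otimes V}|_G$ of the irreps in $\widehat G_k$. It is invariant under $O_\beta$ and $G$; let $\mathcal A_{O_\beta},\mathcal A_G\subset \mathrm{End}(\omega_{U\otimes V,k})$ be the algebras generated by the operators by which $O_\beta$, respectively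 $G$, acts on it. For $\tau\in\widehat{O_\beta}$ let $\eta(\tau)=\mathrm{Hom}_{O_\beta}(\tau,\omega_{U\otimes V,k})$, a representation of $G$, so that $\omega_{U\otimes V,k}=\bigoplus_\tau\tau\otimes\eta(\tau)$. **Theorem ($\eta$-correspondence).** 1. $\mathcal A_{O_\beta}$ and $\mathcal A_G$ are each other's commutant in $\mathrm{End}(\omega_{U\otimes V,k})$. Moreover, for every $\tau\in\widehat{O_\beta}$ that occurs in $\omega_{U\otimes V,k}$, the representation $\eta(\tau)$ is irreducible of tensor rank $k$, and $\tau\mapsto\eta(\tau)$ is an injection from the set of these $\tau$ into $\widehat G_k$. 2. Let $\varepsilon\in\mathbb F_q^\times$ be a non-square, and let $\beta_{k+},\beta_{k-}$ be the forms with associated quadratic forms $0,0$ if $k=0$; $x^2,\ \varepsilon x^2$ if $k=1$; $x^2-y^2,\ x^2-\varepsilon y^2$ if $k=2$. Then the images of the two correspondences together are all irreps of tensor rank $k$: $$\eta(\widehat{O_{\beta_{k+}}})\cup\eta(\widehat{O_{\beta_{k-}}})=\widehat G_k .$$ -/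

import Mathlib

open scoped TensorProduct

noncomputable section

namespace EtaCorrespondence

universe u v

/-! ### Quadratic spaces, isometry groups, the dual pair -/

/-- An inner product (non-degenerate symmetric bilinear form) on the `F`-vector space `U`. -/
structure QuadSpace (F : Type u) [Field F] (U : Type v) [AddCommGroup U] [Module F U] where
  form : LinearMap.BilinForm F U
  symm : ∀ x y, form x y = form y x
  nondeg : ∀ x, (∀ y, form x y = 0) → x = 0

/-- The group of linear automorphisms that preserve the bilinear form `B`. -/
def isometryGroup {F : Type u} [Field F] {M : Type v} [AddCommGroup M] [Module F M]
    (B : LinearMap.BilinForm F M) : Subgroup (M ≃ₗ[F] M) where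
  carrier := {g | ∀ x y, B (g x) (g y) = B x y}
  mul_mem' {a b} ha hb x y := by
    rw [LinearEquiv.mul_apply, LinearEquiv.mul_apply, ha, hb]
  one_mem' x y := rfl
  inv_mem' {a} ha x y := by
    have h := ha (a⁻¹ x) (a⁻¹ y)
    have e : ∀ z, a (a⁻¹ z) = z := fun z => a.apply_symm_apply z
    rw [e, e] at h
    exact h.symm

/-- The symplectic form `⟨v, v'⟩ = v₀ v'₁ - v₁ v'₀` on the plane `V = F²`. -/
def planeForm (F : Type u) [Field F] : LinearMap.BilinForm F (Fin 2 → F) :=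
  Matrix.toBilin' !![0, 1; -1, 0]

lemma planeForm_apply {F : Type u} [Field F] (v v' : Fin 2 → F) :
    planeForm F v v' = v 0 * v' 1 - v 1 * v' 0 := by
  simp [planeForm, Matrix.toBilin'_apply', dotProduct, Fin.sum_univ_two, Matrix.mulVec]
  ring

section DualPair

variable {F : Type u} [Field F] {U : Type v} [AddCommGroup U] [Module F U]

/-- The orthogonal group `O_β`. -/
abbrev QuadSpace.O (Q : QuadSpace F U) : Type v := isometryGroup Q.form

/-- The symplectic form `β ⊗ ⟨ , ⟩` on `W = U ⊗ V`. -/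
def QuadSpace.sympl (Q : QuadSpace F U) : LinearMap.BilinForm F (U ⊗[F] (Fin 2 → F)) :=
  LinearMap.BilinForm.tmul Q.form (planeForm F)

/-- The symplectic group `Sp(U ⊗ V)`. -/
abbrev QuadSpace.Sp (Q : QuadSpace F U) : Type (max u v) := isometryGroup Q.sympl

lemma QuadSpace.sympl_tmul (Q : QuadSpace F U) (u u' : U) (v v' : Fin 2 → F) :
    Q.sympl (u ⊗ₜ v) (u' ⊗ₜ v') = planeForm F v v' * Q.form u u' := rfl

lemma bilin_tensor_ext {M N : Type*} [AddCommGroup M] [Module F M] [AddCommGroup N] [Module F N]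
    (B B' : LinearMap.BilinForm F (M ⊗[F] N))
    (h : ∀ m n m' n', B (m ⊗ₜ n) (m' ⊗ₜ n') = B' (m ⊗ₜ n) (m' ⊗ₜ n')) (x y : M ⊗[F] N) :
    B x y = B' x y := by
  induction x using TensorProduct.induction_on with
  | zero => simp
  | add a b ha hb => simp [ha, hb]
  | tmul m n =>
    induction y using TensorProduct.induction_on with
    | zero => simp
    | add a b ha hb => simp [ha, hb]
    | tmul m' n' => exact h m n m' n'

/-- `O_β` acts on `U ⊗ V` through the first factor. -/
def QuadSpace.oToSp (Q : QuadSpace F U) : Q.O →* Q.Sp where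
  toFun o := ⟨TensorProduct.congr o.1 (LinearEquiv.refl F _), fun x y =>
    bilin_tensor_ext (Q.sympl.compl₁₂ (TensorProduct.congr o.1 (LinearEquiv.refl F _)).toLinearMap
      (TensorProduct.congr o.1 (LinearEquiv.refl F _)).toLinearMap) Q.sympl
      (fun m n m' n' => by simp [QuadSpace.sympl_tmul, o.2 m m']) x y⟩
  map_one' := by
    ext x
    induction x using TensorProduct.induction_on with
    | zero => simp
    | add a b ha hb => simp_all
    | tmul m n => simp
  map_mul' a b := by
    ext x
    induction x using TensorProduct.induction_on with
    | zero => simp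
    | add a b ha hb => simp_all
    | tmul m n => simp

/-- `G = SL₂(F)` acts on `U ⊗ V` through the second factor. -/
def QuadSpace.slToSp (Q : QuadSpace F U) : Matrix.SpecialLinearGroup (Fin 2) F →* Q.Sp where
  toFun g := ⟨TensorProduct.congr (LinearEquiv.refl F _) (Matrix.SpecialLinearGroup.toLin' g),
    fun x y => bilin_tensor_ext
      (Q.sympl.compl₁₂
        (TensorProduct.congr (LinearEquiv.refl F _)
          (Matrix.SpecialLinearGroup.toLin' g)).toLinearMap
        (TensorProduct.congr (LinearEquiv.refl F _)
          (Matrix.SpecialLinearGroup.toLin' g)).toLinearMap) Q.sympl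
      (fun m n m' n' => by
        have hg := g.det_coe
        rw [Matrix.det_fin_two] at hg
        simp only [LinearMap.compl₁₂_apply, LinearEquiv.coe_coe, TensorProduct.congr_tmul,
          QuadSpace.sympl_tmul, planeForm_apply, Matrix.SpecialLinearGroup.toLin'_apply,
          Matrix.toLin'_apply, Matrix.mulVec, dotProduct, Fin.sum_univ_two, LinearEquiv.refl_apply]
        linear_combination (n 0 * n' 1 - n 1 * n' 0) * Q.form m m' * hg) x y⟩
  map_one' := by
    ext x
    induction x using TensorProduct.induction_on with
    | zero => simp
    | add a b ha hb => simp_all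
    | tmul m n => simp
  map_mul' a b := by
    ext x
    induction x using TensorProduct.induction_on with
    | zero => simp
    | add a b ha hb => simp_all
    | tmul m n => simp

lemma QuadSpace.commute_oToSp_slToSp (Q : QuadSpace F U) (o : Q.O)
    (g : Matrix.SpecialLinearGroup (Fin 2) F) :
    Q.oToSp o * Q.slToSp g = Q.slToSp g * Q.oToSp o := by
  ext x
  induction x using TensorProduct.induction_on with
  | zero => simp
  | add a b ha hb => simp_all
  | tmul m n => simp [QuadSpace.oToSp, QuadSpace.slToSp]

/-! ### The Heisenberg group and the Schrödinger model -/

/-- The Heisenberg group `W × F` with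
`(w, z) (w', z') = (w + w', z + z' + ½ ⟨w, w'⟩)`. -/
@[ext]
structure Heisenberg {W : Type v} [AddCommGroup W] [Module F W]
    (B : LinearMap.BilinForm F W) where
  w : W
  z : F

namespace Heisenberg

variable {W : Type v} [AddCommGroup W] [Module F W] {B : LinearMap.BilinForm F W}

instance : Mul (Heisenberg B) := ⟨fun h h' => ⟨h.w + h'.w, h.z + h'.z + 2⁻¹ * B h.w h'.w⟩⟩
instance : One (Heisenberg B) := ⟨⟨0, 0⟩⟩
instance : Inv (Heisenberg B) := ⟨fun h => ⟨-h.w, -h.z + 2⁻¹ * B h.w h.w⟩⟩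

@[simp] lemma mul_w (h h' : Heisenberg B) : (h * h').w = h.w + h'.w := rfl
@[simp] lemma mul_z (h h' : Heisenberg B) :
    (h * h').z = h.z + h'.z + 2⁻¹ * B h.w h'.w := rfl
@[simp] lemma one_w : (1 : Heisenberg B).w = 0 := rfl
@[simp] lemma one_z : (1 : Heisenberg B).z = 0 := rfl
@[simp] lemma inv_w (h : Heisenberg B) : (h⁻¹).w = -h.w := rfl
@[simp] lemma inv_z (h : Heisenberg B) : (h⁻¹).z = -h.z + 2⁻¹ * B h.w h.w := rfl

instance : Group (Heisenberg B) :=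
  Group.ofLeftAxioms
    (fun a b c => by
      ext
      · simp [add_assoc]
      · simp; ring)
    (fun a => by ext <;> simp)
    (fun a => by ext <;> simp)

end Heisenberg

/-- The action `g (w, z) = (g w, z)` of the symplectic group on the Heisenberg group. -/
def QuadSpace.actHeis (Q : QuadSpace F U) (g : Q.Sp) (h : Heisenberg Q.sympl) :
    Heisenberg Q.sympl := ⟨g.1 h.w, h.z⟩

/-- The `i`-th coordinate `U ⊗ F² → U`, so that
`w = coord 0 w ⊗ e₀ + coord 1 w ⊗ e₁`. -/
def coord (F : Type u) [Field F] {U : Type v} [AddCommGroup U] [Module F U] (i : Fin 2) :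
    U ⊗[F] (Fin 2 → F) →ₗ[F] U :=
  (TensorProduct.rid F U).toLinearMap ∘ₗ LinearMap.lTensor U (LinearMap.proj i)

@[simp] lemma coord_tmul (i : Fin 2) (u : U) (v : Fin 2 → F) :
    coord F i (u ⊗ₜ[F] v) = v i • u := by
  simp [coord]

lemma coord_decomp (w : U ⊗[F] (Fin 2 → F)) :
    w = coord F 0 w ⊗ₜ Pi.single 0 1 + coord F 1 w ⊗ₜ Pi.single 1 1 := by
  induction w using TensorProduct.induction_on with
  | zero => simp
  | add a b ha hb =>
    rw [map_add, map_add, TensorProduct.add_tmul, TensorProduct.add_tmul]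
    nth_rewrite 1 [ha, hb]
    abel
  | tmul m n =>
    rw [coord_tmul, coord_tmul, TensorProduct.smul_tmul, TensorProduct.smul_tmul,
      ← TensorProduct.tmul_add]
    congr 1
    ext i
    fin_cases i <;> simp

lemma QuadSpace.sympl_coord (Q : QuadSpace F U) (w w' : U ⊗[F] (Fin 2 → F)) :
    Q.sympl w w' = Q.form (coord F 0 w) (coord F 1 w') - Q.form (coord F 1 w) (coord F 0 w') := by
  rw [coord_decomp w, coord_decomp w']
  simp [QuadSpace.sympl_tmul, planeForm_apply]
  ring

variable [NeZero (2 : F)]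

/-- The Heisenberg representation with central character `ψ` in the Schrödinger model: the
representation induced from the character `(x, z) ↦ ψ z` of `(U ⊗ e₀) × F`, restricted to
functions on `U = U ⊗ e₁`. For `w = x ⊗ e₀ + y ⊗ e₁`,
`(π(w, z) f)(u) = ψ(z - β(x, u) - ½ β(x, y)) f(u + y)`. -/
def QuadSpace.heisRep (Q : QuadSpace F U) (ψ : AddChar F ℂ) :
    Representation ℂ (Heisenberg Q.sympl) (U → ℂ) where
  toFun h :=
    { toFun := fun f u =>
        ψ (h.z - Q.form (coord F 0 h.w) u - 2⁻¹ * Q.form (coord F 0 h.w) (coord F 1 h.w)) *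
          f (u + coord F 1 h.w)
      map_add' := fun f f' => by ext u; simp [mul_add]
      map_smul' := fun c f => by ext u; simp; ring }
  map_one' := by ext f u; simp
  map_mul' h h' := by
    refine LinearMap.ext fun f => funext fun u => ?_
    simp only [LinearMap.coe_mk, AddHom.coe_mk, Module.End.mul_apply, Heisenberg.mul_w,
      Heisenberg.mul_z, map_add, LinearMap.add_apply, Q.sympl_coord]
    rw [← mul_assoc, ← AddChar.map_add_eq_mul, add_assoc u]
    congr 2
    rw [Q.symm (coord F 1 h.w) (coord F 0 h'.w)]
    have h2 : (2 : F) * 2⁻¹ = 1 := mul_inv_cancel₀ (NeZero.ne _)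
    linear_combination (-(Q.form (coord F 0 h'.w) (coord F 1 h.w))) * h2

lemma QuadSpace.heisRep_apply (Q : QuadSpace F U) (ψ : AddChar F ℂ) (h : Heisenberg Q.sympl)
    (f : U → ℂ) (u : U) : Q.heisRep ψ h f u =
      ψ (h.z - Q.form (coord F 0 h.w) u - 2⁻¹ * Q.form (coord F 0 h.w) (coord F 1 h.w)) *
        f (u + coord F 1 h.w) := rfl

/-- `ω` is the oscillator representation of `Sp(U ⊗ V)` in the Schrödinger model. The identity
`egorov` determines `ω` up to a character of `Sp(U ⊗ V)`; that character is trivial because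
`unipotent` fixes `ω` on the elements `(x, y) ↦ (x + A y, y)`, whose conjugates generate
`Sp(U ⊗ V)`. (The second condition matters only if `dim U = 1` and `|F| = 3`: in all other cases
`Sp(U ⊗ V)` has no non-trivial character.) -/
structure QuadSpace.IsOscillator (Q : QuadSpace F U) (ψ : AddChar F ℂ)
    (ω : Representation ℂ Q.Sp (U → ℂ)) : Prop where
  egorov : ∀ g h, ω g * Q.heisRep ψ h * ω g⁻¹ = Q.heisRep ψ (Q.actHeis g h)
  unipotent : ∀ (g : Q.Sp) (A : U →ₗ[F] U),
    (∀ w, coord F 0 (g.1 w) = coord F 0 w + A (coord F 1 w) ∧ coord F 1 (g.1 w) = coord F 1 w) →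
    ∀ f u, ω g f u = ψ (2⁻¹ * Q.form (A u) u) * f u

/-! ### Existence of the oscillator representation -/

section Existence


variable (Q : QuadSpace F U) (ψ : AddChar F ℂ)

/-- `M` satisfies the intertwining identity attached to `g`. -/
def QuadSpace.Intertw (g : Q.Sp) (M : Module.End ℂ (U → ℂ)) : Prop :=
  ∀ h, M * Q.heisRep ψ h = Q.heisRep ψ (Q.actHeis g h) * M

variable {Q ψ}

lemma exists_form_char_ne_one (hψ : ψ ≠ 1) {x : U} (hx : x ≠ 0) :
    ∃ v, ψ (Q.form x v) ≠ 1 := by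
  obtain ⟨a, ha⟩ : ∃ a, ψ a ≠ 1 := by
    by_contra! h
    exact hψ (by ext a; simpa using h a)
  obtain ⟨y, hy⟩ : ∃ y, Q.form x y ≠ 0 := by
    by_contra! h
    exact hx (Q.nondeg x h)
  refine ⟨(a / Q.form x y) • y, ?_⟩
  rw [map_smul, smul_eq_mul, div_mul_cancel₀ _ hy]
  exact ha

lemma sum_form_char [Fintype U] (hψ : ψ ≠ 1) {x : U} (hx : x ≠ 0) :
    ∑ v, ψ (Q.form x v) = 0 := by
  obtain ⟨v, hv⟩ := exists_form_char_ne_one (Q := Q) hψ hx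
  let χ : AddChar U ℂ := ψ.compAddMonoidHom (Q.form x).toAddMonoidHom
  have hχ : χ ≠ 0 := fun h => hv (by simpa [χ] using DFunLike.congr_fun h v)
  simpa [χ] using AddChar.sum_eq_zero_iff_ne_zero.2 hχ

lemma heis_e0 (x : U) (f : U → ℂ) (u : U) :
    Q.heisRep ψ ⟨x ⊗ₜ Pi.single 0 1, 0⟩ f u = ψ (-Q.form x u) * f u := by
  simp [QuadSpace.heisRep_apply]

lemma heis_e1 (y : U) (f : U → ℂ) (u : U) :
    Q.heisRep ψ ⟨y ⊗ₜ Pi.single 1 1, 0⟩ f u = f (u + y) := by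
  simp [QuadSpace.heisRep_apply]

open scoped Classical in
lemma heis_e1_single (y u : U) :
    Q.heisRep ψ ⟨y ⊗ₜ Pi.single 1 1, 0⟩ (Pi.single u 1) = Pi.single (u - y) (1 : ℂ) := by
  ext v
  rw [heis_e1]
  simp [Pi.single_apply, eq_sub_iff_add_eq]

open scoped Classical in
lemma end_eq_zero [Finite U] {M : Module.End ℂ (U → ℂ)}
    (h : ∀ u, M (Pi.single u 1) = 0) : M = 0 := by
  ext u : 2
  simpa using h u

/-- Schur's lemma for the Heisenberg representation. -/
lemma heis_schur [Finite U] (hψ : ψ ≠ 1) {A : Module.End ℂ (U → ℂ)}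
    (hA : ∀ h, A * Q.heisRep ψ h = Q.heisRep ψ h * A) : ∃ c : ℂ, A = c • 1 := by
  classical
  have hA' : ∀ h f, A (Q.heisRep ψ h f) = Q.heisRep ψ h (A f) := fun h f =>
    LinearMap.congr_fun (hA h) f
  have h0 : A (Pi.single 0 1) = (A (Pi.single 0 1) 0) • Pi.single 0 1 := by
    ext u
    by_cases hu : u = 0
    · subst hu; simp
    · obtain ⟨x, hx⟩ := exists_form_char_ne_one (Q := Q) hψ hu
      have e : Q.heisRep ψ ⟨(-x) ⊗ₜ Pi.single 0 1, 0⟩ (Pi.single 0 1) = Pi.single 0 (1 : ℂ) := by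
        ext v
        rw [heis_e0]
        by_cases hv : v = 0
        · subst hv; simp
        · simp [hv]
      have := congrFun (hA' ⟨(-x) ⊗ₜ Pi.single 0 1, 0⟩ (Pi.single 0 1)) u
      rw [e, heis_e0] at this
      have hz : A (Pi.single 0 1) u * (ψ (Q.form u x) - 1) = 0 := by
        rw [Q.symm u x]
        simp only [map_neg, LinearMap.neg_apply, neg_neg] at this
        linear_combination -this
      rcases mul_eq_zero.1 hz with h | h
      · simp [h, hu]
      · exact absurd (sub_eq_zero.1 h) hx
  refine ⟨A (Pi.single 0 1) 0, sub_eq_zero.1 (end_eq_zero fun u => ?_)⟩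
  have e : Pi.single u (1 : ℂ) = Q.heisRep ψ ⟨(-u) ⊗ₜ Pi.single 1 1, 0⟩ (Pi.single 0 1) := by
    rw [heis_e1_single]; simp
  rw [LinearMap.sub_apply, sub_eq_zero, LinearMap.smul_apply, Module.End.one_apply]
  conv_lhs => rw [e, hA', h0, map_smul, ← e]

/-- A non-zero intertwiner is injective. -/
lemma QuadSpace.Intertw.injective [Finite U] (hψ : ψ ≠ 1) {g : Q.Sp} {M : Module.End ℂ (U → ℂ)}
    (hM : Q.Intertw ψ g M) (h0 : M ≠ 0) : Function.Injective M := by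
  classical
  have := Fintype.ofFinite U
  have hM' : ∀ h f, M (Q.heisRep ψ h f) = Q.heisRep ψ (Q.actHeis g h) (M f) := fun h f =>
    LinearMap.congr_fun (hM h) f
  rw [injective_iff_map_eq_zero]
  intro f hf
  by_contra hne
  obtain ⟨u₀, hu₀⟩ : ∃ u, f u ≠ 0 := by
    by_contra! h
    exact hne (funext h)
  have key : (∑ x, ψ (Q.form x u₀) • Q.heisRep ψ ⟨x ⊗ₜ Pi.single 0 1, 0⟩ f) =
      ((Fintype.card U : ℂ) * f u₀) • Pi.single u₀ 1 := by
    ext u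
    simp only [Finset.sum_apply, Pi.smul_apply, heis_e0, smul_eq_mul]
    by_cases hu : u = u₀
    · subst hu
      simp [← mul_assoc, ← AddChar.map_add_eq_mul]
    · have : ∑ x, ψ (Q.form (u₀ - u) x) = 0 := sum_form_char hψ (sub_ne_zero.2 (Ne.symm hu))
      simp only [Pi.single_apply, hu, if_false, mul_zero]
      rw [← zero_mul (f u), ← this, Finset.sum_mul]
      refine Finset.sum_congr rfl fun x _ => ?_
      rw [← mul_assoc, ← AddChar.map_add_eq_mul, Q.symm _ x, map_sub, sub_eq_add_neg]
  have h1 : M (Pi.single u₀ 1) = 0 := by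
    have := congrArg M key
    rw [map_sum, map_smul] at this
    simp only [map_smul, hM', hf, map_zero, smul_zero, Finset.sum_const_zero] at this
    refine (smul_eq_zero.1 this.symm).resolve_left (mul_ne_zero ?_ hu₀)
    exact_mod_cast Fintype.card_ne_zero
  refine h0 (end_eq_zero fun u => ?_)
  have e : Pi.single u (1 : ℂ) =
      Q.heisRep ψ ⟨(u₀ - u) ⊗ₜ Pi.single 1 1, 0⟩ (Pi.single u₀ 1) := by
    rw [heis_e1_single]; simp
  rw [e, hM', h1, map_zero]

lemma actHeis_mul (g : Q.Sp) (h h' : Heisenberg Q.sympl) :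
    Q.actHeis g (h * h') = Q.actHeis g h * Q.actHeis g h' := by
  ext
  · simp [QuadSpace.actHeis]
  · have : Q.sympl (g.1 h.w) (g.1 h'.w) = Q.sympl h.w h'.w := g.2 _ _
    simp [QuadSpace.actHeis, this]

lemma heis_center (w : U ⊗[F] (Fin 2 → F)) (z : F) :
    Q.heisRep ψ ⟨w, z⟩ = ψ z • Q.heisRep ψ ⟨w, 0⟩ := by
  ext1; ext u
  simp only [LinearMap.smul_apply, Pi.smul_apply, QuadSpace.heisRep_apply, smul_eq_mul,
    ← mul_assoc, ← AddChar.map_add_eq_mul]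
  congr 2
  ring

open scoped Classical in
lemma heis_trace [Fintype U] (hψ : ψ ≠ 1) {w : U ⊗[F] (Fin 2 → F)} (hw : w ≠ 0) :
    ∑ v, Q.heisRep ψ ⟨w, 0⟩ (Pi.single v 1) v = 0 := by
  by_cases h1 : coord F 1 w = 0
  · have h0 : coord F 0 w ≠ 0 := by
      intro h
      apply hw
      rw [coord_decomp w, h, h1]
      simp
    have := sum_form_char (Q := Q) hψ (neg_ne_zero.2 h0)
    simpa [QuadSpace.heisRep_apply, h1] using this
  · refine Finset.sum_eq_zero fun v _ => ?_
    simp [QuadSpace.heisRep_apply, h1]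

lemma exists_intertw [Finite F] [Finite U] (hψ : ψ ≠ 1) (g : Q.Sp) :
    ∃ M : Module.End ℂ (U → ℂ), Q.Intertw ψ g M ∧ M ≠ 0 := by
  classical
  have := Fintype.ofFinite U
  have : Finite (Heisenberg Q.sympl) := by
    refine Finite.of_injective (fun h => (coord F 0 h.w, coord F 1 h.w, h.z)) fun h h' e => ?_
    simp only [Prod.mk.injEq] at e
    ext
    · rw [coord_decomp h.w, coord_decomp h'.w, e.1, e.2.1]
    · exact e.2.2
  have := Fintype.ofFinite (Heisenberg Q.sympl)
  -- averages of the rank one operators `f ↦ f v • δ₀`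
  let T : U → Module.End ℂ (U → ℂ) := fun v =>
    LinearMap.toSpanSingleton ℂ (U → ℂ) (Pi.single 0 1) ∘ₗ LinearMap.proj v
  let M : U → Module.End ℂ (U → ℂ) := fun v =>
    ∑ h : Heisenberg Q.sympl, Q.heisRep ψ (Q.actHeis g h) * T v * Q.heisRep ψ (h⁻¹)
  have hM : ∀ v, Q.Intertw ψ g (M v) := by
    intro v k
    simp only [M, Finset.sum_mul, Finset.mul_sum]
    refine Fintype.sum_equiv (Equiv.mulLeft k⁻¹) _ _ fun h => ?_
    have e1 : Q.heisRep ψ (Q.actHeis g h) =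
        Q.heisRep ψ (Q.actHeis g k) * Q.heisRep ψ (Q.actHeis g (k⁻¹ * h)) := by
      rw [← map_mul, ← actHeis_mul, mul_inv_cancel_left]
    have e2 : Q.heisRep ψ (k⁻¹ * h)⁻¹ = Q.heisRep ψ h⁻¹ * Q.heisRep ψ k := by
      rw [← map_mul, mul_inv_rev, inv_inv]
    rw [Equiv.coe_mulLeft, e1, e2]
    simp only [mul_assoc]
  by_contra! hall
  have h0 : ∀ v, M v (Pi.single v 1) 0 = 0 := fun v => by
    rw [hall _ (hM v)]; rfl
  have hterm : ∀ h : Heisenberg Q.sympl,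
      (∑ v, (Q.heisRep ψ (Q.actHeis g h) * T v * Q.heisRep ψ (h⁻¹)) (Pi.single v 1) 0) =
        if h.w = 0 then (Fintype.card U : ℂ) else 0 := by
    intro h
    have e : ∀ v, (Q.heisRep ψ (Q.actHeis g h) * T v * Q.heisRep ψ (h⁻¹)) (Pi.single v 1) 0 =
        Q.heisRep ψ (h⁻¹) (Pi.single v 1) v * Q.heisRep ψ (Q.actHeis g h) (Pi.single 0 1) 0 := by
      intro v
      simp [T, LinearMap.toSpanSingleton_apply]
    simp only [e, ← Finset.sum_mul]
    split_ifs with hw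
    · have hz : ψ (-h.z) * ψ h.z = 1 := by
        rw [← AddChar.map_add_eq_mul]; simp
      simp [QuadSpace.heisRep_apply, QuadSpace.actHeis, hw, mul_assoc, hz]
    · have : Q.heisRep ψ h⁻¹ = ψ (h⁻¹).z • Q.heisRep ψ ⟨-h.w, 0⟩ := heis_center _ _
      simp only [this, LinearMap.smul_apply, Pi.smul_apply, ← Finset.smul_sum,
        heis_trace hψ (neg_ne_zero.2 hw), smul_zero, zero_mul]
  have hsum : ∑ h : Heisenberg Q.sympl, (if h.w = 0 then (Fintype.card U : ℂ) else 0) = 0 := by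
    simp only [← hterm]
    rw [Finset.sum_comm]
    refine Finset.sum_eq_zero fun v _ => ?_
    rw [← h0 v]
    simp [M, LinearMap.sum_apply, Finset.sum_apply]
  rw [← Finset.sum_filter, Finset.sum_const, nsmul_eq_mul] at hsum
  rcases mul_eq_zero.1 hsum with h | h
  · rw [Nat.cast_eq_zero, Finset.card_eq_zero] at h
    have : (1 : Heisenberg Q.sympl) ∈
        Finset.univ.filter fun h : Heisenberg Q.sympl => h.w = 0 := by simp
    simp [h] at this
  · exact Fintype.card_ne_zero (α := U) (by exact_mod_cast h)

lemma QuadSpace.Intertw.mul {g g' : Q.Sp} {M M' : Module.End ℂ (U → ℂ)} (hM : Q.Intertw ψ g M)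
    (hM' : Q.Intertw ψ g' M') : Q.Intertw ψ (g * g') (M * M') := fun h => by
  have e : Q.actHeis (g * g') h = Q.actHeis g (Q.actHeis g' h) := rfl
  rw [mul_assoc, hM' h, ← mul_assoc, hM, mul_assoc, e]

lemma QuadSpace.Intertw.one : Q.Intertw ψ 1 1 := fun h => by
  have e : Q.actHeis 1 h = h := rfl
  rw [e, one_mul, mul_one]

lemma QuadSpace.Intertw.inv {g : Q.Sp} {M N : Module.End ℂ (U → ℂ)} (hM : Q.Intertw ψ g M)
    (h1 : M * N = 1) (h2 : N * M = 1) : Q.Intertw ψ g⁻¹ N := fun h => by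
  have e : Q.actHeis g (Q.actHeis g⁻¹ h) = h := by
    ext
    · exact g.1.apply_symm_apply _
    · rfl
  have := hM (Q.actHeis g⁻¹ h)
  rw [e] at this
  calc N * Q.heisRep ψ h = N * (Q.heisRep ψ h * M) * N := by
        rw [mul_assoc, mul_assoc, h1, mul_one]
    _ = Q.heisRep ψ (Q.actHeis g⁻¹ h) * N := by
        rw [← this, ← mul_assoc, h2, one_mul]

lemma QuadSpace.Intertw.exists_inv [Finite U] (hψ : ψ ≠ 1) {g : Q.Sp} {M : Module.End ℂ (U → ℂ)}
    (hM : Q.Intertw ψ g M) (h0 : M ≠ 0) : ∃ N, M * N = 1 ∧ N * M = 1 := by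
  let e := LinearEquiv.ofInjectiveEndo M (hM.injective hψ h0)
  refine ⟨e.symm.toLinearMap, ?_, ?_⟩
  · ext1; ext1
    exact congrFun (e.apply_symm_apply _) _
  · ext1; ext1
    exact congrFun (e.symm_apply_apply _) _

/-- Two intertwiners attached to the same element are proportional. -/
lemma QuadSpace.Intertw.eq_smul [Finite U] (hψ : ψ ≠ 1) {g : Q.Sp} {M M' : Module.End ℂ (U → ℂ)}
    (hM : Q.Intertw ψ g M) (h0 : M ≠ 0) (hM' : Q.Intertw ψ g M') : ∃ c : ℂ, M' = c • M := by
  obtain ⟨N, h1, h2⟩ := hM.exists_inv hψ h0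
  have hN := (hM.inv h1 h2).mul hM'
  rw [inv_mul_cancel] at hN
  obtain ⟨c, hc⟩ := heis_schur hψ (A := N * M') hN
  refine ⟨c, ?_⟩
  rw [← one_mul M', ← h1, mul_assoc, hc]
  simp

/-- The operator `f(u) ↦ f(-u)`. -/
def parity (U : Type v) [AddCommGroup U] : Module.End ℂ (U → ℂ) :=
  LinearMap.funLeft ℂ ℂ (fun u => -u)

lemma parity_sq : parity U * parity U = 1 := by
  refine LinearMap.ext fun f => funext fun u => ?_
  simp [parity, LinearMap.funLeft_apply]

lemma parity_heis (h : Heisenberg Q.sympl) :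
    parity U * Q.heisRep ψ h = Q.heisRep ψ ⟨-h.w, h.z⟩ * parity U := by
  refine LinearMap.ext fun f => funext fun u => ?_
  simp [parity, LinearMap.funLeft_apply, QuadSpace.heisRep_apply, add_comm]

lemma neg_ne_self_of_ne_zero (F : Type u) [Field F] [NeZero (2 : F)] {U : Type v} [AddCommGroup U]
    [Module F U] {u : U} (hu : u ≠ 0) : -u ≠ u := by
  intro h
  have h2 : (2 : F) • u = 0 := by
    rw [two_smul]; nth_rewrite 1 [← h]; simp
  exact hu ((smul_eq_zero.1 h2).resolve_left (NeZero.ne _))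


lemma trace_parity (F : Type u) [Field F] [NeZero (2 : F)] (U : Type v) [AddCommGroup U]
    [Module F U] [Finite U] : LinearMap.trace ℂ (U → ℂ) (parity U) = 1 := by
  classical
  have := Fintype.ofFinite U
  rw [LinearMap.trace_eq_matrix_trace ℂ (Pi.basisFun ℂ U), Matrix.trace]
  rw [Finset.sum_eq_single (0 : U)]
  · simp [parity, LinearMap.funLeft_apply]
  · intro u _ hu
    have := neg_ne_self_of_ne_zero F hu
    simp [parity, LinearMap.funLeft_apply, this]
  · simp

lemma QuadSpace.Intertw.parity_comm [Finite U] (hψ : ψ ≠ 1) {g : Q.Sp} {M : Module.End ℂ (U → ℂ)}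
    (hM : Q.Intertw ψ g M) (h0 : M ≠ 0) : parity U * M = M * parity U := by
  obtain ⟨N, h1, h2⟩ := hM.exists_inv hψ h0
  have hN := hM.inv h1 h2
  have key : ∀ h, (parity U * (N * parity U * M)) * Q.heisRep ψ h =
      Q.heisRep ψ h * (parity U * (N * parity U * M)) := by
    intro h
    have e : Q.actHeis g⁻¹ ⟨-(Q.actHeis g h).w, (Q.actHeis g h).z⟩ = ⟨-h.w, h.z⟩ := by
      ext
      · simp [QuadSpace.actHeis]
      · rfl
    calc (parity U * (N * parity U * M)) * Q.heisRep ψ h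
        = parity U * (N * parity U * (M * Q.heisRep ψ h)) := by simp only [mul_assoc]
      _ = parity U * (N * (parity U * Q.heisRep ψ (Q.actHeis g h)) * M) := by
          rw [hM h]; simp only [mul_assoc]
      _ = parity U * ((N * Q.heisRep ψ ⟨-(Q.actHeis g h).w, (Q.actHeis g h).z⟩) *
            parity U * M) := by rw [parity_heis]; simp only [mul_assoc]
      _ = (parity U * Q.heisRep ψ ⟨-h.w, h.z⟩) * (N * parity U * M) := by
          rw [hN, e]; simp only [mul_assoc]
      _ = Q.heisRep ψ h * (parity U * (N * parity U * M)) := by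
          rw [parity_heis]; simp only [neg_neg, mul_assoc]
  obtain ⟨c, hc⟩ := heis_schur hψ key
  have hc' : N * parity U * M = c • parity U := by
    calc N * parity U * M = parity U * parity U * (N * parity U * M) := by
          rw [parity_sq, one_mul]
      _ = c • parity U := by rw [mul_assoc, hc]; simp
  have ht := congrArg (LinearMap.trace ℂ (U → ℂ)) hc'
  rw [LinearMap.trace_mul_comm, ← mul_assoc, h1, one_mul, map_smul, trace_parity F U,
    smul_eq_mul, mul_one] at ht
  rw [← ht, one_smul] at hc'
  calc parity U * M = M * (N * parity U * M) := by
        rw [← mul_assoc, ← mul_assoc, h1, one_mul]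
    _ = _ := by rw [hc']

/-- Projection to even functions. -/
def evenProj (U : Type v) [AddCommGroup U] : Module.End ℂ (U → ℂ) := (2⁻¹ : ℂ) • (1 + parity U)

/-- Projection to odd functions. -/
def oddProj (U : Type v) [AddCommGroup U] : Module.End ℂ (U → ℂ) := (2⁻¹ : ℂ) • (1 - parity U)

lemma evenProj_apply (f : U → ℂ) (u : U) : evenProj U f u = 2⁻¹ * (f u + f (-u)) := by
  simp [evenProj, parity, LinearMap.funLeft_apply, mul_add]

lemma oddProj_apply (f : U → ℂ) (u : U) : oddProj U f u = 2⁻¹ * (f u - f (-u)) := by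
  simp [oddProj, parity, LinearMap.funLeft_apply]

lemma even_add_odd : evenProj U + oddProj U = 1 := by
  refine LinearMap.ext fun f => funext fun u => ?_
  simp [evenProj_apply, oddProj_apply]
  ring

lemma even_mul_even : evenProj U * evenProj U = evenProj U := by
  refine LinearMap.ext fun f => funext fun u => ?_
  simp [evenProj_apply]
  ring

lemma odd_mul_odd : oddProj U * oddProj U = oddProj U := by
  refine LinearMap.ext fun f => funext fun u => ?_
  simp [oddProj_apply]
  ring

lemma even_mul_odd : evenProj U * oddProj U = 0 := by
  refine LinearMap.ext fun f => funext fun u => ?_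
  simp [evenProj_apply, oddProj_apply]
  ring

lemma odd_mul_even : oddProj U * evenProj U = 0 := by
  refine LinearMap.ext fun f => funext fun u => ?_
  simp [evenProj_apply, oddProj_apply]
  ring

/-- For `M` commuting with the parity operator, the determinant of `M` on even functions. -/
def detEven (M : Module.End ℂ (U → ℂ)) : ℂ := LinearMap.det (M * evenProj U + oddProj U)

/-- For `M` commuting with the parity operator, the determinant of `M` on odd functions. -/
def detOdd (M : Module.End ℂ (U → ℂ)) : ℂ := LinearMap.det (M * oddProj U + evenProj U)

lemma comm_even {M : Module.End ℂ (U → ℂ)} (h : parity U * M = M * parity U) :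
    evenProj U * M = M * evenProj U := by
  simp [evenProj, mul_add, add_mul, h]

lemma comm_odd {M : Module.End ℂ (U → ℂ)} (h : parity U * M = M * parity U) :
    oddProj U * M = M * oddProj U := by
  simp [oddProj, mul_sub, sub_mul, h]

lemma detEven_mul (M : Module.End ℂ (U → ℂ)) {M' : Module.End ℂ (U → ℂ)}
    (h : parity U * M' = M' * parity U) : detEven (M * M') = detEven M * detEven M' := by
  rw [detEven, detEven, detEven, ← map_mul]
  congr 1
  have h1 : M * evenProj U * (M' * evenProj U) = M * M' * evenProj U := by
    rw [mul_assoc, ← mul_assoc (evenProj U), comm_even h, mul_assoc M', even_mul_even, mul_assoc]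
  have h2 : oddProj U * (M' * evenProj U) = 0 := by
    rw [← mul_assoc, comm_odd h, mul_assoc, odd_mul_even, mul_zero]
  rw [add_mul, mul_add, mul_add, h1, h2, odd_mul_odd, mul_assoc M (evenProj U), even_mul_odd, mul_zero,
    add_zero, zero_add]

lemma detOdd_mul (M : Module.End ℂ (U → ℂ)) {M' : Module.End ℂ (U → ℂ)}
    (h : parity U * M' = M' * parity U) : detOdd (M * M') = detOdd M * detOdd M' := by
  rw [detOdd, detOdd, detOdd, ← map_mul]
  congr 1
  have h1 : M * oddProj U * (M' * oddProj U) = M * M' * oddProj U := by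
    rw [mul_assoc, ← mul_assoc (oddProj U), comm_odd h, mul_assoc M', odd_mul_odd, mul_assoc]
  have h2 : evenProj U * (M' * oddProj U) = 0 := by
    rw [← mul_assoc, comm_even h, mul_assoc, even_mul_odd, mul_zero]
  rw [add_mul, mul_add, mul_add, h1, h2, even_mul_even, mul_assoc M (oddProj U), odd_mul_even, mul_zero,
    add_zero, zero_add]

lemma detEven_one : detEven (1 : Module.End ℂ (U → ℂ)) = 1 := by
  rw [detEven, one_mul, even_add_odd, map_one]

lemma detOdd_one : detOdd (1 : Module.End ℂ (U → ℂ)) = 1 := by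
  rw [detOdd, one_mul, add_comm, even_add_odd, map_one]

/-- Multiplication by the function `d`. -/
def mulOp (d : U → ℂ) : Module.End ℂ (U → ℂ) := LinearMap.mulLeft ℂ d

lemma mulOp_apply (d f : U → ℂ) (u : U) : mulOp d f u = d u * f u := rfl

lemma exists_odd_sign (F : Type u) [Field F] [NeZero (2 : F)] (U : Type v) [AddCommGroup U]
    [Module F U] : ∃ s : U → ℂ, (∀ u, s u * s u = 1) ∧ ∀ u, u ≠ 0 → s (-u) = -s u := by
  classical
  let _ := linearOrderOfSTO (WellOrderingRel (α := U))
  refine ⟨fun u => if u ≤ -u then 1 else -1, fun u => by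
    by_cases h : u ≤ -u <;> simp [h], fun u hu => ?_⟩
  have hne := neg_ne_self_of_ne_zero F hu
  rcases lt_or_gt_of_ne hne with h | h
  · simp [h.le, not_le.2 h]
  · simp [h.le, not_le.2 h]

/-- Multiplication by an even function with value `1` at `0` has equal determinants on even and
on odd functions. -/
lemma detEven_mulOp (F : Type u) [Field F] [NeZero (2 : F)] {U : Type v} [AddCommGroup U]
    [Module F U] {d : U → ℂ} (h0 : d 0 = 1) :
    detEven (mulOp d) = detOdd (mulOp d) := by
  obtain ⟨s, hs, hs'⟩ := exists_odd_sign F U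
  have hss : mulOp s * mulOp s = 1 := by
    refine LinearMap.ext fun f => funext fun u => ?_
    simp [mulOp_apply, ← mul_assoc, hs]
  have hconj : mulOp d * evenProj U + oddProj U =
      mulOp s * ((mulOp d * oddProj U + evenProj U) * mulOp s) := by
    refine LinearMap.ext fun f => funext fun u => ?_
    simp only [LinearMap.add_apply, Module.End.mul_apply, Pi.add_apply, mulOp_apply,
      evenProj_apply, oddProj_apply]
    by_cases hu : u = 0
    · subst hu
      rw [neg_zero, h0]
      linear_combination (-f 0) * hs 0
    · rw [hs' u hu]
      linear_combination (-(2⁻¹ * d u * (f u + f (-u)) + 2⁻¹ * (f u - f (-u)))) * hs u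
  rw [detEven, detOdd, hconj, map_mul, map_mul, mul_comm, mul_assoc, ← map_mul, hss, map_one,
    mul_one]

lemma det_mulOp [Fintype U] (d : U → ℂ) : LinearMap.det (mulOp d) = ∏ u, d u := by
  classical
  have : mulOp d = Matrix.toLin' (Matrix.diagonal d) := by
    refine LinearMap.ext fun f => funext fun u => ?_
    simp [mulOp_apply, Matrix.mulVec_diagonal]
  rw [this, LinearMap.det_toLin', Matrix.det_diagonal]

/-- The even functions have one dimension more than the odd ones. -/
lemma detEven_scalar (F : Type u) [Field F] [NeZero (2 : F)] {U : Type v} [AddCommGroup U]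
    [Module F U] [Finite U] (c : ℂ) :
    detEven (c • (1 : Module.End ℂ (U → ℂ))) = c * detOdd (c • (1 : Module.End ℂ (U → ℂ))) := by
  classical
  have := Fintype.ofFinite U
  let d : U → ℂ := fun u => if u = 0 then 1 else c
  let r : U → ℂ := fun u => if u = 0 then c else 1
  have h := detEven_mulOp F (U := U) (d := d) (by simp [d])
  have h1 : (c • (1 : Module.End ℂ (U → ℂ))) * evenProj U + oddProj U =
      mulOp r * (mulOp d * evenProj U + oddProj U) := by
    refine LinearMap.ext fun f => funext fun u => ?_
    by_cases hu : u = 0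
    · subst hu; simp [mulOp_apply, evenProj_apply, oddProj_apply, d, r]
    · simp [mulOp_apply, evenProj_apply, oddProj_apply, d, r, hu]
  have h2 : (c • (1 : Module.End ℂ (U → ℂ))) * oddProj U + evenProj U =
      mulOp d * oddProj U + evenProj U := by
    refine LinearMap.ext fun f => funext fun u => ?_
    by_cases hu : u = 0
    · subst hu; simp [mulOp_apply, evenProj_apply, oddProj_apply, d]
    · simp [mulOp_apply, evenProj_apply, oddProj_apply, d, hu]
  have hr : LinearMap.det (mulOp r) = c := by
    rw [det_mulOp]; simp [r]
  rw [detEven, detOdd, h1, h2, map_mul, hr]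
  rw [detEven, detOdd] at h
  rw [h]

variable (Q ψ) in
/-- The normalized intertwiners. -/
def QuadSpace.Normalized (g : Q.Sp) (M : Module.End ℂ (U → ℂ)) : Prop :=
  Q.Intertw ψ g M ∧ M ≠ 0 ∧ detEven M = detOdd M

lemma QuadSpace.Intertw.det_ne_zero [Finite U] (hψ : ψ ≠ 1) {g : Q.Sp}
    {M : Module.End ℂ (U → ℂ)} (hM : Q.Intertw ψ g M) (h0 : M ≠ 0) :
    detEven M ≠ 0 ∧ detOdd M ≠ 0 := by
  obtain ⟨N, -, h2⟩ := hM.exists_inv hψ h0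
  have hc := hM.parity_comm hψ h0
  have e : detEven N * detEven M = 1 := by rw [← detEven_mul _ hc, h2, detEven_one]
  have e' : detOdd N * detOdd M = 1 := by rw [← detOdd_mul _ hc, h2, detOdd_one]
  exact ⟨right_ne_zero_of_mul_eq_one e, right_ne_zero_of_mul_eq_one e'⟩

lemma QuadSpace.Normalized.eq [Finite U] (hψ : ψ ≠ 1) {g : Q.Sp}
    {M M' : Module.End ℂ (U → ℂ)} (h : Q.Normalized ψ g M) (h' : Q.Normalized ψ g M') :
    M = M' := by
  obtain ⟨c, rfl⟩ := h.1.eq_smul hψ h.2.1 h'.1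
  have hc := h.1.parity_comm hψ h.2.1
  have hd := h'.2.2
  have e : c • M = (c • 1) * M := by simp
  have hne := h'.1.det_ne_zero hψ h'.2.1
  rw [e, detEven_mul _ hc, detOdd_mul _ hc] at hne
  rw [e, detEven_mul _ hc, detOdd_mul _ hc, detEven_scalar F, h.2.2, mul_assoc] at hd
  have : c = 1 := by
    refine mul_right_cancel₀ hne.2 ?_
    rw [hd, one_mul]
  rw [this, one_smul]

lemma exists_normalized [Finite F] [Finite U] (hψ : ψ ≠ 1) (g : Q.Sp) :
    ∃ M, Q.Normalized ψ g M := by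
  obtain ⟨M, hM, h0⟩ := exists_intertw hψ g
  obtain ⟨he, ho⟩ := hM.det_ne_zero hψ h0
  have hc := hM.parity_comm hψ h0
  have hs : detOdd M / detEven M ≠ 0 := div_ne_zero ho he
  refine ⟨(detOdd M / detEven M) • M, fun h => ?_, smul_ne_zero hs h0, ?_⟩
  · rw [smul_mul_assoc, hM h, mul_smul_comm]
  · have e : (detOdd M / detEven M) • M = ((detOdd M / detEven M) • 1) * M := by simp
    rw [e, detEven_mul _ hc, detOdd_mul _ hc, detEven_scalar F]
    field_simp

lemma QuadSpace.Normalized.mul [Finite U] (hψ : ψ ≠ 1) {g g' : Q.Sp}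
    {M M' : Module.End ℂ (U → ℂ)} (h : Q.Normalized ψ g M) (h' : Q.Normalized ψ g' M') :
    Q.Normalized ψ (g * g') (M * M') := by
  refine ⟨h.1.mul h'.1, fun h0 => ?_, ?_⟩
  · obtain ⟨N, -, h2⟩ := h.1.exists_inv hψ h.2.1
    apply h'.2.1
    rw [← one_mul M', ← h2, mul_assoc, h0, mul_zero]
  · have hc := h'.1.parity_comm hψ h'.2.1
    rw [detEven_mul _ hc, detOdd_mul _ hc, h.2.2, h'.2.2]

lemma QuadSpace.Normalized.one : Q.Normalized ψ 1 1 :=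
  ⟨QuadSpace.Intertw.one, one_ne_zero, by rw [detEven_one, detOdd_one]⟩

lemma normalized_mulOp (g : Q.Sp) (A : U →ₗ[F] U)
    (hA : ∀ w, coord F 0 (g.1 w) = coord F 0 w + A (coord F 1 w) ∧
      coord F 1 (g.1 w) = coord F 1 w) :
    Q.Normalized ψ g (mulOp fun u => ψ (2⁻¹ * Q.form (A u) u)) := by
  have hsymm : ∀ x y, Q.form (A x) y = Q.form (A y) x := by
    intro x y
    have := g.2 (x ⊗ₜ Pi.single 1 1) (y ⊗ₜ Pi.single 1 1)
    rw [Q.sympl_coord, Q.sympl_coord] at this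
    simp only [hA] at this
    simp at this
    rw [sub_eq_zero, Q.symm x] at this
    exact this
  refine ⟨fun h => ?_, fun h => ?_, detEven_mulOp F (by simp)⟩
  · refine LinearMap.ext fun f => funext fun u => ?_
    simp only [Module.End.mul_apply, mulOp_apply, Q.heisRep_apply, QuadSpace.actHeis, hA,
      ← mul_assoc, ← AddChar.map_add_eq_mul]
    congr 2
    simp only [map_add, LinearMap.add_apply]
    have h2 : (2 : F) * 2⁻¹ = 1 := mul_inv_cancel₀ (NeZero.ne _)
    rw [hsymm u (coord F 1 h.w)]
    linear_combination (-(Q.form (A (coord F 1 h.w)) u)) * h2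
  · have := congrFun (LinearMap.congr_fun h 1) 0
    simp [mulOp_apply] at this

theorem exists_isOscillator [Finite F] [Finite U] (Q : QuadSpace F U) {ψ : AddChar F ℂ}
    (hψ : ψ ≠ 1) : ∃ ω, Q.IsOscillator ψ ω := by
  choose M hM using exists_normalized (Q := Q) hψ
  let ω : Representation ℂ Q.Sp (U → ℂ) :=
    { toFun := M
      map_one' := (hM 1).eq hψ QuadSpace.Normalized.one
      map_mul' := fun g g' => (hM (g * g')).eq hψ ((hM g).mul hψ (hM g')) }
  refine ⟨ω, fun g h => ?_, fun g A hA f u => ?_⟩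
  · have e : ω g * Q.heisRep ψ h = Q.heisRep ψ (Q.actHeis g h) * ω g := (hM g).1 h
    rw [e, mul_assoc, ← map_mul, mul_inv_cancel, map_one, mul_one]
  · have : ω g = _ := (hM g).eq hψ (normalized_mulOp g A hA)
    rw [this, mulOp_apply]

end Existence

/-! ### The oscillator representation and its restrictions -/

section Oscillator

variable [Finite F] [Finite U]

/-- The oscillator representation `ω_{U ⊗ V}` of `Sp(U ⊗ V)` on functions on `U`. -/
def QuadSpace.osc (Q : QuadSpace F U) {ψ : AddChar F ℂ} (hψ : ψ ≠ 1) :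
    Representation ℂ Q.Sp (U → ℂ) :=
  (exists_isOscillator Q hψ).choose

theorem QuadSpace.osc_isOscillator (Q : QuadSpace F U) {ψ : AddChar F ℂ} (hψ : ψ ≠ 1) :
    Q.IsOscillator ψ (Q.osc hψ) :=
  (exists_isOscillator Q hψ).choose_spec

/-- The restriction of the oscillator representation to `O_β`. -/
def QuadSpace.oscO (Q : QuadSpace F U) {ψ : AddChar F ℂ} (hψ : ψ ≠ 1) :
    Representation ℂ Q.O (U → ℂ) :=
  (Q.osc hψ).comp Q.oToSp

/-- The restriction of the oscillator representation to `G = SL₂(F)`. -/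
def QuadSpace.oscG (Q : QuadSpace F U) {ψ : AddChar F ℂ} (hψ : ψ ≠ 1) :
    Representation ℂ (Matrix.SpecialLinearGroup (Fin 2) F) (U → ℂ) :=
  (Q.osc hψ).comp Q.slToSp

lemma QuadSpace.oscO_oscG_comm (Q : QuadSpace F U) {ψ : AddChar F ℂ} (hψ : ψ ≠ 1) (o : Q.O)
    (g : Matrix.SpecialLinearGroup (Fin 2) F) (f : U → ℂ) :
    Q.oscO hψ o (Q.oscG hψ g f) = Q.oscG hψ g (Q.oscO hψ o f) := by
  have h : Q.oscO hψ o * Q.oscG hψ g = Q.oscG hψ g * Q.oscO hψ o := by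
    simp only [QuadSpace.oscO, QuadSpace.oscG, MonoidHom.comp_apply, ← map_mul,
      Q.commute_oToSp_slToSp]
  exact LinearMap.congr_fun h f

end Oscillator

end DualPair

/-- The quadratic spaces `β_{k±}` on `F^k` for `k ≤ 2`: the form is `0` for `k = 0`, `ε x²` for
`k = 1` and `x² - ε y²` for `k = 2`. The space is `β_{k+}` for `ε = 1` and `β_{k-}` for a
non-square `ε`. -/
def stdSpace {F : Type u} [Field F] (ε : Fˣ) (k : ℕ) : QuadSpace F (Fin k → F) where
  form := Matrix.toBilin' (Matrix.diagonal fun i : Fin k =>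
    (-1 : F) ^ (i : ℕ) * if (i : ℕ) + 1 = k then (ε : F) else 1)
  symm x y := by
    simp only [Matrix.toBilin'_apply', Matrix.mulVec_diagonal, dotProduct]
    exact Finset.sum_congr rfl fun i _ => by ring
  nondeg x hx := by
    ext i
    have h := hx (Pi.single i 1)
    have hne : ((-1 : F) ^ (i : ℕ) * if (i : ℕ) + 1 = k then (ε : F) else 1) ≠ 0 := by
      refine mul_ne_zero (pow_ne_zero _ (neg_ne_zero.2 one_ne_zero)) ?_
      split_ifs
      · exact ε.ne_zero
      · exact one_ne_zero
    simp only [Matrix.toBilin'_apply', Matrix.mulVec_diagonal, dotProduct] at h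
    rw [Finset.sum_eq_single i] at h
    · simp only [Pi.single_eq_same, mul_one] at h
      exact (mul_eq_zero.1 h).resolve_right hne
    · intro j _ hj
      simp [hj]
    · simp

lemma stdSpace_one {F : Type u} [Field F] (ε : Fˣ) (x y : Fin 1 → F) :
    (stdSpace ε 1).form x y = ε * (x 0 * y 0) := by
  simp [stdSpace, Matrix.toBilin'_apply', Matrix.mulVec_diagonal, dotProduct]
  ring

lemma stdSpace_two {F : Type u} [Field F] (ε : Fˣ) (x y : Fin 2 → F) :
    (stdSpace ε 2).form x y = x 0 * y 0 - ε * (x 1 * y 1) := by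
  simp [stdSpace, Matrix.toBilin'_apply', Matrix.mulVec_diagonal, dotProduct, Fin.sum_univ_two]
  ring

/-! ### Tensor rank -/

/-- `ρ` is isomorphic to a subrepresentation of `σ`. -/
def Occurs {G : Type*} [Group G] {M N : Type*} [AddCommGroup M] [Module ℂ M] [AddCommGroup N]
    [Module ℂ N] (ρ : Representation ℂ G M) (σ : Representation ℂ G N) : Prop :=
  ∃ f : Representation.IntertwiningMap ρ σ, Function.Injective f

section TensorRank

variable {F : Type u} [Field F] [Finite F] [NeZero (2 : F)]

/-- `ρ` is one of the four irreducible representations of `SL₂(F)` of dimension `(q ± 1) / 2`.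
For `q = 3` the trivial representation also has dimension `(q - 1) / 2`, and the irreducible
representation of dimension `q - 1` also has dimension `(q + 1) / 2`; in this case the four
representations that are meant are those that occur in the oscillator representations of
`SL₂(F)`. -/
def IsHalf {M : Type*} [AddCommGroup M] [Module ℂ M]
    (ρ : Representation ℂ (Matrix.SpecialLinearGroup (Fin 2) F) M) : Prop :=
  ρ.IsIrreducible ∧
  (2 * Module.finrank ℂ M = Nat.card F + 1 ∨ 2 * Module.finrank ℂ M + 1 = Nat.card F) ∧
  (Nat.card F = 3 →
    ∃ (ψ : AddChar F ℂ) (hψ : ψ ≠ 1), Occurs ρ ((stdSpace (1 : Fˣ) 1).oscG hψ))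

/-- `IsHalfProduct l σ`: `σ` is an `l`-fold tensor product of representations of dimension
`(q ± 1) / 2` as in `IsHalf` (the trivial representation for `l = 0`). -/
inductive IsHalfProduct (F : Type u) [Field F] [Finite F] [NeZero (2 : F)] :
    ℕ → ∀ (N : Type) [AddCommGroup N] [Module ℂ N],
      Representation ℂ (Matrix.SpecialLinearGroup (Fin 2) F) N → Prop
  | zero : IsHalfProduct F 0 ℂ
      (Representation.trivial ℂ (Matrix.SpecialLinearGroup (Fin 2) F) ℂ)
  | succ (l : ℕ) (M : Type) [AddCommGroup M] [Module ℂ M]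
      (ρ : Representation ℂ (Matrix.SpecialLinearGroup (Fin 2) F) M)
      (N : Type) [AddCommGroup N] [Module ℂ N]
      (σ : Representation ℂ (Matrix.SpecialLinearGroup (Fin 2) F) N)
      (hρ : IsHalf ρ) (hσ : IsHalfProduct F l N σ) :
      IsHalfProduct F (l + 1) (M ⊗[ℂ] N) (ρ.tprod σ)

/-- The irreducible representation `ρ` lies in the `k`-th step of the tensor rank filtration: it
appears in an `l`-fold tensor product, `l ≤ k`, of the representations of dimension
`(q ± 1) / 2`. -/
def InFiltration (k : ℕ) {M : Type*} [AddCommGroup M] [Module ℂ M]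
    (ρ : Representation ℂ (Matrix.SpecialLinearGroup (Fin 2) F) M) : Prop :=
  ∃ l ≤ k, ∃ (N : Type) (_ : AddCommGroup N) (_ : Module ℂ N)
    (σ : Representation ℂ (Matrix.SpecialLinearGroup (Fin 2) F) N),
    IsHalfProduct F l N σ ∧ Occurs ρ σ

/-- `ρ` is an irreducible representation of `SL₂(F)` of tensor rank `k`. -/
def IsIrrepOfRank (k : ℕ) {M : Type*} [AddCommGroup M] [Module ℂ M]
    (ρ : Representation ℂ (Matrix.SpecialLinearGroup (Fin 2) F) M) : Prop :=
  ρ.IsIrreducible ∧ InFiltration k ρ ∧ ∀ j < k, ¬ InFiltration j ρ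

end TensorRank

/-! ### The `k`-spectrum and the eta correspondence -/

section Eta

variable {F : Type u} [Field F] [Finite F] [NeZero (2 : F)] {U : Type v} [AddCommGroup U]
  [Module F U] [Finite U] (Q : QuadSpace F U) {ψ : AddChar F ℂ} (hψ : ψ ≠ 1) (k : ℕ)

/-- The `k`-spectrum: the sum of the isotypic components in `ω_{U ⊗ V}` of the irreducible
representations of `G` of tensor rank `k`, i.e. the sum of the images of all `G`-homomorphisms
from such representations. -/
def QuadSpace.spec : Submodule ℂ (U → ℂ) :=
  sSup {S | ∃ (M : Type) (_ : AddCommGroup M) (_ : Module ℂ M)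
    (ρ : Representation ℂ (Matrix.SpecialLinearGroup (Fin 2) F) M)
    (f : Representation.IntertwiningMap ρ (Q.oscG hψ)),
    IsIrrepOfRank k ρ ∧ S = LinearMap.range f.toLinearMap}

/-- The `k`-spectrum as a representation of `G`. -/
def QuadSpace.specG :
    Representation ℂ (Matrix.SpecialLinearGroup (Fin 2) F) (Q.spec hψ k) :=
  Subrepresentation.toRepresentation (ρ := Q.oscG hψ)
    { toSubmodule := Q.spec hψ k
      apply_mem_toSubmodule := fun g v hv => by
        suffices h : Q.spec hψ k ≤ (Q.spec hψ k).comap (Q.oscG hψ g) from h hv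
        refine sSup_le ?_
        rintro S ⟨M, i1, i2, ρ, f, hρ, rfl⟩ - ⟨m, rfl⟩
        have hle : LinearMap.range f.toLinearMap ≤ Q.spec hψ k :=
          le_sSup ⟨M, i1, i2, ρ, f, hρ, rfl⟩
        exact hle ⟨ρ g m, LinearMap.congr_fun (f.isIntertwining' g) m⟩ }

/-- The `k`-spectrum as a representation of `O_β`. -/
def QuadSpace.specO : Representation ℂ Q.O (Q.spec hψ k) :=
  Subrepresentation.toRepresentation (ρ := Q.oscO hψ)
    { toSubmodule := Q.spec hψ k
      apply_mem_toSubmodule := fun o v hv => by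
        suffices h : Q.spec hψ k ≤ (Q.spec hψ k).comap (Q.oscO hψ o) from h hv
        refine sSup_le ?_
        rintro S ⟨M, i1, i2, ρ, f, hρ, rfl⟩ - ⟨m, rfl⟩
        let f' : Representation.IntertwiningMap ρ (Q.oscG hψ) :=
          { toLinearMap := Q.oscO hψ o ∘ₗ f.toLinearMap
            isIntertwining' := fun g => by
              ext x
              have h1 : f.toLinearMap (ρ g x) = Q.oscG hψ g (f.toLinearMap x) :=
                LinearMap.congr_fun (f.isIntertwining' g) x
              simp only [LinearMap.comp_apply, h1, Q.oscO_oscG_comm] }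
        have hle : LinearMap.range f'.toLinearMap ≤ Q.spec hψ k :=
          le_sSup ⟨M, i1, i2, ρ, f', hρ, rfl⟩
        exact hle ⟨m, rfl⟩ }

/-- The algebra `𝒜_{O_β}`, acting on the `k`-spectrum. -/
def QuadSpace.algO : Subalgebra ℂ (Module.End ℂ (Q.spec hψ k)) :=
  Algebra.adjoin ℂ (Set.range (Q.specO hψ k))

/-- The algebra `𝒜_G`, acting on the `k`-spectrum. -/
def QuadSpace.algG : Subalgebra ℂ (Module.End ℂ (Q.spec hψ k)) :=
  Algebra.adjoin ℂ (Set.range (Q.specG hψ k))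

/-- The space `Hom_{O_β}(τ, k-spectrum)`. -/
def QuadSpace.etaSpace {T : Type*} [AddCommGroup T] [Module ℂ T] (τ : Representation ℂ Q.O T) :
    Submodule ℂ (T →ₗ[ℂ] (U → ℂ)) where
  carrier := {f | (∀ t, f t ∈ Q.spec hψ k) ∧ ∀ o t, f (τ o t) = Q.oscO hψ o (f t)}
  add_mem' {f f'} hf hf' := ⟨fun t => add_mem (hf.1 t) (hf'.1 t), fun o t => by
    simp only [LinearMap.add_apply, hf.2 o t, hf'.2 o t, map_add]⟩
  zero_mem' := ⟨fun t => zero_mem _, fun o t => by simp⟩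
  smul_mem' c f hf := ⟨fun t => Submodule.smul_mem _ c (hf.1 t), fun o t => by
    simp only [LinearMap.smul_apply, hf.2 o t, map_smul]⟩

/-- The eta correspondence: `η(τ) = Hom_{O_β}(τ, k-spectrum)`, on which `G` acts through the
`k`-spectrum. It is the multiplicity space of `τ`, so that the `k`-spectrum is the direct sum of
the `τ ⊗ η(τ)` over the irreducible representations `τ` of `O_β`. -/
def QuadSpace.eta {T : Type*} [AddCommGroup T] [Module ℂ T] (τ : Representation ℂ Q.O T) :
    Representation ℂ (Matrix.SpecialLinearGroup (Fin 2) F) (Q.etaSpace hψ k τ) where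
  toFun g :=
    { toFun := fun f => ⟨Q.oscG hψ g ∘ₗ f.1,
        fun t => (Q.specG hψ k g ⟨f.1 t, f.2.1 t⟩).2, fun o t => by
          simp only [LinearMap.comp_apply, f.2.2 o t, Q.oscO_oscG_comm]⟩
      map_add' := fun f f' => Subtype.ext (LinearMap.comp_add _ _ _)
      map_smul' := fun c f => Subtype.ext (LinearMap.comp_smul _ _ _) }
  map_one' := LinearMap.ext fun f => Subtype.ext (by simp [Module.End.one_eq_id])
  map_mul' g g' := LinearMap.ext fun f => Subtype.ext (by
    simp [Module.End.mul_eq_comp, LinearMap.comp_assoc])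

/-- `ρ` is an irreducible representation of `G` in the image of the eta correspondence. -/
def QuadSpace.InEtaImage {M : Type*} [AddCommGroup M] [Module ℂ M]
    (ρ : Representation ℂ (Matrix.SpecialLinearGroup (Fin 2) F) M) : Prop :=
  ρ.IsIrreducible ∧ ∃ (T : Type) (_ : AddCommGroup T) (_ : Module ℂ T)
    (τ : Representation ℂ Q.O T), τ.IsIrreducible ∧ Nonempty ((Q.eta hψ k τ).Equiv ρ)

end Eta

end EtaCorrespondence

end

open EtaCorrespondence

/-!
In the Schrödinger model of `ω`, the operators that commute with `SL₂` are spanned by the sums of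
the Heisenberg operators over the `SL₂`-orbits of `U ⊗ V`. On the `k`-spectrum each of these orbit
sums is a linear combination of operators of `O_β`. An operator that factors through an oscillator
representation of smaller rank vanishes there, since that representation has no constituent of
tensor rank `k`; this disposes of the orbits of `l ⊗ V` for an isotropic line `l`, while an
anisotropic line gives a reflection. On the remaining orbits in a plane, one takes sums weighted
by a character of the area, and these are multiples of the operators of the Cayley transforms in
`O_β`. So `SL₂` and `O_β` generate each other's commutants, and the double commutant theorem gives
the correspondence `η`.

For surjectivity it is enough that every representation of tensor rank `k` occurs in `ω` for one
of the two forms. Let `ρ` have dimension `(q ± 1) / 2`. If `ρ` did not occur in the oscillator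
representation `ω` of a unary form, `Hom(ρ, ω)` would have no `SL₂`-invariants, and then the
number of its unipotent invariants would be too small for the weights of `ρ`. Tensor products of
the oscillator representations of unary forms are those of binary forms, and a binary form is
equivalent to `x² - y²` or `x² - ε y²`.
-/

noncomputable section

namespace EtaCorrespondence

universe u v w

open scoped MatrixGroups

open Representation (IntertwiningMap)

/-! ### Representations of a group -/

section Representations

variable {k G M N : Type*} [Field k] [Group G] [AddCommGroup M] [Module k M] [AddCommGroup N]
  [Module k N] {ρ : Representation k G M} {σ : Representation k G N}

lemma nontrivial_of_isIrreducible (hρ : ρ.IsIrreducible) : Nontrivial M :=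
  have := (Representation.irreducible_iff_isSimpleModule_asModule ρ).1 hρ
  IsSimpleModule.nontrivial (MonoidAlgebra k G) ρ.asModule

lemma eq_top_of_isIrreducible (hρ : ρ.IsIrreducible) {S : Submodule k M}
    (hS : ∀ g, ∀ m ∈ S, ρ g m ∈ S) {m : M} (hm : m ∈ S) (hm0 : m ≠ 0) : S = ⊤ := by
  let S' : Subrepresentation ρ := ⟨S, hS⟩
  rcases hρ.eq_bot_or_eq_top S' with h | h
  · have hbot : S = ⊥ := congrArg Subrepresentation.toSubmodule h
    exact absurd (by simpa only [hbot, Submodule.mem_bot] using hm) hm0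
  · exact congrArg Subrepresentation.toSubmodule h

lemma isIrreducible_of_forall_eq_top [Nontrivial M]
    (h : ∀ S : Submodule k M, (∀ g, ∀ m ∈ S, ρ g m ∈ S) → S ≠ ⊥ → S = ⊤) : ρ.IsIrreducible := by
  have : Nontrivial (Subrepresentation ρ) :=
    ⟨⊥, ⊤, fun e => bot_ne_top (α := Submodule k M) (congrArg Subrepresentation.toSubmodule e)⟩
  refine ⟨fun S => or_iff_not_imp_left.2 fun hS => Subrepresentation.toSubmodule_injective
    (h S.toSubmodule (fun g m hm => S.apply_mem_toSubmodule g hm) fun hbot => hS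
      (Subrepresentation.toSubmodule_injective hbot))⟩

lemma isIrreducible_of_equiv (e : ρ.Equiv σ) (hρ : ρ.IsIrreducible) : σ.IsIrreducible := by
  have e' : ρ.asModule ≃ₗ[MonoidAlgebra k G] σ.asModule :=
    .ofBijective (IntertwiningMap.equivLinearMapAsModule ρ σ e.toIntertwiningMap)
      e.toLinearEquiv.bijective
  exact (Representation.irreducible_iff_isSimpleModule_asModule σ).2 (.congr e'.symm)

lemma finrank_eq_one_of_isIrreducible_of_trivial (hρ : ρ.IsIrreducible) (h : ∀ g m, ρ g m = m) :
    Module.finrank k M = 1 := by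
  have := nontrivial_of_isIrreducible hρ
  obtain ⟨m, hm⟩ := exists_ne (0 : M)
  refine finrank_eq_one_iff'.2 ⟨m, hm, fun m' => ?_⟩
  have htop : k ∙ m = ⊤ := eq_top_of_isIrreducible hρ (fun g x hx => by rwa [h])
    (Submodule.mem_span_singleton_self m) hm
  exact Submodule.mem_span_singleton.1 (htop ▸ Submodule.mem_top)

lemma isIrreducible_toRepresentation_of_isAtom {S : Subrepresentation ρ} (hS : IsAtom S) :
    S.toRepresentation.IsIrreducible := by
  have hne : S.toSubmodule ≠ ⊥ := fun h => hS.1 (Subrepresentation.toSubmodule_injective h)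
  have := (Submodule.nontrivial_iff_ne_bot).2 hne
  refine isIrreducible_of_forall_eq_top fun T hT hT0 => ?_
  let T' : Subrepresentation ρ := ⟨T.map S.toSubmodule.subtype, by
    rintro g _ ⟨x, hx, rfl⟩
    exact ⟨S.toRepresentation g x, hT g x hx, rfl⟩⟩
  have hle : T' ≤ S := by
    rintro _ ⟨x, -, rfl⟩
    exact x.2
  rcases hS.le_iff.1 hle with h | h
  · have hmap : T.map S.toSubmodule.subtype = ⊥ := congrArg Subrepresentation.toSubmodule h
    exact absurd (Submodule.map_injective_of_injective S.toSubmodule.injective_subtype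
      (hmap.trans (Submodule.map_bot _).symm)) hT0
  · have hmap : T.map S.toSubmodule.subtype = S.toSubmodule :=
      congrArg Subrepresentation.toSubmodule h
    exact Submodule.map_injective_of_injective S.toSubmodule.injective_subtype
      (by rw [hmap, Submodule.map_subtype_top])

lemma exists_isIrreducible_subrepresentation [FiniteDimensional k M] [Nontrivial M]
    (ρ : Representation k G M) : ∃ S : Subrepresentation ρ, S.toRepresentation.IsIrreducible := by
  have hmono : StrictMono (Subrepresentation.toSubmodule (ρ := ρ)) := fun _ _ h => h
  have : IsAtomic (Subrepresentation ρ) :=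
    isAtomic_of_orderBot_wellFounded_lt hmono.wellFoundedLT.wf
  obtain ⟨S, hS⟩ : ∃ S : Subrepresentation ρ, IsAtom S := by
    refine ((eq_bot_or_exists_atom_le (⊤ : Subrepresentation ρ)).resolve_left fun h => ?_).imp
      fun _ => And.left
    exact top_ne_bot (α := Submodule k M) (congrArg Subrepresentation.toSubmodule h)
  exact ⟨S, isIrreducible_toRepresentation_of_isAtom hS⟩

/-- The representation obtained from `ρ` by transport of structure along `e`. -/
def transport (ρ : Representation k G M) (e : M ≃ₗ[k] N) : Representation k G N :=
  e.conjAlgEquiv k |>.toAlgHom.toMonoidHom.comp ρ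

/-- The isomorphism of `ρ` with the representation transported along `e`. -/
def transportEquiv (ρ : Representation k G M) (e : M ≃ₗ[k] N) : ρ.Equiv (transport ρ e) :=
  .mk e fun g => LinearMap.ext fun m => by simp [transport]

lemma exists_isIrreducible_injective [FiniteDimensional k M] [Nontrivial M]
    (ρ : Representation k G M) :
    ∃ (n : ℕ) (τ : Representation k G (Fin n → k)) (f : IntertwiningMap τ ρ),
      τ.IsIrreducible ∧ Function.Injective f := by
  obtain ⟨S, hS⟩ := exists_isIrreducible_subrepresentation ρ
  let e := transportEquiv S.toRepresentation (Module.finBasis k S.toSubmodule).equivFun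
  exact ⟨_, _, (⟨S.toSubmodule.subtype, fun g => rfl⟩ :
    IntertwiningMap S.toRepresentation ρ).comp e.symm.toIntertwiningMap,
    isIrreducible_of_equiv e hS, Subtype.val_injective.comp e.symm.toLinearEquiv.injective⟩

lemma intertwiningMap_asAlgebraHom (f : IntertwiningMap ρ σ) (r : MonoidAlgebra k G) (m : M) :
    f (ρ.asAlgebraHom r m) = σ.asAlgebraHom r (f m) :=
  (IntertwiningMap.equivLinearMapAsModule ρ σ f).map_smul r m

lemma adjoin_range_eq_range_asAlgebraHom (ρ : Representation k G M) :
    Algebra.adjoin k (Set.range ρ) = ρ.asAlgebraHom.range := by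
  refine le_antisymm (Algebra.adjoin_le ?_) ?_
  · rintro _ ⟨g, rfl⟩
    exact ⟨MonoidAlgebra.of k G g, ρ.asAlgebraHom_of g⟩
  · rintro _ ⟨r, rfl⟩
    change ρ.asAlgebraHom r ∈ _
    rw [Representation.asAlgebraHom_def, MonoidAlgebra.lift_apply]
    exact sum_mem fun g _ => Subalgebra.smul_mem _ (Algebra.subset_adjoin (Set.mem_range_self g)) _

lemma exists_intertwiningMap_leftInverse [Finite G] [NeZero (Nat.card G : k)]
    (f : IntertwiningMap ρ σ) (hf : Function.Injective f) :
    ∃ g : IntertwiningMap σ ρ, Function.LeftInverse g f := by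
  obtain ⟨g, hg⟩ := MonoidAlgebra.exists_leftInverse_of_injective
    (IntertwiningMap.equivLinearMapAsModule ρ σ f) (LinearMap.ker_eq_bot.2 hf)
  exact ⟨(IntertwiningMap.equivLinearMapAsModule σ ρ).symm g, fun m => LinearMap.congr_fun hg m⟩

lemma mem_adjoin_range_of_forall_commute [Finite G] [NeZero (Nat.card G : k)]
    [FiniteDimensional k M] {C : Module.End k M}
    (hC : ∀ A : Module.End k M, (∀ g, A * ρ g = ρ g * A) → C * A = A * C) :
    C ∈ Algebra.adjoin k (Set.range ρ) := by
  classical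
  let C' : Module.End (Module.End (MonoidAlgebra k G) ρ.asModule) ρ.asModule :=
    { toFun := C
      map_add' := C.map_add
      map_smul' := fun A m => by
        let φ : IntertwiningMap ρ ρ := (IntertwiningMap.equivLinearMapAsModule ρ ρ).symm A
        exact LinearMap.congr_fun (hC φ.toLinearMap φ.isIntertwining') m }
  let b := Module.finBasis k M
  obtain ⟨r, hr⟩ := jacobson_density C' (Finset.univ.image b : Finset M)
  rw [adjoin_range_eq_range_asAlgebraHom]
  exact ⟨r, b.ext fun i => (hr (b i) (Finset.mem_image_of_mem _ (Finset.mem_univ i))).symm⟩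

lemma mem_centralizer_adjoin_iff {R A : Type*} [CommSemiring R] [Semiring A] [Algebra R A]
    {s : Set A} {z : A} :
    z ∈ Subalgebra.centralizer R (Algebra.adjoin R s : Set A) ↔ ∀ g ∈ s, g * z = z * g := by
  refine ⟨fun h g hg => h g (Algebra.subset_adjoin hg), fun h g hg => ?_⟩
  have hle : Algebra.adjoin R s ≤ Subalgebra.centralizer R {z} :=
    Algebra.adjoin_le fun g hg => by
      rintro _ rfl
      exact (h g hg).symm
  exact (hle hg z rfl).symm

lemma exists_monoidHom_of_forall_eq_smul {A : Type*} [Ring A] [Nontrivial A] [Algebra k A]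
    {R R' : G →* A} (h : ∀ g, ∃ c : k, R g = c • R' g) : ∃ χ : G →* k, ∀ g, R g = χ g • R' g := by
  have hinj : ∀ g, Function.Injective fun c : k => c • R' g := fun g =>
    smul_left_injective k ((Group.isUnit g).map R').ne_zero
  choose c hc using h
  refine ⟨⟨⟨c, hinj 1 ?_⟩, fun g g' => hinj (g * g') ?_⟩, hc⟩
  · change c 1 • R' 1 = (1 : k) • R' 1
    rw [← hc, map_one, map_one, one_smul]
  · change c (g * g') • R' (g * g') = (c g * c g') • R' (g * g')
    rw [← hc, map_mul, map_mul, hc, hc, smul_mul_smul_comm]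

end Representations

section Occurrence

variable {G : Type*} [Group G] {M N P : Type*} [AddCommGroup M] [Module ℂ M] [AddCommGroup N]
  [Module ℂ N] [AddCommGroup P] [Module ℂ P] {ρ : Representation ℂ G M} {σ : Representation ℂ G N}
  {κ : Representation ℂ G P}

lemma Occurs.trans (h : Occurs ρ σ) (h' : Occurs σ κ) : Occurs ρ κ := by
  obtain ⟨f, hf⟩ := h
  obtain ⟨f', hf'⟩ := h'
  exact ⟨f'.comp f, hf'.comp hf⟩

lemma Occurs.of_equiv (e : ρ.Equiv σ) : Occurs ρ σ :=
  ⟨e.toIntertwiningMap, e.toLinearEquiv.injective⟩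

end Occurrence

section Rank

variable {F : Type u} [Field F] [Finite F] [NeZero (2 : F)] {k : ℕ} {M N : Type*}
  [AddCommGroup M] [Module ℂ M] [AddCommGroup N] [Module ℂ N] {ρ : Representation ℂ SL(2, F) M}
  {σ : Representation ℂ SL(2, F) N}

lemma InFiltration.of_occurs (hρ : InFiltration k ρ) (h : Occurs σ ρ) : InFiltration k σ := by
  obtain ⟨l, hl, N', i₁, i₂, κ, hκ, ho⟩ := hρ
  exact ⟨l, hl, N', i₁, i₂, κ, hκ, h.trans ho⟩

lemma IsIrrepOfRank.of_equiv (h : IsIrrepOfRank k ρ) (e : ρ.Equiv σ) : IsIrrepOfRank k σ :=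
  ⟨isIrreducible_of_equiv e h.1, h.2.1.of_occurs (.of_equiv e.symm),
    fun j hj h' => h.2.2 j hj (h'.of_occurs (.of_equiv e))⟩

end Rank

/-! ### Generators of `SL₂` -/

section Generators

variable {F : Type u} [Field F]

/-- The upper unipotent matrix with entry `t`. -/
def upper (t : F) : SL(2, F) := ⟨!![1, t; 0, 1], by simp⟩

/-- The Weyl element, a representative of the non-trivial element of the Weyl group. -/
def weyl : SL(2, F) := ⟨!![0, -1; 1, 0], by simp⟩

/-- The element with eigenvalues `t` and `t⁻¹` of the diagonal torus. -/
def torus (t : Fˣ) : SL(2, F) := ⟨!![(t : F), 0; 0, ((t⁻¹ : Fˣ) : F)], by simp⟩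

@[simp] lemma coe_upper (t : F) : (upper t).1 = !![1, t; 0, 1] := rfl

@[simp] lemma coe_weyl : (weyl : SL(2, F)).1 = !![0, -1; 1, 0] := rfl

@[simp] lemma coe_torus (t : Fˣ) : (torus t).1 = !![(t : F), 0; 0, ((t⁻¹ : Fˣ) : F)] := rfl

lemma upper_zero : upper (0 : F) = 1 := by
  ext i j; fin_cases i <;> fin_cases j <;> simp

lemma upper_mul_upper (s t : F) : upper s * upper t = upper (s + t) := by
  ext i j; fin_cases i <;> fin_cases j <;> simp [Matrix.mul_apply, add_comm]

lemma torus_one : torus (1 : Fˣ) = 1 := by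
  ext i j; fin_cases i <;> fin_cases j <;> simp

lemma torus_mul_torus (s t : Fˣ) : torus s * torus t = torus (s * t) := by
  ext i j; fin_cases i <;> fin_cases j <;> simp [Matrix.mul_apply, mul_comm]

lemma torus_mul_upper (t : Fˣ) (x : F) : torus t * upper x = upper (t * t * x) * torus t := by
  ext i j; fin_cases i <;> fin_cases j <;> simp [Matrix.mul_apply]
  field_simp

lemma weyl_mul_torus (t : Fˣ) : weyl * torus t = torus t⁻¹ * weyl := by
  ext i j; fin_cases i <;> fin_cases j <;> simp [Matrix.mul_apply]

lemma weyl_inv : (weyl : SL(2, F))⁻¹ = weyl * torus (-1) := by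
  ext i j; fin_cases i <;> fin_cases j <;>
    simp [Matrix.SpecialLinearGroup.coe_inv, Matrix.adjugate_fin_two, Matrix.mul_apply]

lemma weyl_mul_upper_mul_weyl_inv (t : Fˣ) :
    weyl * upper (t : F) * weyl⁻¹ =
      upper (-(t⁻¹ : Fˣ) : F) * weyl * torus (-t) * upper (-(t⁻¹ : Fˣ) : F) := by
  ext i j; fin_cases i <;> fin_cases j <;>
    simp [Matrix.SpecialLinearGroup.coe_inv, Matrix.adjugate_fin_two, Matrix.mul_apply]

lemma eq_top_of_upper_mem_of_conj_mem {S : Subgroup SL(2, F)} (h : ∀ t, upper t ∈ S)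
    (h' : ∀ t, weyl * upper t * weyl⁻¹ ∈ S) : S = ⊤ := by
  refine (Subgroup.eq_top_iff' S).2 fun g =>
    Matrix.SL2.transvection_induction (· ∈ S) (fun i j hij c => ?_) (fun _ _ => mul_mem) g
  fin_cases i <;> fin_cases j
  · exact absurd rfl hij
  · convert h c
    ext i j; fin_cases i <;> fin_cases j <;>
      simp [Matrix.SpecialLinearGroup.transvection_coe]
  · convert h' (-c)
    ext i j; fin_cases i <;> fin_cases j <;>
      simp [Matrix.SpecialLinearGroup.transvection_coe, Matrix.SpecialLinearGroup.coe_inv,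
        Matrix.adjugate_fin_two, Matrix.mul_apply]
  · exact absurd rfl hij

lemma eq_top_of_upper_mem_of_weyl_mem {S : Subgroup SL(2, F)} (h : ∀ t, upper t ∈ S)
    (hw : weyl ∈ S) : S = ⊤ :=
  eq_top_of_upper_mem_of_conj_mem h fun t => mul_mem (mul_mem hw (h t)) (inv_mem hw)

lemma monoidHom_eq_one_of_upper {A : Type*} [MulOneClass A] {χ : SL(2, F) →* A}
    (h : ∀ t, χ (upper t) = 1) : χ = 1 :=
  χ.ker_eq_top_iff.1 <| eq_top_of_upper_mem_of_conj_mem h fun t => χ.normal_ker.conj_mem _ (h t) _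

lemma representation_eq_of_forall_eq_smul {k M : Type*} [Field k] [AddCommGroup M] [Module k M]
    [Nontrivial M] {R R' : Representation k SL(2, F) M} (h : ∀ g, ∃ c : k, R g = c • R' g)
    (hu : ∀ t, R (upper t) = R' (upper t)) : R = R' := by
  obtain ⟨χ, hχ⟩ := exists_monoidHom_of_forall_eq_smul h
  have h1 : χ = 1 := monoidHom_eq_one_of_upper fun t =>
    smul_left_injective k ((Group.isUnit (upper t)).map R').ne_zero (by
      simp only [← hχ, hu, one_smul])
  ext1 g
  rw [hχ, h1, MonoidHom.one_apply, one_smul]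

end Generators

/-! ### The operators of the Schrödinger model -/

section Schroedinger

variable {F : Type u} [Field F] {U : Type v} [AddCommGroup U] [Module F U] {Q : QuadSpace F U}

lemma coord_slToSp (g : SL(2, F)) (x y : U) (i : Fin 2) :
    coord F i ((Q.slToSp g).1 (x ⊗ₜ Pi.single 0 1 + y ⊗ₜ Pi.single 1 1)) =
      g.1 i 0 • x + g.1 i 1 • y := by
  simp [QuadSpace.slToSp, Matrix.SpecialLinearGroup.toLin'_apply, Matrix.toLin'_apply]

lemma coord_oToSp (o : Q.O) (x y : U) (i : Fin 2) :
    coord F i ((Q.oToSp o).1 (x ⊗ₜ Pi.single 0 1 + y ⊗ₜ Pi.single 1 1)) =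
      if i = 0 then o.1 x else o.1 y := by
  fin_cases i <;> simp [QuadSpace.oToSp]

variable [NeZero (2 : F)] {ψ : AddChar F ℂ}

variable (Q ψ) in
/-- The operator by which the element `x ⊗ e₀ + y ⊗ e₁` of the Heisenberg group acts. -/
def QuadSpace.heisOp (x y : U) : Module.End ℂ (U → ℂ) :=
  Q.heisRep ψ ⟨x ⊗ₜ Pi.single 0 1 + y ⊗ₜ Pi.single 1 1, 0⟩

lemma heisOp_apply (x y : U) (f : U → ℂ) (u : U) :
    Q.heisOp ψ x y f u = ψ (-Q.form x u - 2⁻¹ * Q.form x y) * f (u + y) := by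
  simp [QuadSpace.heisOp, QuadSpace.heisRep_apply]

lemma heisOp_zero : Q.heisOp ψ 0 0 = 1 :=
  LinearMap.ext fun f => funext fun u => by simp [heisOp_apply]

lemma heisOp_mul (x y x' y' : U) : Q.heisOp ψ x y * Q.heisOp ψ x' y' =
    ψ (2⁻¹ * (Q.form x y' - Q.form y x')) • Q.heisOp ψ (x + x') (y + y') := by
  rw [QuadSpace.heisOp, QuadSpace.heisOp, QuadSpace.heisOp, ← map_mul, ← heis_center]
  congr 1
  ext
  · simp [TensorProduct.add_tmul]; abel
  · simp [Q.sympl_coord, sub_eq_add_neg]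

lemma heisRep_eq_smul_heisOp (h : Heisenberg Q.sympl) :
    Q.heisRep ψ h = ψ h.z • Q.heisOp ψ (coord F 0 h.w) (coord F 1 h.w) := by
  rw [QuadSpace.heisOp, ← coord_decomp, ← heis_center]

lemma intertw_iff {g : Q.Sp} {A : Module.End ℂ (U → ℂ)} :
    Q.Intertw ψ g A ↔ ∀ x y : U, A * Q.heisOp ψ x y =
      Q.heisOp ψ (coord F 0 (g.1 (x ⊗ₜ Pi.single 0 1 + y ⊗ₜ Pi.single 1 1)))
        (coord F 1 (g.1 (x ⊗ₜ Pi.single 0 1 + y ⊗ₜ Pi.single 1 1))) * A := by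
  refine ⟨fun H x y => ?_, fun H h => ?_⟩
  · rw [QuadSpace.heisOp, H, heisRep_eq_smul_heisOp]
    simp [QuadSpace.actHeis]
  · rw [heisRep_eq_smul_heisOp, heisRep_eq_smul_heisOp, mul_smul_comm, smul_mul_assoc, H,
      ← coord_decomp]
    rfl

lemma intertw_slToSp_iff {g : SL(2, F)} {A : Module.End ℂ (U → ℂ)} :
    Q.Intertw ψ (Q.slToSp g) A ↔ ∀ x y : U, A * Q.heisOp ψ x y =
      Q.heisOp ψ (g.1 0 0 • x + g.1 0 1 • y) (g.1 1 0 • x + g.1 1 1 • y) * A := by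
  simp only [intertw_iff, coord_slToSp]

lemma intertw_oToSp_iff {o : Q.O} {A : Module.End ℂ (U → ℂ)} :
    Q.Intertw ψ (Q.oToSp o) A ↔ ∀ x y : U, A * Q.heisOp ψ x y =
      Q.heisOp ψ (o.1 x) (o.1 y) * A := by
  simp only [intertw_iff, coord_oToSp, if_true, one_ne_zero, if_false]

variable [Finite F] [Finite U] (hψ : ψ ≠ 1)

lemma osc_intertw (g : Q.Sp) : Q.Intertw ψ g (Q.osc hψ g) := fun h => by
  rw [← (Q.osc_isOscillator hψ).egorov g h, mul_assoc, ← map_mul, inv_mul_cancel, map_one, mul_one]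

lemma osc_ne_zero (g : Q.Sp) : Q.osc hψ g ≠ 0 :=
  ((Group.isUnit g).map (Q.osc hψ)).ne_zero

lemma oscG_mul_heisOp (g : SL(2, F)) (x y : U) :
    Q.oscG hψ g * Q.heisOp ψ x y =
      Q.heisOp ψ (g.1 0 0 • x + g.1 0 1 • y) (g.1 1 0 • x + g.1 1 1 • y) * Q.oscG hψ g :=
  intertw_slToSp_iff.1 (osc_intertw hψ _) x y

lemma oscG_upper_apply (t : F) (f : U → ℂ) (u : U) :
    Q.oscG hψ (upper t) f u = ψ (2⁻¹ * (t * Q.form u u)) * f u := by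
  have h := (Q.osc_isOscillator hψ).unipotent (Q.slToSp (upper t)) (t • LinearMap.id)
    (fun w => by
      rw [coord_decomp w, coord_slToSp, coord_slToSp]
      simp) f u
  rw [QuadSpace.oscG, MonoidHom.comp_apply, h]
  simp

lemma exists_eq_smul_oscO (o : Q.O) {A : Module.End ℂ (U → ℂ)}
    (h : ∀ x y : U, A * Q.heisOp ψ x y = Q.heisOp ψ (o.1 x) (o.1 y) * A) :
    ∃ c : ℂ, A = c • Q.oscO hψ o :=
  (osc_intertw hψ (Q.oToSp o)).eq_smul hψ (osc_ne_zero hψ _) (intertw_oToSp_iff.2 h)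

lemma exists_eq_smul_oscG (g : SL(2, F)) {A : Module.End ℂ (U → ℂ)}
    (h : ∀ x y : U, A * Q.heisOp ψ x y =
      Q.heisOp ψ (g.1 0 0 • x + g.1 0 1 • y) (g.1 1 0 • x + g.1 1 1 • y) * A) :
    ∃ c : ℂ, A = c • Q.oscG hψ g :=
  (osc_intertw hψ (Q.slToSp g)).eq_smul hψ (osc_ne_zero hψ _) (intertw_slToSp_iff.2 h)

/- The unipotent elements pin down the operators exactly, not only up to scalars, because a
character of `SL₂` is determined by its values on them. -/
lemma eq_oscG (R : Representation ℂ SL(2, F) (U → ℂ))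
    (h : ∀ g (x y : U), R g * Q.heisOp ψ x y =
      Q.heisOp ψ (g.1 0 0 • x + g.1 0 1 • y) (g.1 1 0 • x + g.1 1 1 • y) * R g)
    (hu : ∀ t f u, R (upper t) f u = ψ (2⁻¹ * (t * Q.form u u)) * f u) :
    R = Q.oscG hψ :=
  representation_eq_of_forall_eq_smul (fun g => exists_eq_smul_oscG hψ g (h g)) fun t =>
    LinearMap.ext fun f => funext fun u => by rw [hu, oscG_upper_apply]

end Schroedinger

/-! ### Orbits of pairs of vectors -/

section Orbits

lemma sum_apply_eq_card_nsmul_sum {G X M : Type*} [Group G] [Fintype G] [DecidableEq X]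
    [AddCommMonoid M] (φ : G →* Equiv.Perm X) (p : X) {Y : Finset X}
    (hY : ∀ y, (∃ g, φ g p = y) ↔ y ∈ Y) (f : X → M) :
    ∑ g, f (φ g p) = Fintype.card {g // φ g p = p} • ∑ y ∈ Y, f y := by
  have himage : Finset.univ.image (fun g => φ g p) = Y := by
    ext y
    simp [hY]
  rw [Finset.sum_comp f fun g => φ g p, himage, Finset.smul_sum]
  refine Finset.sum_congr rfl fun y hy => ?_
  obtain ⟨g₀, rfl⟩ := (hY y).2 hy
  rw [← Fintype.card_subtype]
  congr 1
  refine Fintype.card_congr ((Equiv.mulLeft g₀⁻¹).subtypeEquiv fun g => ?_)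
  rw [Equiv.coe_mulLeft, map_mul, Equiv.Perm.mul_apply, map_inv, Equiv.Perm.inv_eq_iff_eq]

variable {F : Type u} [Field F] {U : Type v} [AddCommGroup U] [Module F U]

/-- The action of `SL₂` on `U × U`, which is the action on `U ⊗ V` in the coordinates with respect
to the basis of `V`. -/
def pairAction : SL(2, F) →* Equiv.Perm (U × U) :=
  MonoidHom.toHomPerm
    { toFun := fun g p => (g.1 0 0 • p.1 + g.1 0 1 • p.2, g.1 1 0 • p.1 + g.1 1 1 • p.2)
      map_one' := funext fun p => Prod.ext (by simp; rfl) (by simp; rfl)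
      map_mul' := fun g h => funext fun p => by
        change _ = (g.1 0 0 • (h.1 0 0 • p.1 + h.1 0 1 • p.2) +
          g.1 0 1 • (h.1 1 0 • p.1 + h.1 1 1 • p.2), g.1 1 0 • (h.1 0 0 • p.1 + h.1 0 1 • p.2) +
          g.1 1 1 • (h.1 1 0 • p.1 + h.1 1 1 • p.2))
        ext <;> simp [Matrix.mul_apply] <;> module }

lemma pairAction_apply (g : SL(2, F)) (p : U × U) : pairAction g p =
    (g.1 0 0 • p.1 + g.1 0 1 • p.2, g.1 1 0 • p.1 + g.1 1 1 • p.2) := rfl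

lemma pairAction_zero (g : SL(2, F)) : pairAction g (0 : U × U) = 0 := by
  simp [pairAction_apply]

lemma pairAction_smul (g : SL(2, F)) (v : F × F) (z : U) :
    pairAction g (v.1 • z, v.2 • z) = ((pairAction g v).1 • z, (pairAction g v).2 • z) := by
  ext <;> simp [pairAction_apply] <;> module

lemma exists_pairAction_eq_iff {v : F × F} (hv : v ≠ 0) (v' : F × F) :
    (∃ g : SL(2, F), pairAction g v = v') ↔ v' ≠ 0 := by
  have hstd : ∀ w : F × F, w ≠ 0 → ∃ g : SL(2, F), pairAction g ((1, 0) : F × F) = w := by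
    rintro ⟨a, c⟩ h
    by_cases ha : a = 0
    · have hc : c ≠ 0 := fun hc => h (by simp [ha, hc])
      let g : SL(2, F) := ⟨!![a, -c⁻¹; c, 0], by simp [hc]⟩
      exact ⟨g, by rw [pairAction_apply]; simp [g]⟩
    · let g : SL(2, F) := ⟨!![a, 0; c, a⁻¹], by simp [ha]⟩
      exact ⟨g, by rw [pairAction_apply]; simp [g]⟩
  constructor
  · rintro ⟨g, rfl⟩ h
    exact hv ((pairAction g).injective (h.trans (pairAction_zero g).symm))
  · intro hv'
    obtain ⟨g, rfl⟩ := hstd v hv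
    obtain ⟨g', rfl⟩ := hstd v' hv'
    exact ⟨g' * g⁻¹, by
      rw [← Equiv.Perm.mul_apply, ← map_mul, inv_mul_cancel_right]⟩

lemma planeForm_smul_eq (x y z : Fin 2 → F) :
    planeForm F x y • z = planeForm F z y • x + planeForm F x z • y := by
  ext i
  fin_cases i <;> simp [planeForm_apply] <;> ring

lemma planeForm_pairAction (g : SL(2, F)) (p : (Fin 2 → F) × (Fin 2 → F)) :
    planeForm F (pairAction g p).1 (pairAction g p).2 = planeForm F p.1 p.2 := by
  have hdet := g.2
  rw [Matrix.det_fin_two] at hdet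
  simp only [planeForm_apply, pairAction_apply, Pi.add_apply, Pi.smul_apply, smul_eq_mul]
  linear_combination (p.1 0 * p.2 1 - p.1 1 * p.2 0) * hdet

lemma exists_pairAction_eq_iff_planeForm {p : (Fin 2 → F) × (Fin 2 → F)}
    (hp : planeForm F p.1 p.2 ≠ 0) (p' : (Fin 2 → F) × (Fin 2 → F)) :
    (∃ g : SL(2, F), pairAction g p = p') ↔ planeForm F p'.1 p'.2 = planeForm F p.1 p.2 := by
  constructor
  · rintro ⟨g, rfl⟩
    exact planeForm_pairAction g p
  · intro h
    obtain ⟨x, y⟩ := p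
    obtain ⟨x', y'⟩ := p'
    dsimp only at h hp
    set d := planeForm F x y with hd
    have hcoord (z : Fin 2 → F) : (planeForm F z y / d) • x + (planeForm F x z / d) • y = z := by
      rw [div_eq_inv_mul, div_eq_inv_mul, mul_smul, mul_smul, ← smul_add, ← planeForm_smul_eq,
        ← hd, inv_smul_smul₀ hp]
    refine ⟨⟨!![planeForm F x' y / d, planeForm F x x' / d;
      planeForm F y' y / d, planeForm F x y' / d], ?_⟩, Prod.ext (hcoord x') (hcoord y')⟩
    have hplucker : planeForm F x' y * planeForm F x y' - planeForm F x x' * planeForm F y' y =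
        planeForm F x' y' * planeForm F x y := by
      simp only [planeForm_apply]; ring
    rw [Matrix.det_fin_two_of, div_mul_div_comm, div_mul_div_comm, ← sub_div, hplucker, h, ← hd,
      div_self (mul_ne_zero hp hp)]

end Orbits

/-! ### The commutant of `SL₂` -/

section Commutant

variable {F : Type u} [Field F] {U : Type v} [AddCommGroup U] [Module F U] [NeZero (2 : F)]
  {Q : QuadSpace F U} {ψ : AddChar F ℂ}

lemma sum_smul_heisOp_eq_single [Fintype U] [DecidableEq U] (hψ : ψ ≠ 1) (u v : U) :
    ∑ x, ψ (Q.form x u + 2⁻¹ * Q.form x (v - u)) • Q.heisOp ψ x (v - u) =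
      (Fintype.card U : ℂ) •
        (LinearMap.single ℂ (fun _ : U => ℂ) u ∘ₗ LinearMap.proj v) := by
  refine LinearMap.ext fun f => funext fun w => ?_
  have hphase (x : U) : Q.form x u + 2⁻¹ * Q.form x (v - u) +
      (-Q.form x w - 2⁻¹ * Q.form x (v - u)) = Q.form (u - w) x := by
    rw [Q.symm (u - w), map_sub (Q.form x) u w]; ring
  simp only [LinearMap.sum_apply, Finset.sum_apply, LinearMap.smul_apply, Pi.smul_apply,
    heisOp_apply, smul_eq_mul, ← mul_assoc, ← AddChar.map_add_eq_mul, hphase, ← Finset.sum_mul]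
  by_cases hw : w = u
  · subst hw
    simp
  · rw [sum_form_char hψ (sub_ne_zero.2 (Ne.symm hw))]
    simp [hw]

lemma span_range_heisOp [Finite U] (hψ : ψ ≠ 1) :
    Submodule.span ℂ (Set.range fun p : U × U => Q.heisOp ψ p.1 p.2) = ⊤ := by
  classical
  have := Fintype.ofFinite U
  refine Submodule.eq_top_iff'.2 fun A => ?_
  set S := Submodule.span ℂ (Set.range fun p : U × U => Q.heisOp ψ p.1 p.2)
  have hsingle (u v : U) : LinearMap.single ℂ (fun _ : U => ℂ) u ∘ₗ LinearMap.proj v ∈ S := by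
    rw [← Submodule.smul_mem_iff S (Nat.cast_ne_zero.2 Fintype.card_ne_zero :
      (Fintype.card U : ℂ) ≠ 0), ← sum_smul_heisOp_eq_single (Q := Q) hψ]
    exact S.sum_mem fun x _ => S.smul_mem _ (Submodule.subset_span ⟨(x, v - u), rfl⟩)
  have hA : A = ∑ u, ∑ v, A (Pi.single v 1) u •
      (LinearMap.single ℂ (fun _ : U => ℂ) u ∘ₗ LinearMap.proj v) := by
    refine sub_eq_zero.1 (end_eq_zero fun v => funext fun u => ?_)
    simp [Pi.single_apply, Finset.sum_apply]
  rw [hA]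
  exact S.sum_mem fun u _ => S.sum_mem fun v _ => S.smul_mem _ (hsingle u v)

variable [Finite F] [Finite U] (hψ : ψ ≠ 1)

lemma oscG_mul_heisOp_pair (g : SL(2, F)) (p : U × U) :
    Q.oscG hψ g * Q.heisOp ψ p.1 p.2 =
      Q.heisOp ψ (pairAction g p).1 (pairAction g p).2 * Q.oscG hψ g :=
  oscG_mul_heisOp hψ g p.1 p.2

/- Averaging over `SL₂` fixes its commutant, and the averages of the Heisenberg operators, which
span all operators, are the sums over orbits. -/
lemma mem_of_commute_oscG [Fintype SL(2, F)] {S : Submodule ℂ (Module.End ℂ (U → ℂ))}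
    (hS : ∀ p : U × U,
      ∑ g : SL(2, F), Q.heisOp ψ (pairAction g p).1 (pairAction g p).2 ∈ S)
    {A : Module.End ℂ (U → ℂ)} (hA : ∀ g, A * Q.oscG hψ g = Q.oscG hψ g * A) : A ∈ S := by
  let avg : Module.End ℂ (U → ℂ) →ₗ[ℂ] Module.End ℂ (U → ℂ) :=
    ∑ g, LinearMap.mulLeftRight ℂ (Q.oscG hψ g, Q.oscG hψ g⁻¹)
  have havg (B) : avg B = ∑ g, Q.oscG hψ g * B * Q.oscG hψ g⁻¹ := by
    simp [avg, LinearMap.sum_apply]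
  have hinv (g) : Q.oscG hψ g * Q.oscG hψ g⁻¹ = 1 := by
    rw [← map_mul, mul_inv_cancel, map_one]
  have hle : ⊤ ≤ S.comap avg := by
    rw [← span_range_heisOp (Q := Q) hψ, Submodule.span_le]
    rintro _ ⟨p, rfl⟩
    rw [SetLike.mem_coe, Submodule.mem_comap, havg]
    simp only [oscG_mul_heisOp_pair, mul_assoc, hinv, mul_one]
    exact hS p
  have havgA : avg A = (Fintype.card SL(2, F) : ℂ) • A := by
    simp only [havg, ← hA, mul_assoc, hinv, mul_one]
    rw [Finset.sum_const, Finset.card_univ, Nat.cast_smul_eq_nsmul]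
  rw [← Submodule.smul_mem_iff S (Nat.cast_ne_zero.2 Fintype.card_ne_zero :
    (Fintype.card SL(2, F) : ℂ) ≠ 0), ← havgA]
  exact hle Submodule.mem_top

variable (Q) in
/-- The operators that agree on the `k`-spectrum with a linear combination of the operators of
`O_β`. -/
def specAgree (k : ℕ) : Submodule ℂ (Module.End ℂ (U → ℂ)) where
  carrier := {A | ∃ a ∈ Submodule.span ℂ (Set.range (Q.oscO hψ)), ∀ f ∈ Q.spec hψ k, A f = a f}
  add_mem' := by
    rintro A B ⟨a, ha, hA⟩ ⟨b, hb, hB⟩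
    exact ⟨a + b, add_mem ha hb, fun f hf => by
      rw [LinearMap.add_apply, LinearMap.add_apply, hA f hf, hB f hf]⟩
  zero_mem' := ⟨0, zero_mem _, fun f _ => rfl⟩
  smul_mem' := by
    rintro c A ⟨a, ha, hA⟩
    exact ⟨c • a, Submodule.smul_mem _ c ha, fun f hf => by
      rw [LinearMap.smul_apply, LinearMap.smul_apply, hA f hf]⟩

variable (Q) in
/-- Every operator that commutes with `SL₂` agrees on the `k`-spectrum with a combination of the
operators of `O_β`; the correspondence follows from this formally. -/
def HasSpecCommutant (k : ℕ) : Prop :=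
  ∀ A : Module.End ℂ (U → ℂ), (∀ g, A * Q.oscG hψ g = Q.oscG hψ g * A) → A ∈ specAgree Q hψ k

lemma oscO_mem_specAgree (k : ℕ) (o : Q.O) : Q.oscO hψ o ∈ specAgree Q hψ k :=
  ⟨_, Submodule.subset_span ⟨o, rfl⟩, fun _ _ => rfl⟩

lemma one_mem_specAgree (k : ℕ) : 1 ∈ specAgree Q hψ k :=
  map_one (Q.oscO hψ) ▸ oscO_mem_specAgree hψ k 1

/- An operator into the invariants of `SL₂` kills the spectrum of positive rank. -/
lemma mem_specAgree_of_invariant {k : ℕ} (hk : 0 < k) {B : Module.End ℂ (U → ℂ)}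
    (hB : ∀ g, B * Q.oscG hψ g = Q.oscG hψ g * B) (hinv : ∀ g f, Q.oscG hψ g (B f) = B f) :
    B ∈ specAgree Q hψ k := by
  refine ⟨0, zero_mem _, fun f hf => ?_⟩
  suffices h : Q.spec hψ k ≤ LinearMap.ker B from h hf
  refine sSup_le ?_
  rintro S ⟨M, i1, i2, ρ, φ, hρ, rfl⟩
  have := hρ.1
  let B' : IntertwiningMap (Q.oscG hψ) (Q.oscG hψ) := ⟨B, hB⟩
  rcases Representation.IsIrreducible.injective_or_eq_zero (B'.comp φ) with h | h
  · have htriv (g m) : ρ g m = m := h (by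
      rw [IntertwiningMap.isIntertwining]; exact hinv g _)
    have hfinrank := finrank_eq_one_of_isIrreducible_of_trivial hρ.1 htriv
    have := Module.finite_of_finrank_eq_succ hfinrank
    have e : M ≃ₗ[ℂ] ℂ := LinearEquiv.ofFinrankEq _ _ (hfinrank.trans (Module.finrank_self ℂ).symm)
    refine absurd ⟨0, le_rfl, ℂ, _, _, _, IsHalfProduct.zero, ⟨e.toLinearMap, fun g => ?_⟩,
      e.injective⟩ (hρ.2.2 0 hk)
    ext m
    simp [htriv]
  · rintro _ ⟨m, rfl⟩
    exact congrArg (fun χ : IntertwiningMap ρ (Q.oscG hψ) => χ m) h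

/-- A linear map that preserves the form, as an element of `O_β`; it is bijective because the form
is non-degenerate and `U` is finite. -/
def mkIsometry (L : U →ₗ[F] U) (hL : ∀ x y, Q.form (L x) (L y) = Q.form x y) : Q.O :=
  ⟨LinearEquiv.ofBijective L (by
    have hi : Function.Injective L := (injective_iff_map_eq_zero L).2 fun x hx =>
      Q.nondeg x fun y => by rw [← hL, hx]; simp
    exact ⟨hi, Finite.surjective_of_injective hi⟩), hL⟩

lemma mem_specAgree_of_isometry (k : ℕ) {L : U →ₗ[F] U}
    (hL : ∀ x y, Q.form (L x) (L y) = Q.form x y) {A : Module.End ℂ (U → ℂ)}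
    (hA : ∀ x y, A * Q.heisOp ψ x y = Q.heisOp ψ (L x) (L y) * A) : A ∈ specAgree Q hψ k := by
  obtain ⟨c, rfl⟩ := exists_eq_smul_oscO hψ (mkIsometry L hL) hA
  exact Submodule.smul_mem _ c (oscO_mem_specAgree hψ k _)

/- The sum of the Heisenberg operators over an anisotropic line is a multiple of the operator of
the reflection in that line. -/
lemma sum_line_mem_specAgree_of_anisotropic [Fintype F] (k : ℕ) {z : U} (hz : Q.form z z ≠ 0) :
    ∑ v : F × F, Q.heisOp ψ (v.1 • z) (v.2 • z) ∈ specAgree Q hψ k := by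
  let L : U →ₗ[F] U := LinearMap.id - (2 / Q.form z z) • (Q.form z).smulRight z
  have hLapply (x : U) : L x = x - (2 / Q.form z z * Q.form z x) • z := by
    simp [L, smul_smul]
  have hL (x y : U) : Q.form (L x) (L y) = Q.form x y := by
    simp only [hLapply, map_sub, LinearMap.sub_apply, map_smul, LinearMap.smul_apply, smul_eq_mul,
      Q.symm x z]
    field_simp
    ring
  refine mem_specAgree_of_isometry hψ k hL fun x y => ?_
  rw [Finset.sum_mul, Finset.mul_sum]
  refine Fintype.sum_equiv (Equiv.addRight (2 / Q.form z z * Q.form z x,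
    2 / Q.form z z * Q.form z y)) _ _ fun v => ?_
  have hshift (a b : F) (x : U) : x - b • z + (a + b) • z = a • z + x := by module
  rw [heisOp_mul, heisOp_mul, hLapply, hLapply]
  simp only [Equiv.coe_addRight, Prod.fst_add, Prod.snd_add, hshift]
  congr 2
  simp only [map_sub, LinearMap.sub_apply, map_smul, LinearMap.smul_apply, smul_eq_mul,
    Q.symm x z, Q.symm y z]
  field_simp
  ring

lemma sum_pairAction_mem_specAgree_of_line [Fintype F] [Fintype SL(2, F)] {k : ℕ} {z : U}
    (hz : ∑ v : F × F, Q.heisOp ψ (v.1 • z) (v.2 • z) ∈ specAgree Q hψ k) (v : F × F) :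
    ∑ g : SL(2, F), Q.heisOp ψ (pairAction g (v.1 • z, v.2 • z)).1
      (pairAction g (v.1 • z, v.2 • z)).2 ∈ specAgree Q hψ k := by
  classical
  simp only [pairAction_smul]
  by_cases hv : v = 0
  · simp only [hv, pairAction_zero, Prod.fst_zero, Prod.snd_zero, zero_smul, heisOp_zero]
    exact Submodule.sum_mem _ fun _ _ => one_mem_specAgree hψ k
  · rw [sum_apply_eq_card_nsmul_sum pairAction v (Y := Finset.univ.erase 0)
      (fun w => by simp [exists_pairAction_eq_iff hv])
      fun w : F × F => Q.heisOp ψ (w.1 • z) (w.2 • z),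
      Finset.sum_erase_eq_sub (Finset.mem_univ _)]
    refine nsmul_mem (sub_mem hz ?_) _
    simpa [heisOp_zero] using one_mem_specAgree hψ k

end Commutant

/-! ### The commutant of `SL₂` for binary forms -/

section Plane

variable {F : Type u} [Field F] {Q : QuadSpace F (Fin 2 → F)}

lemma planeForm_self (x : Fin 2 → F) : planeForm F x x = 0 := by
  rw [planeForm_apply]; ring

lemma neg_planeForm (x y : Fin 2 → F) : -planeForm F x y = planeForm F y x := by
  rw [planeForm_apply, planeForm_apply]; ring

lemma eq_zero_of_planeForm {x : Fin 2 → F} (h : ∀ y, planeForm F x y = 0) : x = 0 := by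
  ext i
  fin_cases i
  · simpa [planeForm_apply] using h (Pi.single 1 1)
  · simpa [planeForm_apply] using h (Pi.single 0 1)

lemma planeForm_map_map (L : Module.End F (Fin 2 → F)) (x y : Fin 2 → F) :
    planeForm F (L x) (L y) = LinearMap.det L * planeForm F x y := by
  obtain ⟨M, rfl⟩ := Matrix.toLin'.surjective L
  simp only [LinearMap.det_toLin', Matrix.det_fin_two, planeForm_apply, Matrix.toLin'_apply,
    Matrix.mulVec, dotProduct, Fin.sum_univ_two]
  ring

lemma exists_eq_smul_of_planeForm_eq_zero {l x : Fin 2 → F} (hl : l ≠ 0)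
    (h : planeForm F l x = 0) : ∃ a : F, x = a • l := by
  obtain ⟨y, hy⟩ : ∃ y, planeForm F l y ≠ 0 := by
    by_contra! hzero
    exact hl (eq_zero_of_planeForm hzero)
  refine ⟨planeForm F x y / planeForm F l y, ?_⟩
  rw [div_eq_inv_mul, mul_smul, eq_inv_smul_iff₀ hy, planeForm_smul_eq l y x, h, zero_smul,
    add_zero]

lemma exists_eq_smul_pair_of_planeForm_eq_zero {p : (Fin 2 → F) × (Fin 2 → F)}
    (h : planeForm F p.1 p.2 = 0) : ∃ z ≠ 0, ∃ v : F × F, p = (v.1 • z, v.2 • z) := by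
  by_cases h1 : p.1 = 0
  · by_cases h2 : p.2 = 0
    · exact ⟨1, one_ne_zero, 0, by ext <;> simp [h1, h2]⟩
    · exact ⟨p.2, h2, (0, 1), by ext <;> simp [h1]⟩
  · obtain ⟨a, ha⟩ := exists_eq_smul_of_planeForm_eq_zero h1 h
    exact ⟨p.1, h1, (1, a), by ext <;> simp [ha]⟩

lemma exists_eq_smul_of_form_eq_zero {l x : Fin 2 → F} (hl : l ≠ 0) (hll : Q.form l l = 0)
    (h : Q.form l x = 0) : ∃ a : F, x = a • l := by
  refine exists_eq_smul_of_planeForm_eq_zero hl (by_contra fun hlx => hl (Q.nondeg l fun y => ?_))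
  have hy := congrArg (Q.form l) (planeForm_smul_eq l x y)
  simpa [hll, h, hlx] using hy

variable (Q) in
/-- The linear map `J` with `β (J x) y = ⟨x, y⟩`, which compares the symmetric form `β` on the plane
with the area form. -/
def QuadSpace.rotation : Module.End F (Fin 2 → F) :=
  LinearMap.BilinForm.symmCompOfNondegenerate (planeForm F) Q.form
    ((LinearMap.IsRefl.nondegenerate_iff_separatingLeft fun x y h => (Q.symm y x).trans h).2
      Q.nondeg)

lemma form_rotation_left (x y : Fin 2 → F) : Q.form (Q.rotation x) y = planeForm F x y :=
  LinearMap.BilinForm.symmCompOfNondegenerate_left_apply _ _ _ _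

lemma form_rotation_right (x y : Fin 2 → F) : Q.form x (Q.rotation y) = -planeForm F x y := by
  rw [Q.symm, form_rotation_left, neg_planeForm]

lemma rotation_rotation (x : Fin 2 → F) :
    Q.rotation (Q.rotation x) = -(LinearMap.det Q.rotation • x) := by
  refine eq_neg_of_add_eq_zero_left (eq_zero_of_planeForm fun y => ?_)
  rw [map_add, LinearMap.add_apply, map_smul, LinearMap.smul_apply, smul_eq_mul,
    ← planeForm_map_map, ← form_rotation_left (Q := Q) (Q.rotation (Q.rotation x)) y,
    form_rotation_left, ← neg_neg (planeForm F _ y), ← form_rotation_right (Q := Q),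
    form_rotation_left, neg_add_cancel]

variable (Q) in
/-- The map `1 / 2 + c J`. The quotient of `cayley c` and `cayley (-c)` is an isometry of `β`, the
Cayley transform of `2 c J`. -/
def QuadSpace.cayley (c : F) : Module.End F (Fin 2 → F) := (2⁻¹ : F) • 1 + c • Q.rotation

lemma cayley_apply (c : F) (x : Fin 2 → F) :
    Q.cayley c x = (2⁻¹ : F) • x + c • Q.rotation x := rfl

lemma form_cayley_left (c : F) (x y : Fin 2 → F) :
    Q.form (Q.cayley c x) y = Q.form x (Q.cayley (-c) y) := by
  simp only [cayley_apply, map_add, map_smul, LinearMap.add_apply, LinearMap.smul_apply,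
    form_rotation_left, form_rotation_right, smul_eq_mul]
  ring

lemma cayley_cayley_neg (c : F) (x : Fin 2 → F) :
    Q.cayley c (Q.cayley (-c) x) =
      (2⁻¹ ^ 2 + c ^ 2 * LinearMap.det Q.rotation) • x := by
  simp only [cayley_apply, map_add, map_smul, rotation_rotation]
  module

lemma cayley_neg_cayley (c : F) (x : Fin 2 → F) :
    Q.cayley (-c) (Q.cayley c x) =
      (2⁻¹ ^ 2 + c ^ 2 * LinearMap.det Q.rotation) • x := by
  rw [← neg_sq c, ← cayley_cayley_neg, neg_neg]

lemma form_cayley_cayley (c : F) (x y : Fin 2 → F) :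
    Q.form (Q.cayley c x) (Q.cayley c y) =
      (2⁻¹ ^ 2 + c ^ 2 * LinearMap.det Q.rotation) * Q.form x y := by
  rw [form_cayley_left, cayley_neg_cayley, map_smul, smul_eq_mul]

lemma planeForm_eq_of_form_eq_of_comm {L : Module.End F (Fin 2 → F)}
    (hL : ∀ x y, Q.form (L x) (L y) = Q.form x y)
    (hcomm : ∀ x, Q.rotation (L x) = L (Q.rotation x)) (x y : Fin 2 → F) :
    planeForm F (L x) (L y) = planeForm F x y := by
  rw [← form_rotation_left (Q := Q), hcomm, hL, form_rotation_left]

variable [NeZero (2 : F)]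

lemma exists_cayley_ne_zero (c : F) : ∃ x, Q.cayley c x ≠ 0 := by
  by_contra! h
  have hneg (y : Fin 2 → F) : Q.cayley (-c) y = 0 := Q.nondeg _ fun x => by
    rw [form_cayley_left, neg_neg, h, map_zero]
  have hsum : Q.cayley c 1 + Q.cayley (-c) 1 = 1 := by
    have htwo : (2⁻¹ + 2⁻¹ : F) = 1 := by
      rw [← two_mul, mul_inv_cancel₀ (NeZero.ne (2 : F))]
    rw [cayley_apply, cayley_apply, add_add_add_comm, ← add_smul, htwo, one_smul, neg_smul,
      add_neg_cancel, add_zero]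
  rw [h, hneg, add_zero] at hsum
  exact zero_ne_one hsum

variable {ψ : AddChar F ℂ}

section AreaSum

variable [Fintype F]

variable (Q ψ) in
/-- The sum of the Heisenberg operators weighted by a character of the area. -/
def QuadSpace.areaSum (c : F) : Module.End ℂ ((Fin 2 → F) → ℂ) :=
  ∑ p : (Fin 2 → F) × (Fin 2 → F), ψ (c * planeForm F p.1 p.2) • Q.heisOp ψ p.1 p.2

lemma areaSum_mul_heisOp (c : F) (x y : Fin 2 → F) :
    Q.areaSum ψ c * Q.heisOp ψ x y =
      ∑ p : (Fin 2 → F) × (Fin 2 → F), ψ (c * planeForm F p.1 p.2 + c * planeForm F x y +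
        (Q.form p.1 (Q.cayley c y) - Q.form p.2 (Q.cayley c x))) • Q.heisOp ψ p.1 p.2 := by
  rw [QuadSpace.areaSum, Finset.sum_mul]
  refine Fintype.sum_equiv (Equiv.addRight (x, y)) _ _ fun p => ?_
  rw [smul_mul_assoc, heisOp_mul, smul_smul, ← AddChar.map_add_eq_mul]
  simp only [Equiv.coe_addRight, Prod.fst_add, Prod.snd_add]
  congr 2
  simp only [cayley_apply, map_add, map_smul, LinearMap.add_apply, smul_eq_mul,
    form_rotation_right, Q.symm y x]
  rw [← neg_planeForm x y, ← neg_planeForm p.2 x]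
  ring

lemma heisOp_mul_areaSum (c : F) (x y : Fin 2 → F) :
    Q.heisOp ψ x y * Q.areaSum ψ c =
      ∑ p : (Fin 2 → F) × (Fin 2 → F), ψ (c * planeForm F p.1 p.2 + c * planeForm F x y +
        (Q.form p.2 (Q.cayley (-c) x) - Q.form p.1 (Q.cayley (-c) y))) •
          Q.heisOp ψ p.1 p.2 := by
  rw [QuadSpace.areaSum, Finset.mul_sum]
  refine Fintype.sum_equiv (Equiv.addLeft (x, y)) _ _ fun p => ?_
  rw [mul_smul_comm, heisOp_mul, smul_smul, ← AddChar.map_add_eq_mul]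
  simp only [Equiv.coe_addLeft, Prod.fst_add, Prod.snd_add]
  congr 2
  simp only [cayley_apply, map_add, map_smul, LinearMap.add_apply, smul_eq_mul,
    form_rotation_right, Q.symm y x, Q.symm p.1 y, Q.symm p.2 x]
  rw [← neg_planeForm x y, ← neg_planeForm p.2 x]
  ring

lemma card_smul_sum_planeForm_eq [DecidableEq F] (hψ : ψ ≠ 1) (d : F) :
    (Fintype.card F : ℂ) • ∑ p : (Fin 2 → F) × (Fin 2 → F) with planeForm F p.1 p.2 = d,
      Q.heisOp ψ p.1 p.2 = ∑ c : F, ψ (-(c * d)) • Q.areaSum ψ c := by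
  simp only [QuadSpace.areaSum, Finset.smul_sum, smul_smul, ← AddChar.map_add_eq_mul]
  rw [Finset.sum_comm, Finset.sum_filter]
  refine Finset.sum_congr rfl fun p _ => ?_
  have hphase (c : F) : -(c * d) + c * planeForm F p.1 p.2 = c * (planeForm F p.1 p.2 - d) := by
    ring
  rw [← Finset.sum_smul]
  simp only [hphase]
  rw [AddChar.sum_mulShift _ (AddChar.IsPrimitive.of_ne_one hψ)]
  simp only [sub_eq_zero]
  split_ifs <;> simp

end AreaSum

variable [Finite F] (hψ : ψ ≠ 1)

variable (Q) in
/-- The functions invariant under the Heisenberg operators of `l ⊗ V`, as a subrepresentation of the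
oscillator representation of `SL₂`. -/
def lineInvariants (l : Fin 2 → F) : Subrepresentation (Q.oscG hψ) where
  toSubmodule :=
    { carrier := {f | ∀ v : F × F, Q.heisOp ψ (v.1 • l) (v.2 • l) f = f}
      add_mem' := fun hf hf' v => by rw [map_add, hf, hf']
      zero_mem' := fun v => map_zero _
      smul_mem' := fun c f hf v => by rw [map_smul, hf] }
  apply_mem_toSubmodule g f hf v := by
    obtain ⟨w, rfl⟩ := (pairAction g).surjective v
    have h := LinearMap.congr_fun (oscG_mul_heisOp_pair (Q := Q) hψ g (w.1 • l, w.2 • l)) f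
    rw [Module.End.mul_apply, Module.End.mul_apply, hf, pairAction_smul] at h
    exact h.symm

section Isotropic

variable {l : Fin 2 → F} (hl : l ≠ 0) (hll : Q.form l l = 0)
include hl hll

/- Multiplication by the characters `u ↦ ψ (a β(l, u))` forces the support into the line, and
translation along the line leaves only the value at the origin free. -/
lemma eq_zero_of_mem_lineInvariants {f : (Fin 2 → F) → ℂ}
    (hf : f ∈ (lineInvariants Q hψ l).toSubmodule) (hf0 : f 0 = 0) : f = 0 := by
  funext u
  by_cases hu : Q.form l u = 0
  · obtain ⟨b, rfl⟩ := exists_eq_smul_of_form_eq_zero hl hll hu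
    have h := congrFun (hf (0, b)) 0
    rw [heisOp_apply] at h
    simpa only [zero_smul, map_zero, LinearMap.zero_apply, neg_zero, mul_zero, sub_zero, zero_add,
      AddChar.map_zero_eq_one, one_mul, hf0, Pi.zero_apply] using h
  · obtain ⟨a, ha⟩ : ∃ a, ψ a ≠ 1 := AddChar.ne_one_iff.1 hψ
    have h := congrFun (hf (-(a / Q.form l u), 0)) u
    rw [heisOp_apply] at h
    have hfu : ψ a * f u = f u := by simpa [hu] using h
    exact (mul_left_eq_self₀.1 hfu).resolve_left ha

/- Evaluation at the origin embeds the invariants into `ℂ`, so that `SL₂` acts on them by scalars;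
the scalar of a unipotent element is `1`. -/
lemma oscG_eq_of_mem_lineInvariants {f : (Fin 2 → F) → ℂ}
    (hf : f ∈ (lineInvariants Q hψ l).toSubmodule) (g : SL(2, F)) : Q.oscG hψ g f = f := by
  by_cases hf0 : f = 0
  · rw [hf0, map_zero]
  have heq {f₁ f₂ : (lineInvariants Q hψ l).toSubmodule} (h : f₁.1 0 = f₂.1 0) : f₁ = f₂ :=
    Subtype.ext (sub_eq_zero.1 (eq_zero_of_mem_lineInvariants hψ hl hll (sub_mem f₁.2 f₂.2)
      (sub_eq_zero.2 h)))
  have hval : f 0 ≠ 0 := fun h => hf0 (eq_zero_of_mem_lineInvariants hψ hl hll hf h)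
  have : Nontrivial (lineInvariants Q hψ l).toSubmodule :=
    ⟨⟨f, hf⟩, 0, fun h => hf0 (congrArg Subtype.val h)⟩
  have htriv : (lineInvariants Q hψ l).toRepresentation = 1 :=
    representation_eq_of_forall_eq_smul
      (fun g => ⟨Q.oscG hψ g f 0 / f 0, LinearMap.ext fun f' => heq ?_⟩)
      fun t => LinearMap.ext fun f' => heq ?_
  · exact congrArg Subtype.val (LinearMap.congr_fun (DFunLike.congr_fun htriv g) ⟨f, hf⟩)
  · change Q.oscG hψ g f'.1 0 = Q.oscG hψ g f 0 / f 0 * f'.1 0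
    have hf' : f'.1 = (f'.1 0 / f 0) • f := congrArg Subtype.val
      (heq (f₂ := (f'.1 0 / f 0) • ⟨f, hf⟩) (div_mul_cancel₀ _ hval).symm)
    conv_lhs => rw [hf', map_smul]
    rw [Pi.smul_apply, smul_eq_mul, div_mul_comm]
  · change Q.oscG hψ (upper t) f'.1 0 = f'.1 0
    rw [oscG_upper_apply]
    simp

/- The sum is a multiple of the projection onto the functions invariant under `l ⊗ V`. -/
lemma sum_line_mem_specAgree_of_isotropic [Fintype F] {k : ℕ} (hk : 0 < k) :
    ∑ v : F × F, Q.heisOp ψ (v.1 • l) (v.2 • l) ∈ specAgree Q hψ k := by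
  refine mem_specAgree_of_invariant hψ hk (fun g => ?_) fun g f =>
    oscG_eq_of_mem_lineInvariants hψ hl hll (fun w => ?_) g
  · rw [Finset.sum_mul, Finset.mul_sum]
    refine (Fintype.sum_equiv (pairAction g) _ _ fun v => ?_).symm
    rw [oscG_mul_heisOp_pair hψ g (v.1 • l, v.2 • l), pairAction_smul]
  · rw [LinearMap.sum_apply, map_sum]
    refine Fintype.sum_equiv (Equiv.addLeft w) _ _ fun v => ?_
    rw [← Module.End.mul_apply, heisOp_mul]
    simp [hll, add_smul]

end Isotropic

section

variable [Fintype F]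

lemma areaSum_mul_oscG (c : F) (g : SL(2, F)) :
    Q.areaSum ψ c * Q.oscG hψ g = Q.oscG hψ g * Q.areaSum ψ c := by
  rw [QuadSpace.areaSum, Finset.sum_mul, Finset.mul_sum]
  refine (Fintype.sum_equiv (pairAction g) _ _ fun p => ?_).symm
  rw [mul_smul_comm, oscG_mul_heisOp_pair, smul_mul_assoc, planeForm_pairAction]

lemma areaSum_mem_lineInvariants {c : F} {l : Fin 2 → F} (hl : Q.cayley (-c) l = 0)
    (f : (Fin 2 → F) → ℂ) : Q.areaSum ψ c f ∈ (lineInvariants Q hψ l).toSubmodule := by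
  intro v
  rw [← Module.End.mul_apply, heisOp_mul_areaSum]
  simp [hl, planeForm_self, QuadSpace.areaSum]

/- If `cayley (-c)` is invertible, commuting a Heisenberg operator past the sum applies the quotient
of `cayley c` and `-cayley (-c)`, an isometry. Otherwise the sum is invariant under `l ⊗ V` for an
isotropic vector `l`. -/
lemma areaSum_mem_specAgree {k : ℕ} (hk : 0 < k) (c : F) : Q.areaSum ψ c ∈ specAgree Q hψ k := by
  set m : F := 2⁻¹ ^ 2 + c ^ 2 * LinearMap.det Q.rotation with hm
  by_cases hm0 : m = 0
  · obtain ⟨x, hx⟩ := exists_cayley_ne_zero (Q := Q) c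
    have hll : Q.form (Q.cayley c x) (Q.cayley c x) = 0 := by
      rw [form_cayley_cayley, ← hm, hm0, zero_mul]
    have hker : Q.cayley (-c) (Q.cayley c x) = 0 := by
      rw [cayley_neg_cayley, ← hm, hm0, zero_smul]
    exact mem_specAgree_of_invariant hψ hk (areaSum_mul_oscG hψ c) fun g f =>
      oscG_eq_of_mem_lineInvariants hψ hx hll (areaSum_mem_lineInvariants hψ hker f) g
  · let L : Module.End F (Fin 2 → F) := (-m⁻¹) • (Q.cayley c * Q.cayley c)
    have hLapply (x : Fin 2 → F) : L x = (-m⁻¹) • Q.cayley c (Q.cayley c x) := rfl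
    have hL (x y : Fin 2 → F) : Q.form (L x) (L y) = Q.form x y := by
      simp only [hLapply, map_smul, LinearMap.smul_apply, smul_eq_mul, form_cayley_cayley, ← hm]
      field_simp
    have hcomm (x : Fin 2 → F) : Q.rotation (L x) = L (Q.rotation x) := by
      simp only [hLapply, cayley_apply, map_add, map_smul]
    have hcayley (x : Fin 2 → F) : Q.cayley (-c) (L x) = -Q.cayley c x := by
      rw [hLapply, map_smul, cayley_neg_cayley, ← hm, neg_smul, inv_smul_smul₀ hm0]
    refine mem_specAgree_of_isometry hψ k hL fun x y => ?_
    rw [areaSum_mul_heisOp, heisOp_mul_areaSum, planeForm_eq_of_form_eq_of_comm hL hcomm]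
    refine Finset.sum_congr rfl fun p _ => ?_
    rw [hcayley, hcayley, map_neg, map_neg, neg_sub_neg]

end

lemma sum_pairAction_mem_specAgree_plane [Fintype SL(2, F)] {k : ℕ} (hk : 0 < k)
    (p : (Fin 2 → F) × (Fin 2 → F)) :
    ∑ g : SL(2, F), Q.heisOp ψ (pairAction g p).1 (pairAction g p).2 ∈ specAgree Q hψ k := by
  classical
  have := Fintype.ofFinite F
  by_cases hp : planeForm F p.1 p.2 = 0
  · obtain ⟨z, hz, v, rfl⟩ := exists_eq_smul_pair_of_planeForm_eq_zero hp
    refine sum_pairAction_mem_specAgree_of_line hψ ?_ v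
    by_cases hzz : Q.form z z = 0
    · exact sum_line_mem_specAgree_of_isotropic hψ hz hzz hk
    · exact sum_line_mem_specAgree_of_anisotropic hψ k hzz
  · rw [sum_apply_eq_card_nsmul_sum pairAction p
      (Y := {p' | planeForm F p'.1 p'.2 = planeForm F p.1 p.2})
      (fun p' => by simp [exists_pairAction_eq_iff_planeForm hp])
      fun p : (Fin 2 → F) × (Fin 2 → F) => Q.heisOp ψ p.1 p.2]
    refine nsmul_mem ?_ _
    rw [← Submodule.smul_mem_iff _ (Nat.cast_ne_zero.2 Fintype.card_ne_zero :
      (Fintype.card F : ℂ) ≠ 0), card_smul_sum_planeForm_eq hψ]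
    exact Submodule.sum_mem _ fun c _ => Submodule.smul_mem _ _ (areaSum_mem_specAgree hψ hk c)

end Plane

theorem hasSpecCommutant {F : Type u} [Field F] [NeZero (2 : F)] [Finite F]
    {ψ : AddChar F ℂ} (hψ : ψ ≠ 1) {k : ℕ} (hk : k ≤ 2) (Q : QuadSpace F (Fin k → F)) :
    HasSpecCommutant Q hψ k := by
  classical
  intro A hA
  have := Fintype.ofFinite F
  refine mem_of_commute_oscG hψ (fun p => ?_) hA
  interval_cases k
  · simp only [Subsingleton.elim _ (0 : Fin 0 → F), heisOp_zero]
    exact Submodule.sum_mem _ fun _ _ => one_mem_specAgree hψ 0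
  · have hcoord (x : Fin 1 → F) : x 0 • 1 = x := by
      ext i; fin_cases i; simp
    have hline := sum_line_mem_specAgree_of_anisotropic hψ 1 (Q := Q) (z := 1) fun h =>
      one_ne_zero (Q.nondeg 1 fun y => by rw [← hcoord y, map_smul, h, smul_zero])
    simpa only [hcoord] using sum_pairAction_mem_specAgree_of_line hψ hline (p.1 0, p.2 0)
  · exact sum_pairAction_mem_specAgree_plane hψ two_pos p

/-! ### The correspondence, given the commutant of `SL₂` -/

section Eta

variable {F : Type u} [Field F] [Finite F] [NeZero (2 : F)] {U : Type v} [AddCommGroup U]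
  [Module F U] [Finite U] {Q : QuadSpace F U} {ψ : AddChar F ℂ} (hψ : ψ ≠ 1) {k : ℕ}

instance : Finite Q.O :=
  Finite.of_injective (fun o : Q.O => (o.1 : U → U)) fun _ _ h =>
    Subtype.ext (LinearEquiv.ext (congrFun h))

/-- The inclusion of the `k`-spectrum into the oscillator representation, as an intertwining map of
representations of `SL₂`. -/
def specIncl : IntertwiningMap (Q.specG hψ k) (Q.oscG hψ) where
  toLinearMap := (Q.spec hψ k).subtype
  isIntertwining' _ := rfl

lemma specO_mul_specG (o : Q.O) (g : SL(2, F)) :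
    Q.specO hψ k o * Q.specG hψ k g = Q.specG hψ k g * Q.specO hψ k o :=
  LinearMap.ext fun x => Subtype.ext (Q.oscO_oscG_comm hψ o g x.1)

lemma algO_le_centralizer :
    Q.algO hψ k ≤ Subalgebra.centralizer ℂ (Q.algG hψ k : Set (Module.End ℂ (Q.spec hψ k))) := by
  refine Algebra.adjoin_le ?_
  rintro _ ⟨o, rfl⟩
  rw [SetLike.mem_coe, QuadSpace.algG, mem_centralizer_adjoin_iff]
  rintro _ ⟨g, rfl⟩
  exact (specO_mul_specG hψ o g).symm

lemma exists_mem_algO_of_mem_span {a : Module.End ℂ (U → ℂ)}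
    (ha : a ∈ Submodule.span ℂ (Set.range (Q.oscO hψ))) :
    ∃ b ∈ Q.algO hψ k, ∀ x, (b x).1 = a x.1 := by
  induction ha using Submodule.span_induction with
  | mem a h =>
    obtain ⟨o, rfl⟩ := h
    exact ⟨Q.specO hψ k o, Algebra.subset_adjoin ⟨o, rfl⟩, fun x => rfl⟩
  | zero => exact ⟨0, zero_mem _, fun x => rfl⟩
  | add a a' _ _ ha ha' =>
    obtain ⟨b, hb, hba⟩ := ha
    obtain ⟨b', hb', hba'⟩ := ha'
    exact ⟨b + b', add_mem hb hb', fun x => congrArg₂ (· + ·) (hba x) (hba' x)⟩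
  | smul c a _ ha =>
    obtain ⟨b, hb, hba⟩ := ha
    exact ⟨c • b, Subalgebra.smul_mem _ hb c, fun x => congrArg (c • ·) (hba x)⟩

theorem centralizer_algG (hC : HasSpecCommutant Q hψ k) :
    Subalgebra.centralizer ℂ (Q.algG hψ k : Set (Module.End ℂ (Q.spec hψ k))) = Q.algO hψ k := by
  refine le_antisymm (fun A hA => ?_) (algO_le_centralizer hψ)
  obtain ⟨π, hπ⟩ :=
    exists_intertwiningMap_leftInverse (specIncl (Q := Q) hψ (k := k)) Subtype.val_injective
  rw [QuadSpace.algG, mem_centralizer_adjoin_iff] at hA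
  obtain ⟨a, ha, hAa⟩ := hC ((Q.spec hψ k).subtype ∘ₗ A ∘ₗ π.toLinearMap) fun g => by
    refine LinearMap.ext fun f => ?_
    have hAg := LinearMap.congr_fun (hA _ ⟨g, rfl⟩) (π f)
    exact congrArg Subtype.val
      ((congrArg A (IntertwiningMap.isIntertwining _ _ π g f)).trans hAg.symm)
  obtain ⟨b, hb, hba⟩ := exists_mem_algO_of_mem_span hψ ha
  have hAb : A = b := by
    refine LinearMap.ext fun x => Subtype.ext ?_
    rw [hba, ← hAa _ x.2]
    exact congrArg (fun y => (A y).1) (hπ x).symm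
  rwa [hAb]

theorem centralizer_algO (hC : HasSpecCommutant Q hψ k) :
    Subalgebra.centralizer ℂ (Q.algO hψ k : Set (Module.End ℂ (Q.spec hψ k))) = Q.algG hψ k := by
  refine le_antisymm (fun A hA => mem_adjoin_range_of_forall_commute fun B hB => ?_)
    ((Subalgebra.le_centralizer_iff _ _).1 (algO_le_centralizer hψ))
  have hBO : B ∈ Q.algO hψ k := by
    rw [← centralizer_algG hψ hC, QuadSpace.algG, mem_centralizer_adjoin_iff]
    rintro _ ⟨g, rfl⟩
    exact (hB g).symm
  exact ((Subalgebra.mem_centralizer_iff ℂ).1 hA B hBO).symm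

variable {T : Type*} [AddCommGroup T] [Module ℂ T] {τ : Representation ℂ Q.O T}

/-- An element of `η(τ)` as an intertwining map into the `k`-spectrum. -/
def etaMap (f : Q.etaSpace hψ k τ) : IntertwiningMap τ (Q.specO hψ k) where
  toLinearMap := f.1.codRestrict _ f.2.1
  isIntertwining' o := LinearMap.ext fun t => Subtype.ext (f.2.2 o t)

/-- Evaluation of the elements of `η(τ)` at a vector of `τ`. -/
def etaEval (t : T) : IntertwiningMap (Q.eta hψ k τ) (Q.specG hψ k) where
  toFun f := etaMap hψ f t
  map_add' _ _ := rfl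
  map_smul' _ _ := rfl
  isIntertwining' _ := rfl

lemma eta_ext {f f' : Q.etaSpace hψ k τ} (h : ∀ t, etaMap hψ f t = etaMap hψ f' t) : f = f' :=
  Subtype.ext (LinearMap.ext fun t => congrArg Subtype.val (h t))

lemma etaMap_asAlgebraHom (r : MonoidAlgebra ℂ SL(2, F)) (f : Q.etaSpace hψ k τ) (t : T) :
    etaMap hψ ((Q.eta hψ k τ).asAlgebraHom r f) t =
      (Q.specG hψ k).asAlgebraHom r (etaMap hψ f t) :=
  intertwiningMap_asAlgebraHom (etaEval hψ t) r f

lemma etaMap_injective (hτ : τ.IsIrreducible) {f : Q.etaSpace hψ k τ} (hf : f ≠ 0) :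
    Function.Injective (etaMap hψ f) :=
  have := hτ
  (Representation.IsIrreducible.injective_or_eq_zero (etaMap hψ f)).resolve_right
    fun h => hf (eta_ext hψ fun t => congrArg (fun φ : IntertwiningMap τ _ => φ t) h)

lemma occurs_specO_iff_nontrivial (hτ : τ.IsIrreducible) :
    Occurs τ (Q.specO hψ k) ↔ Nontrivial (Q.etaSpace hψ k τ) := by
  constructor
  · rintro ⟨φ, hφ⟩
    have := nontrivial_of_isIrreducible hτ
    obtain ⟨t, ht⟩ := exists_ne (0 : T)
    let f : Q.etaSpace hψ k τ := ⟨(Q.spec hψ k).subtype ∘ₗ φ.toLinearMap, fun t => (φ t).2,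
      fun o t => congrArg Subtype.val (IntertwiningMap.isIntertwining _ _ φ o t)⟩
    refine ⟨f, 0, fun hf => ht (hφ (Subtype.ext ?_))⟩
    rw [map_zero]
    exact LinearMap.congr_fun (congrArg Subtype.val hf) t
  · intro h
    obtain ⟨f, hf⟩ := exists_ne (0 : Q.etaSpace hψ k τ)
    exact ⟨etaMap hψ f, etaMap_injective hψ hτ hf⟩

/- A retraction of the `k`-spectrum onto a copy of `τ`, followed by another embedding of `τ`,
commutes with `O_β`, so it lies in the algebra generated by `SL₂`. -/
lemma exists_asAlgebraHom_eq (hC : HasSpecCommutant Q hψ k) (hτ : τ.IsIrreducible)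
    {f : Q.etaSpace hψ k τ} (hf : f ≠ 0) :
    ∃ π : IntertwiningMap (Q.specO hψ k) τ, (∀ t, π (etaMap hψ f t) = t) ∧
      ∀ f' : Q.etaSpace hψ k τ, ∃ r,
        (Q.specG hψ k).asAlgebraHom r = (etaMap hψ f').toLinearMap ∘ₗ π.toLinearMap := by
  obtain ⟨π, hπ⟩ := exists_intertwiningMap_leftInverse _ (etaMap_injective hψ hτ hf)
  refine ⟨π, hπ, fun f' => ?_⟩
  suffices h : (etaMap hψ f').toLinearMap ∘ₗ π.toLinearMap ∈ Q.algG hψ k by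
    rwa [QuadSpace.algG, ← SetLike.mem_coe, adjoin_range_eq_range_asAlgebraHom] at h
  rw [← centralizer_algO hψ hC, QuadSpace.algO, mem_centralizer_adjoin_iff]
  rintro _ ⟨o, rfl⟩
  exact (((etaMap hψ f').comp π).isIntertwining' o).symm

lemma eta_isIrreducible (hC : HasSpecCommutant Q hψ k) (hτ : τ.IsIrreducible)
    [Nontrivial (Q.etaSpace hψ k τ)] :
    Representation.IsIrreducible (V := Q.etaSpace hψ k τ) (Q.eta hψ k τ) := by
  refine isIrreducible_of_forall_eq_top fun S hS hS0 => Submodule.eq_top_iff'.2 fun f' => ?_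
  obtain ⟨f, hf, hf0⟩ := S.ne_bot_iff.1 hS0
  obtain ⟨π, hπ, hr⟩ := exists_asAlgebraHom_eq hψ hC hτ hf0
  obtain ⟨r, hr⟩ := hr f'
  have hrf : (Q.eta hψ k τ).asAlgebraHom r f = f' := eta_ext hψ fun t => by
    rw [etaMap_asAlgebraHom, hr]
    exact congrArg (etaMap hψ f') (hπ t)
  rw [← hrf]
  exact Representation.asAlgebraHom_mem_of_forall_mem _ S hS f hf r

lemma IsIrrepOfRank.of_occurs_specG {M : Type*} [AddCommGroup M] [Module ℂ M]
    {ρ : Representation ℂ SL(2, F) M} (hρ : ρ.IsIrreducible) (h : Occurs ρ (Q.specG hψ k)) :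
    IsIrrepOfRank k ρ := by
  obtain ⟨φ, hφ⟩ := h
  obtain ⟨π, hπ⟩ := exists_intertwiningMap_leftInverse ((specIncl hψ).comp φ)
    (Subtype.val_injective.comp hφ)
  have := nontrivial_of_isIrreducible hρ
  obtain ⟨m, hm⟩ := exists_ne (0 : M)
  by_contra hrank
  have hle : Q.spec hψ k ≤ LinearMap.ker π.toLinearMap := by
    refine sSup_le ?_
    rintro S ⟨M', i1, i2, ρ', f, hρ', rfl⟩
    have := hρ'.1
    rcases Representation.IsIrreducible.bijective_or_eq_zero (π.comp f) with h | h
    · exact absurd (hρ'.of_equiv ((π.comp f).ofBijective h)) hrank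
    · rintro _ ⟨x, rfl⟩
      exact congrArg (fun χ : IntertwiningMap ρ' ρ => χ x) h
  exact hm ((hπ m).symm.trans (hle (φ m).2))

theorem eta_isIrrepOfRank (hC : HasSpecCommutant Q hψ k) (hτ : τ.IsIrreducible)
    (ho : Occurs τ (Q.specO hψ k)) :
    IsIrrepOfRank (M := Q.etaSpace hψ k τ) k (Q.eta hψ k τ) := by
  have := (occurs_specO_iff_nontrivial hψ hτ).1 ho
  have := nontrivial_of_isIrreducible hτ
  obtain ⟨t, ht⟩ := exists_ne (0 : T)
  refine IsIrrepOfRank.of_occurs_specG hψ (eta_isIrreducible hψ hC hτ) ⟨etaEval hψ t, ?_⟩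
  refine (injective_iff_map_eq_zero _).2 fun f hf => by_contra fun hf0 => ht ?_
  exact etaMap_injective hψ hτ hf0 (hf.trans (map_zero _).symm)

variable {T' : Type*} [AddCommGroup T'] [Module ℂ T'] {τ' : Representation ℂ Q.O T'}

theorem nonempty_equiv_of_eta_equiv (hC : HasSpecCommutant Q hψ k) (hτ : τ.IsIrreducible)
    (hτ' : τ'.IsIrreducible) (ho : Occurs τ (Q.specO hψ k))
    (e : (Q.eta hψ k τ).Equiv (Q.eta hψ k τ')) : Nonempty (τ.Equiv τ') := by
  have := (occurs_specO_iff_nontrivial hψ hτ).1 ho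
  obtain ⟨f, hf⟩ := exists_ne (0 : Q.etaSpace hψ k τ)
  obtain ⟨π, hπ, hr⟩ := exists_asAlgebraHom_eq hψ hC hτ hf
  obtain ⟨r, hr⟩ := hr f
  have hrf : (Q.eta hψ k τ).asAlgebraHom r f = f := eta_ext hψ fun t => by
    rw [etaMap_asAlgebraHom, hr]
    exact congrArg (etaMap hψ f) (hπ t)
  have href := intertwiningMap_asAlgebraHom (M := Q.etaSpace hψ k τ) (N := Q.etaSpace hψ k τ')
    e.toIntertwiningMap r f
  rw [hrf] at href
  replace href : e f = (Q.eta hψ k τ').asAlgebraHom r (e f) := href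
  have hfactor (t : T') : etaMap hψ (e f) t = etaMap hψ f (π (etaMap hψ (e f) t)) := by
    conv_lhs => rw [href, etaMap_asAlgebraHom, hr]
    rfl
  rcases Representation.IsIrreducible.bijective_or_eq_zero (π.comp (etaMap hψ (e f))) with h | h
  · exact ⟨((π.comp (etaMap hψ (e f))).ofBijective h).symm⟩
  · have hef : e f = 0 := eta_ext hψ fun t => by
      rw [hfactor, show π (etaMap hψ (e f) t) = 0 from
        congrArg (fun χ : IntertwiningMap τ' τ => χ t) h, map_zero]
      rfl
    exact absurd (by rw [← e.symm_apply_apply f, hef, map_zero]) hf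

/-- The functoriality of `η` for isomorphisms. -/
def etaCongr (e : τ.Equiv τ') : (Q.eta hψ k τ).Equiv (Q.eta hψ k τ') :=
  .mk
    { toFun := fun f => ⟨f.1 ∘ₗ e.symm.toLinearMap, fun _ => f.2.1 _, fun o t =>
        (congrArg f.1 (IntertwiningMap.isIntertwining _ _ e.symm.toIntertwiningMap o t)).trans
          (f.2.2 o _)⟩
      invFun := fun f => ⟨f.1 ∘ₗ e.toLinearMap, fun _ => f.2.1 _, fun o t =>
        (congrArg f.1 (IntertwiningMap.isIntertwining _ _ e.toIntertwiningMap o t)).trans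
          (f.2.2 o _)⟩
      map_add' := fun _ _ => rfl
      map_smul' := fun _ _ => rfl
      left_inv := fun f => Subtype.ext (LinearMap.ext fun t => congrArg f.1 (e.symm_apply_apply t))
      right_inv := fun f => Subtype.ext (LinearMap.ext fun t =>
        congrArg f.1 (e.apply_symm_apply t)) }
    fun _ => rfl

/-- The action of `O_β` on the space of `SL₂`-homomorphisms from `ρ` to the oscillator
representation. -/
def homRep {M : Type*} [AddCommGroup M] [Module ℂ M] (ρ : Representation ℂ SL(2, F) M) :
    Representation ℂ Q.O (IntertwiningMap ρ (Q.oscG hψ)) where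
  toFun o :=
    { toFun := fun h => ⟨Q.oscO hψ o ∘ₗ h.toLinearMap, fun g => LinearMap.ext fun m =>
        (congrArg (Q.oscO hψ o) (IntertwiningMap.isIntertwining _ _ h g m)).trans
          (Q.oscO_oscG_comm hψ o g _)⟩
      map_add' := fun _ _ => IntertwiningMap.ext (LinearMap.comp_add _ _ _)
      map_smul' := fun _ _ => IntertwiningMap.ext (LinearMap.comp_smul _ _ _) }
  map_one' := LinearMap.ext fun h => IntertwiningMap.ext (LinearMap.ext fun m =>
    LinearMap.congr_fun (map_one (Q.oscO hψ)) (h m))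
  map_mul' o o' := LinearMap.ext fun h => IntertwiningMap.ext (LinearMap.ext fun m =>
    LinearMap.congr_fun (map_mul (Q.oscO hψ) o o') (h m))

section Surjective

variable {M : Type} [AddCommGroup M] [Module ℂ M] {ρ : Representation ℂ SL(2, F) M}

lemma IsIrrepOfRank.mem_spec (hρ : IsIrrepOfRank k ρ) (h : IntertwiningMap ρ (Q.oscG hψ)) (m : M) :
    h m ∈ Q.spec hψ k :=
  (le_sSup ⟨M, _, _, ρ, h, hρ, rfl⟩ : LinearMap.range h.toLinearMap ≤ Q.spec hψ k) ⟨m, rfl⟩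

/-- For a family of `SL₂`-homomorphisms from `ρ` that transforms under `O_β` by `τ`, the map
`ρ → η(τ)` that evaluates the family at a vector of `ρ`. -/
def toEta (hρ : IsIrrepOfRank k ρ) (f : IntertwiningMap τ (homRep (Q := Q) hψ ρ)) :
    IntertwiningMap ρ (Q.eta hψ k τ) where
  toFun m := ⟨{ toFun := fun t => f t m
                map_add' := fun t t' => by rw [map_add]; rfl
                map_smul' := fun c t => by rw [map_smul]; rfl },
    fun t => hρ.mem_spec hψ _ m, fun o t =>
      congrArg (fun h : IntertwiningMap ρ (Q.oscG hψ) => h m)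
        (IntertwiningMap.isIntertwining _ _ f o t)⟩
  map_add' m m' := Subtype.ext (LinearMap.ext fun t => map_add (f t) m m')
  map_smul' c m := Subtype.ext (LinearMap.ext fun t => map_smul (f t) c m)
  isIntertwining' g := LinearMap.ext fun m => Subtype.ext (LinearMap.ext fun t =>
    IntertwiningMap.isIntertwining _ _ (f t) g m)

theorem inEtaImage_of_occurs (hC : HasSpecCommutant Q hψ k) (hρ : IsIrrepOfRank k ρ)
    (ho : Occurs ρ (Q.oscG hψ)) : Q.InEtaImage hψ k ρ := by
  obtain ⟨φ, hφ⟩ := ho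
  have : FiniteDimensional ℂ M := Module.Finite.of_injective φ.toLinearMap hφ
  have := hρ.1
  have := nontrivial_of_isIrreducible hρ.1
  have : Nontrivial (IntertwiningMap ρ (Q.oscG hψ)) := by
    obtain ⟨m, hm⟩ := exists_ne (0 : M)
    exact ⟨φ, 0, fun h => hm (hφ (by rw [h]; rfl))⟩
  obtain ⟨n, τ, f, hτ, hf⟩ := exists_isIrreducible_injective (homRep (Q := Q) hψ ρ)
  have := nontrivial_of_isIrreducible hτ
  obtain ⟨t, ht⟩ := exists_ne (0 : Fin n → ℂ)
  have hne : toEta hψ hρ f ≠ 0 := by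
    refine fun h => ht (hf ?_)
    rw [map_zero]
    refine IntertwiningMap.ext (LinearMap.ext fun m => ?_)
    exact congrArg (fun χ : IntertwiningMap ρ (Q.eta hψ k τ) => (χ m).1 t) h
  have : Nontrivial (Q.etaSpace hψ k τ) := by
    by_contra! h
    exact hne (IntertwiningMap.ext (LinearMap.ext fun m => Subsingleton.elim _ _))
  have := eta_isIrreducible hψ hC hτ
  have hbij := (Representation.IsIrreducible.bijective_or_eq_zero (W := Q.etaSpace hψ k τ)
    (toEta hψ hρ f)).resolve_right hne
  exact ⟨hρ.1, _, _, _, τ, hτ, ⟨((toEta hψ hρ f).ofBijective hbij).symm⟩⟩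

end Surjective

theorem isIrrepOfRank_of_inEtaImage (hC : HasSpecCommutant Q hψ k) {M : Type*} [AddCommGroup M]
    [Module ℂ M] {ρ : Representation ℂ SL(2, F) M} (h : Q.InEtaImage hψ k ρ) :
    IsIrrepOfRank k ρ := by
  obtain ⟨hρ, T, _, _, τ, hτ, ⟨e⟩⟩ := h
  have := nontrivial_of_isIrreducible hρ
  have : Nontrivial (Q.etaSpace hψ k τ) := e.toLinearEquiv.toEquiv.nontrivial
  exact (eta_isIrrepOfRank hψ hC hτ ((occurs_specO_iff_nontrivial hψ hτ).2 this)).of_equiv e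

end Eta

/-! ### A dimension bound for representations of `SL₂` without invariants -/

section Average

variable {k H M : Type*} [CommRing k] [Group H] [Fintype H] [Invertible (Fintype.card H : k)]
  [AddCommGroup M] [Module k M] (ρ : Representation k H M)

lemma apply_mul_averageMap (h : H) : ρ h * ρ.averageMap = ρ.averageMap :=
  LinearMap.ext fun v => ρ.averageMap_invariant v h

lemma averageMap_mul_apply (h : H) : ρ.averageMap * ρ h = ρ.averageMap := by
  rw [Representation.averageMap, ← Representation.asAlgebraHom_single_one, ← map_mul,
    GroupAlgebra.mul_average_right]

lemma averageMap_eq_smul_sum : ρ.averageMap = ⅟(Fintype.card H : k) • ∑ h, ρ h := by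
  simp [Representation.averageMap, GroupAlgebra.average]

lemma card_smul_averageMap : (Fintype.card H : k) • ρ.averageMap = ∑ h, ρ h := by
  rw [averageMap_eq_smul_sum, smul_smul, mul_invOf_self, one_smul]

variable {ρ} in
lemma commute_averageMap {a : Module.End k M} (f : H ≃ H) (h : ∀ x, a * ρ x = ρ (f x) * a) :
    Commute a ρ.averageMap := by
  rw [averageMap_eq_smul_sum]
  refine Commute.smul_right ?_ _
  change a * ∑ x, ρ x = (∑ x, ρ x) * a
  rw [Finset.mul_sum, Finset.sum_mul]
  exact Fintype.sum_equiv f _ _ h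

end Average

section Bound

lemma sum_eq_add_sum_units {F A : Type*} [GroupWithZero F] [Fintype F] [Fintype Fˣ]
    [AddCommMonoid A] (f : F → A) : ∑ t, f t = f 0 + ∑ t : Fˣ, f t := by
  classical
  rw [Fintype.sum_eq_add_sum_subtype_ne f 0]
  congr 1
  exact (Fintype.sum_equiv unitsEquivNeZero _ _ fun t => rfl).symm

/-- The parametrization of the upper unipotent subgroup, as a homomorphism. -/
def upperHom (F : Type*) [Field F] : Multiplicative F →* SL(2, F) where
  toFun t := upper t.toAdd
  map_one' := upper_zero
  map_mul' s t := (upper_mul_upper s.toAdd t.toAdd).symm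

/-- The parametrization of the diagonal torus, as a homomorphism. -/
def torusHom (F : Type*) [Field F] : Fˣ →* SL(2, F) where
  toFun := torus
  map_one' := torus_one
  map_mul' s t := (torus_mul_torus s t).symm

variable {F : Type u} [Field F] {k M : Type*} [Field k] [AddCommGroup M] [Module k M]
  (σ : Representation k SL(2, F) M)

/-- The vectors fixed by the upper unipotent matrices. -/
def fixedUpper : Submodule k M := Representation.invariants (σ.comp (upperHom F))

/-- The vectors fixed by the upper triangular matrices. -/
def fixedBorel : Submodule k M :=
  fixedUpper σ ⊓ Representation.invariants (σ.comp (torusHom F))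

/-- For a vector fixed by the upper triangular matrices, the sum of its translates, which by the
Bruhat decomposition are indexed by `1` and the cosets of `upper t * weyl`. -/
def sumTranslates [Fintype F] (v : M) : M := v + ∑ t : F, σ (upper t * weyl) v

variable {σ}

lemma upper_sumTranslates [Fintype F] {v : M} (hv : v ∈ fixedBorel σ) (x : F) :
    σ (upper x) (sumTranslates σ v) = sumTranslates σ v := by
  rw [sumTranslates, map_add, map_sum, show σ (upper x) v = v from hv.1 x]
  congr 1
  refine Fintype.sum_equiv (Equiv.addLeft x) _ _ fun t => ?_
  rw [← Module.End.mul_apply, ← map_mul, ← mul_assoc, upper_mul_upper, Equiv.coe_addLeft]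

lemma weyl_sumTranslates [Fintype F] {v : M} (hv : v ∈ fixedBorel σ) :
    σ weyl (sumTranslates σ v) = sumTranslates σ v := by
  classical
  have hu (t : F) : σ (upper t) v = v := hv.1 t
  have ht (t : Fˣ) : σ (torus t) v = v := hv.2 t
  have hw : σ weyl v = σ weyl⁻¹ v := by rw [weyl_inv, map_mul, Module.End.mul_apply, ht]
  have hinv : σ weyl (σ weyl⁻¹ v) = v := by
    rw [← Module.End.mul_apply, ← map_mul, mul_inv_cancel, map_one, Module.End.one_apply]
  have hsum : ∑ t : Fˣ, σ weyl (σ (upper (t : F)) (σ weyl v)) =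
      ∑ t : Fˣ, σ (upper (t : F)) (σ weyl v) := by
    refine Fintype.sum_equiv ((Equiv.inv Fˣ).trans (Equiv.neg Fˣ)) _ _ fun t => ?_
    have hb : σ (weyl * upper (t : F) * weyl⁻¹) v = σ (upper (-(t⁻¹ : Fˣ) : F)) (σ weyl v) := by
      rw [weyl_mul_upper_mul_weyl_inv]
      simp only [map_mul, Module.End.mul_apply, hu, ht]
    simpa [hw] using hb
  simp only [sumTranslates, map_add, map_sum, map_mul, Module.End.mul_apply]
  rw [sum_eq_add_sum_units fun t => σ weyl (σ (upper t) (σ weyl v)),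
    sum_eq_add_sum_units fun t => σ (upper t) (σ weyl v), hsum, upper_zero, map_one,
    Module.End.one_apply, hw, hinv, add_left_comm]

lemma apply_sumTranslates [Fintype F] {v : M} (hv : v ∈ fixedBorel σ) (g : SL(2, F)) :
    σ g (sumTranslates σ v) = sumTranslates σ v := by
  have := eq_top_of_upper_mem_of_weyl_mem
    (S := (MulAction.stabilizer (Module.End k M)ˣ (sumTranslates σ v)).comap σ.toHomUnits)
    (upper_sumTranslates hv) (weyl_sumTranslates hv)
  exact (this ▸ Subgroup.mem_top g :
    g ∈ (MulAction.stabilizer (Module.End k M)ˣ (sumTranslates σ v)).comap σ.toHomUnits)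

variable (σ) [CharZero k]

section Torus

variable [Fintype Fˣ]

/-- The projection to the vectors fixed by the diagonal torus. -/
def projTorus : Module.End k M := Representation.averageMap (σ.comp (torusHom F))

lemma torus_mul_projTorus (t : Fˣ) : σ (torus t) * projTorus σ = projTorus σ :=
  apply_mul_averageMap (σ.comp (torusHom F)) t

lemma projTorus_mul_torus (t : Fˣ) : projTorus σ * σ (torus t) = projTorus σ :=
  averageMap_mul_apply (σ.comp (torusHom F)) t

lemma commute_weyl_projTorus : Commute (σ weyl) (projTorus σ) :=
  commute_averageMap (Equiv.inv Fˣ) fun t => by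
    change σ weyl * σ (torus t) = σ (torus t⁻¹) * σ weyl
    rw [← map_mul, ← map_mul, weyl_mul_torus]

end Torus

variable [Fintype F]

/-- The projection to the vectors fixed by the upper unipotent matrices. -/
def projUpper : Module.End k M := Representation.averageMap (σ.comp (upperHom F))

lemma sum_upper : ∑ t : F, σ (upper t) = (Fintype.card F : k) • projUpper σ := by
  rw [← Fintype.card_multiplicative F]
  exact (Fintype.sum_equiv Multiplicative.ofAdd _ _ fun _ => rfl).trans
    (card_smul_averageMap (σ.comp (upperHom F))).symm

lemma upper_mul_projUpper (t : F) : σ (upper t) * projUpper σ = projUpper σ :=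
  apply_mul_averageMap (σ.comp (upperHom F)) (.ofAdd t)

lemma projUpper_mul_upper (t : F) : projUpper σ * σ (upper t) = projUpper σ :=
  averageMap_mul_apply (σ.comp (upperHom F)) (.ofAdd t)

lemma commute_torus_projUpper (t : Fˣ) : Commute (σ (torus t)) (projUpper σ) :=
  commute_averageMap
    ((Multiplicative.toAdd.trans (Units.mulLeft (t * t))).trans Multiplicative.ofAdd) fun x => by
      change σ (torus t) * σ (upper x.toAdd) = σ (upper ((t * t : Fˣ) * x.toAdd)) * σ (torus t)
      rw [← map_mul, ← map_mul, torus_mul_upper, Units.val_mul]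

lemma isProj_projUpper : LinearMap.IsProj (fixedUpper σ) (projUpper σ) :=
  Representation.isProj_averageMap _

lemma projUpper_mul_projUpper : projUpper σ * projUpper σ = projUpper σ :=
  (isProj_projUpper σ).isIdempotentElem

variable [Fintype Fˣ]

/-- The projection to the vectors fixed by the upper triangular matrices. -/
def projBorel : Module.End k M := projUpper σ * projTorus σ

lemma sum_torus : ∑ t : Fˣ, σ (torus t) = ((Fintype.card F : k) - 1) • projTorus σ := by
  have hcard : (Fintype.card F : k) - 1 = Fintype.card Fˣ := by
    rw [sub_eq_iff_eq_add, ← Nat.card_eq_fintype_card, Nat.card_eq_card_units_add_one,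
      Nat.card_eq_fintype_card, Nat.cast_add_one]
  rw [hcard]
  exact (card_smul_averageMap (σ.comp (torusHom F))).symm

lemma commute_projUpper_projTorus : Commute (projUpper σ) (projTorus σ) :=
  commute_averageMap (Equiv.refl _) fun t => (commute_torus_projUpper σ t).symm

lemma isProj_projBorel : LinearMap.IsProj (fixedBorel σ) (projBorel σ) where
  map_mem v := by
    refine ⟨(isProj_projUpper σ).map_mem _, ?_⟩
    rw [projBorel, commute_projUpper_projTorus]
    exact Representation.averageMap_invariant _ _
  map_id v hv := by
    rw [projBorel, Module.End.mul_apply, projTorus, Representation.averageMap_id _ _ hv.2]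
    exact (isProj_projUpper σ).map_id _ hv.1

lemma projUpper_mul_projBorel : projUpper σ * projBorel σ = projBorel σ := by
  rw [projBorel, ← mul_assoc, projUpper_mul_projUpper]

lemma projBorel_mul_projUpper : projBorel σ * projUpper σ = projBorel σ := by
  rw [projBorel, mul_assoc, ← commute_projUpper_projTorus, ← mul_assoc, projUpper_mul_projUpper]

lemma projBorel_mul_weyl_inv_mul_projUpper :
    projBorel σ * σ weyl⁻¹ * projUpper σ = projUpper σ * σ weyl * projBorel σ := by
  rw [weyl_inv, map_mul, projBorel, mul_assoc (projUpper σ), ← mul_assoc (projTorus σ),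
    ← (commute_weyl_projTorus σ).eq, mul_assoc (σ weyl), projTorus_mul_torus,
    (commute_projUpper_projTorus σ).eq]
  simp only [mul_assoc]

lemma card_smul_projUpper_mul_weyl_conj :
    (Fintype.card F : k) • (projUpper σ * (σ weyl * projUpper σ * σ weyl⁻¹) * projUpper σ) =
      projUpper σ + ((Fintype.card F : k) - 1) • (projUpper σ * σ weyl * projBorel σ) := by
  have hunit (t : Fˣ) : projUpper σ * (σ weyl * σ (upper (t : F)) * σ weyl⁻¹) * projUpper σ =
      projUpper σ * σ weyl * (σ (torus (-t)) * projUpper σ) := by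
    rw [← map_mul, ← map_mul, weyl_mul_upper_mul_weyl_inv]
    simp only [map_mul, mul_assoc, upper_mul_projUpper]
    rw [← mul_assoc, projUpper_mul_upper]
  have hneg : ∑ t : Fˣ, σ (torus (-t)) = ∑ t : Fˣ, σ (torus t) :=
    Fintype.sum_equiv (Equiv.neg Fˣ) _ _ fun _ => rfl
  calc _ = ∑ t : F, projUpper σ * (σ weyl * σ (upper t) * σ weyl⁻¹) * projUpper σ := by
        rw [← Finset.sum_mul, ← Finset.mul_sum, ← Finset.sum_mul, ← Finset.mul_sum, sum_upper]
        simp only [mul_smul_comm, smul_mul_assoc]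
    _ = projUpper σ * (σ weyl * σ (upper 0) * σ weyl⁻¹) * projUpper σ +
          ∑ t : Fˣ, projUpper σ * σ weyl * (σ (torus (-t)) * projUpper σ) := by
        rw [sum_eq_add_sum_units]
        simp only [hunit]
    _ = _ := by
        rw [← Finset.mul_sum, ← Finset.sum_mul, hneg, sum_torus, upper_zero, map_one, mul_one,
          ← map_mul, mul_inv_cancel, map_one, mul_one, projUpper_mul_projUpper, smul_mul_assoc,
          ← (commute_projUpper_projTorus σ).eq, mul_smul_comm, projBorel]

lemma projUpper_mul_weyl_mul_projBorel (h0 : σ.invariants = ⊥) :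
    projUpper σ * σ weyl * projBorel σ = -(Fintype.card F : k)⁻¹ • projBorel σ := by
  have hq : (Fintype.card F : k) ≠ 0 := Nat.cast_ne_zero.2 Fintype.card_ne_zero
  have hsum : projBorel σ + (Fintype.card F : k) • (projUpper σ * σ weyl * projBorel σ) = 0 := by
    refine LinearMap.ext fun v => ?_
    have h : sumTranslates σ (projBorel σ v) ∈ σ.invariants :=
      apply_sumTranslates ((isProj_projBorel σ).map_mem v)
    rw [h0, Submodule.mem_bot, sumTranslates] at h
    rw [← smul_mul_assoc, ← smul_mul_assoc, ← sum_upper, LinearMap.zero_apply, ← h]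
    simp [Finset.sum_mul, LinearMap.sum_apply]
  rw [neg_smul, eq_neg_iff_add_eq_zero, ← smul_right_inj hq, smul_zero, ← hsum, smul_add,
    smul_inv_smul₀ hq, add_comm]

/-- The multiplication by `1 / 2` on the part of `fixedUpper σ` without vectors fixed by the torus
and by `q / (q + 1)` on `fixedBorel σ`, as an operator on the whole space. The eigenvalues are
chosen to make `spanProj σ` the identity on `fixedUpper σ` when `σ` has no invariants. -/
def halfProj : Module.End k M :=
  (2⁻¹ : k) • (projUpper σ +
    (((Fintype.card F : k) - 1) / ((Fintype.card F : k) + 1)) • projBorel σ)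

lemma halfProj_mul_projUpper : halfProj σ * projUpper σ = halfProj σ := by
  rw [halfProj, smul_mul_assoc, add_mul, smul_mul_assoc, projUpper_mul_projUpper,
    projBorel_mul_projUpper]

lemma projUpper_mul_halfProj : projUpper σ * halfProj σ = halfProj σ := by
  rw [halfProj, mul_smul_comm, mul_add, mul_smul_comm, projUpper_mul_projUpper,
    projUpper_mul_projBorel]

lemma commute_upper_halfProj (t : F) : Commute (σ (upper t)) (halfProj σ) := by
  have hl : σ (upper t) * halfProj σ = halfProj σ := by
    rw [← projUpper_mul_halfProj, ← mul_assoc, upper_mul_projUpper]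
  have hr : halfProj σ * σ (upper t) = halfProj σ := by
    rw [← halfProj_mul_projUpper, mul_assoc, projUpper_mul_upper]
  exact hl.trans hr.symm

lemma commute_torus_halfProj (t : Fˣ) : Commute (σ (torus t)) (halfProj σ) :=
  have he := commute_torus_projUpper σ t
  have hp : Commute (σ (torus t)) (projTorus σ) :=
    (torus_mul_projTorus σ t).trans (projTorus_mul_torus σ t).symm
  (he.add_right ((he.mul_right hp).smul_right _)).smul_right _

lemma halfProj_mem_fixedBorel : halfProj σ ∈ fixedBorel (Representation.linHom σ σ) := by
  have hconj (g : SL(2, F)) (h : Commute (σ g) (halfProj σ)) :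
      Representation.linHom σ σ g (halfProj σ) = halfProj σ := by
    change σ g * (halfProj σ * σ g⁻¹) = halfProj σ
    rw [← mul_assoc, h.eq, mul_assoc, ← map_mul, mul_inv_cancel, map_one, mul_one]
  exact ⟨fun t => hconj _ (commute_upper_halfProj σ t.toAdd),
    fun t => hconj _ (commute_torus_halfProj σ t)⟩

/-- The projection to the subrepresentation generated by `fixedUpper σ`, provided that `σ` has no
invariants. -/
def spanProj : Module.End k M := sumTranslates (Representation.linHom σ σ) (halfProj σ)

lemma commute_spanProj (g : SL(2, F)) : Commute (σ g) (spanProj σ) := by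
  have h : spanProj σ ∈ (Representation.linHom σ σ).invariants :=
    apply_sumTranslates (halfProj_mem_fixedBorel σ)
  have h' := (Representation.mem_linHom_invariants_iff_isIntertwining _).1 h
  exact LinearMap.ext fun v => (h'.isIntertwining g v).symm

variable {σ} in
lemma card_smul_projUpper_mul_halfProj_conj (h0 : σ.invariants = ⊥) :
    (Fintype.card F : k) • (projUpper σ * (σ weyl * halfProj σ * σ weyl⁻¹) * projUpper σ) =
      projUpper σ - halfProj σ := by
  have hx := projUpper_mul_weyl_mul_projBorel σ h0
  have hq : (Fintype.card F : k) ≠ 0 := Nat.cast_ne_zero.2 Fintype.card_ne_zero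
  have hq1 : (Fintype.card F : k) + 1 ≠ 0 := Nat.cast_add_one_ne_zero _
  have hb : projUpper σ * (σ weyl * projBorel σ * σ weyl⁻¹) * projUpper σ =
      ((Fintype.card F : k)⁻¹ * (Fintype.card F : k)⁻¹) • projBorel σ := by
    calc _ = projUpper σ * σ weyl * projBorel σ * (projBorel σ * σ weyl⁻¹ * projUpper σ) := by
          have hbb : projBorel σ * projBorel σ = projBorel σ :=
            (isProj_projBorel σ).isIdempotentElem
          conv_lhs => rw [← hbb]
          simp only [mul_assoc]
      _ = _ := by
          rw [projBorel_mul_weyl_inv_mul_projUpper, hx, smul_mul_smul_comm, neg_mul_neg,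
            (isProj_projBorel σ).isIdempotentElem]
  have he := card_smul_projUpper_mul_weyl_conj σ
  rw [hx] at he
  rw [halfProj]
  simp only [mul_smul_comm, smul_mul_assoc, mul_add, add_mul]
  rw [hb, smul_comm, smul_add, he]
  match_scalars <;> field_simp <;> ring

variable {σ} in
lemma spanProj_mul_projUpper (h0 : σ.invariants = ⊥) : spanProj σ * projUpper σ = projUpper σ := by
  have hterm (t : F) : Representation.linHom σ σ (upper t * weyl) (halfProj σ) * projUpper σ =
      σ (upper t) * (σ weyl * halfProj σ * σ weyl⁻¹ * projUpper σ) := by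
    have hinv : σ (upper t)⁻¹ * projUpper σ = projUpper σ := by
      conv_lhs => rw [← upper_mul_projUpper σ t]
      rw [← mul_assoc, ← map_mul, inv_mul_cancel, map_one, one_mul]
    change σ (upper t * weyl) * (halfProj σ * σ (upper t * weyl)⁻¹) * projUpper σ = _
    rw [mul_inv_rev, map_mul, map_mul]
    simp only [mul_assoc, hinv]
  rw [spanProj, sumTranslates, add_mul, Finset.sum_mul]
  simp only [hterm]
  rw [← Finset.sum_mul, sum_upper, smul_mul_assoc, ← mul_assoc,
    card_smul_projUpper_mul_halfProj_conj h0, halfProj_mul_projUpper, add_sub_cancel]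

variable {σ} in
lemma isIdempotentElem_spanProj (h0 : σ.invariants = ⊥) : IsIdempotentElem (spanProj σ) := by
  have hhalf : spanProj σ * halfProj σ = halfProj σ := by
    rw [← projUpper_mul_halfProj, ← mul_assoc, spanProj_mul_projUpper h0]
  have hconj (g : SL(2, F)) : spanProj σ * Representation.linHom σ σ g (halfProj σ) =
      Representation.linHom σ σ g (halfProj σ) := by
    change spanProj σ * (σ g * (halfProj σ * σ g⁻¹)) = σ g * (halfProj σ * σ g⁻¹)
    rw [← mul_assoc, ← (commute_spanProj σ g).eq, mul_assoc, ← mul_assoc _ (halfProj σ), hhalf]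
  change spanProj σ * (_ + ∑ t, _) = _ + ∑ t, _
  rw [mul_add, hhalf, Finset.mul_sum]
  simp only [hconj]

lemma trace_spanProj : LinearMap.trace k M (spanProj σ) =
    ((Fintype.card F : k) + 1) * LinearMap.trace k M (halfProj σ) := by
  have hconj (g : SL(2, F)) : LinearMap.trace k M (Representation.linHom σ σ g (halfProj σ)) =
      LinearMap.trace k M (halfProj σ) := by
    change LinearMap.trace k M (σ g * (halfProj σ * σ g⁻¹)) = _
    rw [LinearMap.trace_mul_comm, mul_assoc, ← map_mul, inv_mul_cancel, map_one, mul_one]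
  rw [spanProj, sumTranslates, map_add, map_sum]
  simp only [hconj, Finset.sum_const, Finset.card_univ, nsmul_eq_mul]
  ring

lemma trace_halfProj [FiniteDimensional k M] : LinearMap.trace k M (halfProj σ) =
    2⁻¹ * (Module.finrank k (fixedUpper σ) +
      ((Fintype.card F : k) - 1) / ((Fintype.card F : k) + 1) *
        Module.finrank k (fixedBorel σ)) := by
  rw [halfProj, map_smul, map_add, map_smul, (isProj_projUpper σ).trace,
    (isProj_projBorel σ).trace, smul_eq_mul, smul_eq_mul]

omit [Fintype Fˣ] in
variable {σ} in
theorem card_mul_finrank_fixedUpper_add_le [FiniteDimensional k M] (h0 : σ.invariants = ⊥) :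
    (Fintype.card F + 1) * Module.finrank k (fixedUpper σ) +
      (Fintype.card F - 1) * Module.finrank k (fixedBorel σ) ≤ 2 * Module.finrank k M := by
  classical
  have htrace := (LinearMap.IsIdempotentElem.isProj_range _ (isIdempotentElem_spanProj h0)).trace
  rw [trace_spanProj, trace_halfProj] at htrace
  have hq1 : (Fintype.card F : k) + 1 ≠ 0 := Nat.cast_add_one_ne_zero _
  have hrange : (Fintype.card F + 1) * Module.finrank k (fixedUpper σ) +
      (Fintype.card F - 1) * Module.finrank k (fixedBorel σ) =
        2 * Module.finrank k (LinearMap.range (spanProj σ)) := by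
    rw [← Nat.cast_inj (R := k)]
    push_cast [Nat.cast_sub (Fintype.card_pos (α := F))]
    rw [← htrace]
    field_simp
  rw [hrange]
  exact Nat.mul_le_mul_left 2 (Submodule.finrank_le _)

end Bound

/-! ### Representations of dimension `(q ± 1) / 2` -/

section Squares

variable {F : Type u} [Field F]

lemma ringChar_ne_two (F : Type u) [Field F] [NeZero (2 : F)] : ringChar F ≠ 2 := fun h =>
  NeZero.ne (2 : F) (by simpa [h] using ringChar.Nat.cast_ringChar (R := F))

lemma isSquare_val_iff {c : Fˣ} : IsSquare (c : F) ↔ IsSquare c := by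
  refine ⟨fun ⟨s, hs⟩ => ?_, fun h => h.map (Units.coeHom F)⟩
  have hs0 : s ≠ 0 := fun h => c.ne_zero (by rw [hs, h, mul_zero])
  exact ⟨Units.mk0 s hs0, Units.ext hs⟩

variable {ε : Fˣ} (hε : ¬ IsSquare ε)

include hε in
lemma exists_eq_mul_self_or_eq_mul_mul_self [Finite F] (c : Fˣ) :
    ∃ s : Fˣ, c = s * s ∨ c = ε * (s * s) := by
  classical
  have := Fintype.ofFinite F
  by_cases hc : IsSquare c
  · exact hc.imp fun s hs => Or.inl hs
  · have hεc : quadraticChar F (ε⁻¹ * c : Fˣ) = 1 := by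
      rw [← isSquare_inv] at hε
      rw [← isSquare_val_iff, ← quadraticChar_neg_one_iff_not_isSquare] at hc hε
      rw [Units.val_mul, map_mul, hε, hc, neg_mul_neg, one_mul]
    obtain ⟨s, hs⟩ := isSquare_val_iff.1 ((quadraticChar_one_iff_isSquare (Units.ne_zero _)).1 hεc)
    exact ⟨s, Or.inr (inv_mul_eq_iff_eq_mul.1 hs)⟩

variable [Fintype F]

include hε in
lemma two_mul_apply_eq [DecidableEq F] {f : F → ℤ} (hf : ∀ (s : Fˣ) c, f (s * s * c) = f c)
    (c : Fˣ) : 2 * f c = f 1 + f ε + quadraticChar F c * (f 1 - f ε) := by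
  have hs (s : Fˣ) : quadraticChar F (s * s) = 1 :=
    (quadraticChar_one_iff_isSquare (mul_ne_zero s.ne_zero s.ne_zero)).2 ⟨s, rfl⟩
  have hχ : quadraticChar F ε = -1 :=
    quadraticChar_neg_one_iff_not_isSquare.2 (isSquare_val_iff.not.2 hε)
  obtain ⟨s, rfl | rfl⟩ := exists_eq_mul_self_or_eq_mul_mul_self hε c
  · rw [Units.val_mul, hs, ← mul_one (s * s : F), hf]
    ring
  · rw [Units.val_mul, Units.val_mul, map_mul, hs, hχ, mul_comm (ε : F), hf]
    ring

include hε in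
lemma two_mul_sum_eq [NeZero (2 : F)] {f : F → ℕ} (hf : ∀ (s : Fˣ) c, f (s * s * c) = f c) :
    2 * ∑ c, f c = (Fintype.card F - 1) * (f 1 + f ε) + 2 * f 0 := by
  classical
  have hχ : ∑ c : Fˣ, quadraticChar F c = 0 := by
    have h := quadraticChar_sum_zero (ringChar_ne_two F)
    rwa [sum_eq_add_sum_units, MulChar.map_zero, zero_add] at h
  have hunits : 2 * ∑ c : Fˣ, (f c : ℤ) = (Fintype.card F - 1 : ℕ) * (f 1 + f ε) := by
    rw [Finset.mul_sum, Finset.sum_congr rfl fun c _ =>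
      two_mul_apply_eq hε (f := fun c => (f c : ℤ)) (by exact_mod_cast hf) c,
      Finset.sum_add_distrib, ← Finset.sum_mul, hχ, zero_mul, add_zero, Finset.sum_const,
      Finset.card_univ, nsmul_eq_mul, Fintype.card_units]
  rw [sum_eq_add_sum_units, mul_add, add_comm]
  exact_mod_cast congrArg (· + 2 * (f 0 : ℤ)) hunits

end Squares

section Weights

variable {F : Type u} [Field F] {M : Type*} [AddCommGroup M] [Module ℂ M]
  (ρ : Representation ℂ SL(2, F) M) (ψ : AddChar F ℂ)

/-- The dual of `ρ`, restricted to the upper unipotent matrices and twisted by the character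
`t ↦ ψ (c t)`. -/
def twistedDual (c : F) : Representation ℂ (Multiplicative F) (Module.Dual ℂ M) where
  toFun t := ψ (c * t.toAdd) • ρ.dual (upper t.toAdd)
  map_one' := by
    rw [toAdd_one, mul_zero, AddChar.map_zero_eq_one, upper_zero, map_one, one_smul]
  map_mul' s t := by
    rw [toAdd_mul, mul_add, AddChar.map_add_eq_mul, ← upper_mul_upper,
      MonoidHom.map_mul ρ.dual, smul_mul_smul_comm]

/-- The functionals on `M` that the upper unipotent matrices multiply by the character
`t ↦ ψ (c t)`. -/
def weightSpace (c : F) : Submodule ℂ (Module.Dual ℂ M) := (twistedDual ρ ψ c).invariants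

variable {ρ ψ}

lemma mem_weightSpace {c : F} {l : Module.Dual ℂ M} :
    l ∈ weightSpace ρ ψ c ↔ ∀ t m, l (ρ (upper t) m) = ψ (c * t) * l m := by
  have happ (t : F) (m : M) :
      twistedDual ρ ψ c (.ofAdd t) l m = ψ (c * t) * l (ρ (upper t)⁻¹ m) := rfl
  refine ⟨fun h t m => ?_, fun h t => LinearMap.ext fun m => ?_⟩
  · conv_lhs => rw [← h (.ofAdd t), happ, Representation.inv_self_apply]
  · change ψ (c * t.toAdd) * l (ρ (upper t.toAdd)⁻¹ m) = l m
    rw [← h, Representation.self_inv_apply]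

lemma comp_torus_mem_weightSpace {c : F} {l : Module.Dual ℂ M} (h : l ∈ weightSpace ρ ψ c)
    (s : Fˣ) : l ∘ₗ ρ (torus s) ∈ weightSpace ρ ψ (s * s * c) := by
  rw [mem_weightSpace] at h ⊢
  intro t m
  rw [LinearMap.comp_apply, ← Module.End.mul_apply, ← map_mul, torus_mul_upper, map_mul,
    Module.End.mul_apply, h, LinearMap.comp_apply]
  congr 2
  ring

lemma finrank_weightSpace_mul_self_mul [FiniteDimensional ℂ M] (s : Fˣ) (c : F) :
    Module.finrank ℂ (weightSpace ρ ψ (s * s * c)) = Module.finrank ℂ (weightSpace ρ ψ c) := by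
  have hle (s : Fˣ) (c : F) : Module.finrank ℂ (weightSpace ρ ψ c) ≤
      Module.finrank ℂ (weightSpace ρ ψ (s * s * c)) := by
    refine LinearMap.finrank_le_finrank_of_injective (f := (ρ (torus s)).dualMap.restrict
      fun l hl => comp_torus_mem_weightSpace hl s) ?_
    have hinj : Function.Injective (ρ (torus s)).dualMap :=
      LinearMap.dualMap_injective_of_surjective (ρ.apply_bijective _).2
    exact fun l l' h => Subtype.ext (hinj (congrArg Subtype.val h))
  refine le_antisymm ((hle s⁻¹ _).trans_eq ?_) (hle s c)
  rw [← mul_assoc, mul_mul_mul_comm, Units.inv_mul, one_mul, one_mul]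

lemma apply_eq_of_finrank_weightSpace_zero_eq [FiniteDimensional ℂ M]
    (h : Module.finrank ℂ (weightSpace ρ ψ 0) = Module.finrank ℂ M) (g : SL(2, F)) (m : M) :
    ρ g m = m := by
  have htop : weightSpace ρ ψ 0 = ⊤ :=
    Submodule.eq_top_of_finrank_eq (h.trans Subspace.dual_finrank_eq.symm)
  have hupper (t : F) : ρ (upper t) = 1 := LinearMap.ext fun m => by
    rw [← sub_eq_zero, ← Module.forall_dual_apply_eq_zero_iff ℂ]
    intro l
    have hl : l ∈ weightSpace ρ ψ 0 := htop ▸ Submodule.mem_top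
    rw [map_sub, mem_weightSpace.1 hl, zero_mul, AddChar.map_zero_eq_one, one_mul,
      Module.End.one_apply, sub_self]
  rw [monoidHom_eq_one_of_upper (χ := ρ) hupper]
  rfl

variable [FiniteDimensional ℂ M]

lemma sum_finrank_weightSpace [Fintype F] (hψ : ψ ≠ 1) :
    ∑ c, Module.finrank ℂ (weightSpace ρ ψ c) = Module.finrank ℂ M := by
  classical
  have hq : (Fintype.card F : ℂ) ≠ 0 := Nat.cast_ne_zero.2 Fintype.card_ne_zero
  have haverage (c : F) : (Fintype.card F : ℂ) • (twistedDual ρ ψ c).averageMap =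
      ∑ t : F, ψ (c * t) • ρ.dual (upper t) := by
    rw [← Fintype.card_multiplicative F, card_smul_averageMap]
    exact (Fintype.sum_equiv Multiplicative.ofAdd _ _ fun _ => rfl).symm
  have hsum : ∑ c, (twistedDual ρ ψ c).averageMap = 1 := by
    refine smul_right_injective _ hq ?_
    simp only [Finset.smul_sum, haverage]
    rw [Finset.sum_comm]
    simp only [← Finset.sum_smul, AddChar.sum_mulShift _ (AddChar.IsPrimitive.of_ne_one hψ)]
    rw [Finset.sum_eq_single 0 (fun t _ ht => by rw [if_neg ht, Nat.cast_zero, zero_smul])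
      (by simp), if_pos rfl, upper_zero, map_one]
  have hproj (c : F) :
      LinearMap.IsProj (weightSpace ρ ψ c) (twistedDual ρ ψ c).averageMap :=
    Representation.isProj_averageMap _
  have htrace := congrArg (LinearMap.trace ℂ _) hsum
  rw [map_sum, LinearMap.trace_one, Subspace.dual_finrank_eq, Finset.sum_congr rfl fun c _ =>
    (hproj c).trace] at htrace
  exact_mod_cast htrace

lemma two_mul_finrank_eq [Fintype F] [NeZero (2 : F)] (hψ : ψ ≠ 1) {ε : Fˣ}
    (hε : ¬ IsSquare ε) : 2 * Module.finrank ℂ M = (Fintype.card F - 1) *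
      (Module.finrank ℂ (weightSpace ρ ψ (2⁻¹ * (1 : Fˣ))) +
        Module.finrank ℂ (weightSpace ρ ψ (2⁻¹ * ε))) +
      2 * Module.finrank ℂ (weightSpace ρ ψ 0) := by
  have h2 : (2 : F)⁻¹ ≠ 0 := inv_ne_zero (NeZero.ne _)
  have h := two_mul_sum_eq hε (f := fun c => Module.finrank ℂ (weightSpace ρ ψ (2⁻¹ * c)))
    fun s c => by rw [← finrank_weightSpace_mul_self_mul s (2⁻¹ * c), mul_left_comm]
  rw [mul_zero] at h
  rw [Units.val_one, ← h, ← sum_finrank_weightSpace (ρ := ρ) hψ]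
  congr 1
  exact (Fintype.sum_equiv (Equiv.mulLeft₀ _ h2) _ _ fun c => rfl).symm

lemma sum_finrank_weightSpace_stdSpace_one [Fintype F] (a : Fˣ) :
    ∑ u, Module.finrank ℂ (weightSpace ρ ψ (2⁻¹ * (stdSpace a 1).form u u)) =
      Module.finrank ℂ (weightSpace ρ ψ 0) +
        (Fintype.card F - 1) * Module.finrank ℂ (weightSpace ρ ψ (2⁻¹ * a)) := by
  classical
  have hunits (s : Fˣ) : Module.finrank ℂ (weightSpace ρ ψ (2⁻¹ * (a * (s * s)))) =
      Module.finrank ℂ (weightSpace ρ ψ (2⁻¹ * a)) := by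
    rw [← finrank_weightSpace_mul_self_mul s (2⁻¹ * a), mul_comm (a : F), mul_left_comm]
  rw [Fintype.sum_equiv (Equiv.funUnique (Fin 1) F) _
    (fun x => Module.finrank ℂ (weightSpace ρ ψ (2⁻¹ * (a * (x * x))))) fun u => by
      rw [stdSpace_one]; rfl, sum_eq_add_sum_units]
  simp only [hunits, Finset.sum_const, Finset.card_univ, Fintype.card_units, smul_eq_mul]
  rw [mul_zero, mul_zero, mul_zero]

end Weights

section Half

variable {F : Type u} [Field F] [NeZero (2 : F)] {ψ : AddChar F ℂ} (hψ : ψ ≠ 1)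

section Functions

variable [Finite F] {U : Type w} [AddCommGroup U] [Module F U] [Finite U] {Q : QuadSpace F U}

open scoped Classical in
lemma oscG_torus_single_apply_self {v : U} (hv : v ≠ 0) {s : Fˣ} (hs : s ≠ 1) :
    Q.oscG hψ (torus s) (Pi.single v 1) v = 0 := by
  have hsv : ((s : F) - 1) • v ≠ 0 := smul_ne_zero (sub_ne_zero.2 fun h => hs (Units.ext h)) hv
  obtain ⟨x, hx⟩ := exists_form_char_ne_one (Q := Q) hψ hsv
  have heigen : Q.heisOp ψ x 0 (Pi.single v 1) = ψ (-Q.form x v) • Pi.single v (1 : ℂ) := by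
    refine funext fun u => ?_
    rw [heisOp_apply]
    by_cases hu : u = v <;> simp [hu]
  have hegorov := congrFun (LinearMap.congr_fun (oscG_mul_heisOp (Q := Q) hψ (torus s) x 0)
    (Pi.single v 1)) v
  rw [Module.End.mul_apply, heigen, map_smul, Module.End.mul_apply, heisOp_apply] at hegorov
  simp only [coe_torus, Matrix.of_apply, Matrix.cons_val_zero, Matrix.cons_val_one,
    Matrix.cons_val', Matrix.cons_val_fin_one, smul_zero, zero_smul, add_zero, map_zero,
    mul_zero, sub_zero, Pi.smul_apply, smul_eq_mul, map_smul, LinearMap.smul_apply] at hegorov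
  by_contra hne
  have hchar : ψ (-Q.form x v) = ψ (-(s * Q.form x v)) := mul_right_cancel₀ hne hegorov
  refine hx ?_
  have hform : Q.form (((s : F) - 1) • v) x = -Q.form x v - -(s * Q.form x v) := by
    rw [map_smul, LinearMap.smul_apply, smul_eq_mul, Q.symm v x]
    ring
  rw [hform, AddChar.map_sub_eq_div, hchar, div_self]
  exact (AddChar.val_isUnit ψ _).ne_zero

end Functions

variable {M : Type v} [AddCommGroup M] [Module ℂ M] {ρ : Representation ℂ SL(2, F) M}

section Functionals

variable [Finite F] {U : Type w} [AddCommGroup U] [Module F U]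

lemma pi_mem_fixedUpper [Finite U] (Q : QuadSpace F U) {l : U → Module.Dual ℂ M}
    (hl : ∀ u, l u ∈ weightSpace ρ ψ (2⁻¹ * Q.form u u)) :
    LinearMap.pi l ∈ fixedUpper (Representation.linHom ρ (Q.oscG hψ)) := fun t => by
  refine LinearMap.ext fun m => funext fun u => ?_
  change Q.oscG hψ (upper t.toAdd) (LinearMap.pi l (ρ (upper t.toAdd)⁻¹ m)) u = l u m
  have hu := mem_weightSpace.1 (hl u) t.toAdd (ρ (upper t.toAdd)⁻¹ m)
  rw [Representation.self_inv_apply] at hu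
  rw [oscG_upper_apply, LinearMap.pi_apply, hu, mul_left_comm, mul_comm t.toAdd, mul_assoc]

lemma sum_finrank_le_finrank_fixedUpper [FiniteDimensional ℂ M] [Fintype U]
    (Q : QuadSpace F U) :
    ∑ u, Module.finrank ℂ (weightSpace ρ ψ (2⁻¹ * Q.form u u)) ≤
      Module.finrank ℂ (fixedUpper (Representation.linHom ρ (Q.oscG hψ))) := by
  rw [← Module.finrank_pi_fintype ℂ]
  let T : (∀ u, weightSpace ρ ψ (2⁻¹ * Q.form u u)) →ₗ[ℂ]
      fixedUpper (Representation.linHom ρ (Q.oscG hψ)) :=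
    { toFun l := ⟨LinearMap.pi fun u => (l u).1, pi_mem_fixedUpper hψ Q fun u => (l u).2⟩
      map_add' _ _ := rfl
      map_smul' _ _ := rfl }
  refine LinearMap.finrank_le_finrank_of_injective (f := T) fun l l' h => ?_
  refine funext fun u => Subtype.ext (LinearMap.ext fun m => ?_)
  exact congrFun (LinearMap.congr_fun (congrArg Subtype.val h) m) u

-- Averaging the functional `l` placed at `v` over the torus does not cancel it: the matrices
-- `torus s` with `s ≠ 1` move the point mass at `v` away from `v`.
lemma fixedBorel_ne_bot [Finite U] (Q : QuadSpace F U) {v : U} (hv : v ≠ 0)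
    {l : Module.Dual ℂ M} (hl : l ∈ weightSpace ρ ψ (2⁻¹ * Q.form v v)) (hl0 : l ≠ 0) :
    fixedBorel (Representation.linHom ρ (Q.oscG hψ)) ≠ ⊥ := by
  classical
  have := Fintype.ofFinite F
  set σ := Representation.linHom ρ (Q.oscG hψ)
  have hmem : LinearMap.pi (Pi.single v l) ∈ fixedUpper σ := by
    refine pi_mem_fixedUpper hψ Q fun u => ?_
    obtain rfl | hu := eq_or_ne u v
    · rwa [Pi.single_eq_same]
    · rw [Pi.single_eq_of_ne hu]
      exact zero_mem _
  have hpi (m : M) : LinearMap.pi (Pi.single v l) m = l m • Pi.single v (1 : ℂ) := by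
    refine funext fun u => ?_
    by_cases hu : u = v <;> simp [hu]
  have htorus (s : Fˣ) (m : M) : σ (torus s) (LinearMap.pi (Pi.single v l)) m v =
      if s = 1 then l m else 0 := by
    change Q.oscG hψ (torus s) (LinearMap.pi (Pi.single v l) (ρ (torus s)⁻¹ m)) v = _
    rw [hpi, map_smul, Pi.smul_apply]
    split_ifs with hs
    · simp [hs, torus_one]
    · rw [oscG_torus_single_apply_self hψ hv hs, smul_zero]
  intro hbot
  have hproj : projTorus σ (LinearMap.pi (Pi.single v l)) = 0 := by
    have h := (isProj_projBorel σ).map_mem (LinearMap.pi (Pi.single v l))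
    rwa [projBorel, commute_projUpper_projTorus, Module.End.mul_apply,
      (isProj_projUpper σ).map_id _ hmem, hbot, Submodule.mem_bot] at h
  refine hl0 (LinearMap.ext fun m => ?_)
  calc l m = (∑ s : Fˣ, σ (torus s)) (LinearMap.pi (Pi.single v l)) m v := by
        rw [LinearMap.sum_apply, LinearMap.sum_apply, Finset.sum_apply]
        simp only [htorus, Finset.sum_ite_eq', Finset.mem_univ, if_true]
    _ = 0 := by
        rw [sum_torus, LinearMap.smul_apply, hproj, smul_zero]
        rfl

end Functionals

lemma Occurs.of_invariants_linHom_ne_bot {G : Type*} [Group G] {N : Type*} [AddCommGroup N]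
    [Module ℂ N] {ρ : Representation ℂ G M} {ω : Representation ℂ G N} (hρ : ρ.IsIrreducible)
    (h : (Representation.linHom ρ ω).invariants ≠ ⊥) : Occurs ρ ω := by
  obtain ⟨v, hv, hv0⟩ := Submodule.exists_mem_ne_zero_of_ne_bot h
  let φ : IntertwiningMap ρ ω :=
    Representation.invariantsEquivIntertwiningMap ρ ω ⟨v, hv⟩
  exact ⟨φ, (Representation.IsIrreducible.injective_or_eq_zero φ).resolve_right fun h =>
    hv0 (congrArg IntertwiningMap.toLinearMap h)⟩

lemma occurs_oscG_stdSpace_one [Fintype F] [FiniteDimensional ℂ M] (hρ : ρ.IsIrreducible) {a : Fˣ}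
    (ha : weightSpace ρ ψ (2⁻¹ * a) ≠ ⊥)
    (hdim : 2 * (Module.finrank ℂ M * Fintype.card F) <
      (Fintype.card F + 1) * (Module.finrank ℂ (weightSpace ρ ψ 0) +
        (Fintype.card F - 1) * Module.finrank ℂ (weightSpace ρ ψ (2⁻¹ * a))) +
      (Fintype.card F - 1)) :
    Occurs ρ ((stdSpace a 1).oscG hψ) := by
  refine .of_invariants_linHom_ne_bot hρ fun hbot => ?_
  have hbound := card_mul_finrank_fixedUpper_add_le hbot
  have hupper := sum_finrank_le_finrank_fixedUpper (ρ := ρ) hψ (stdSpace a 1)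
  rw [sum_finrank_weightSpace_stdSpace_one] at hupper
  have hborel : 1 ≤ Module.finrank ℂ
      (fixedBorel (Representation.linHom ρ ((stdSpace a 1).oscG hψ))) := by
    rw [Nat.one_le_iff_ne_zero, Ne, Submodule.finrank_eq_zero]
    obtain ⟨l, hl, hl0⟩ := Submodule.exists_mem_ne_zero_of_ne_bot ha
    refine fixedBorel_ne_bot hψ (stdSpace a 1) (v := fun _ => 1)
      (fun h => one_ne_zero (congrFun h 0)) (l := l) ?_ hl0
    rwa [stdSpace_one, mul_one, mul_one]
  rw [Module.finrank_linearMap, Module.finrank_pi, Fintype.card_fun, Fintype.card_fin,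
    pow_one] at hbound
  have hmul := Nat.mul_le_mul_left (Fintype.card F + 1) hupper
  have hmul' := Nat.mul_le_mul_left (Fintype.card F - 1) hborel
  omega

/-- The weights of an irreducible representation of dimension `e = (q ± 1) / 2`: here `A` and `B`
are the multiplicities of the two classes of nonzero weights, `z` that of the weight `0`. -/
lemma two_mul_mul_lt {q e A B z d : ℕ} (hq : 1 < q) (hq3 : q ≠ 3)
    (he : 2 * e = q + 1 ∨ 2 * e + 1 = q) (hsum : 2 * e = (q - 1) * (A + B) + 2 * z)
    (hAB : A ≠ 0 ∨ B ≠ 0) (hd : d ≠ 0) :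
    2 * (e * q) < (q + 1) * (z + (q - 1) * d) + (q - 1) := by
  obtain ⟨p, rfl⟩ : ∃ p, q = p + 1 := ⟨q - 1, by omega⟩
  rw [Nat.add_sub_cancel] at hsum ⊢
  have hpd : p ≤ p * d := Nat.le_mul_of_pos_right p (by omega)
  rw [← mul_assoc]
  rcases he with he | he
  · have hz : z ≠ 0 := by
      rintro rfl
      rcases Nat.lt_or_ge (A + B) 2 with hlt | hge
      · rw [show A + B = 1 by omega] at hsum
        omega
      · have := Nat.mul_le_mul_left p hge
        omega
    rw [he]
    have := Nat.mul_le_mul_left (p + 1 + 1) (show p + 1 ≤ z + p * d by omega)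
    omega
  · rw [show 2 * e = p by omega]
    nlinarith [Nat.mul_le_mul_left (p + 1 + 1) (show p ≤ z + p * d by omega)]

theorem occurs_oscG_stdSpace_one_or [Finite F] {ε : Fˣ} (hε : ¬ IsSquare ε)
    (hρ : ρ.IsIrreducible)
    (hd : 2 * Module.finrank ℂ M = Nat.card F + 1 ∨ 2 * Module.finrank ℂ M + 1 = Nat.card F)
    (h3 : Nat.card F ≠ 3) :
    Occurs ρ ((stdSpace 1 1).oscG hψ) ∨ Occurs ρ ((stdSpace ε 1).oscG hψ) := by
  have := Fintype.ofFinite F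
  rw [Nat.card_eq_fintype_card] at hd h3
  have hq : 1 < Fintype.card F := Fintype.one_lt_card
  have : FiniteDimensional ℂ M := FiniteDimensional.of_finrank_pos (by omega)
  have hsum := two_mul_finrank_eq (ρ := ρ) hψ hε
  have hweight : Module.finrank ℂ (weightSpace ρ ψ (2⁻¹ * (1 : Fˣ))) ≠ 0 ∨
      Module.finrank ℂ (weightSpace ρ ψ (2⁻¹ * ε)) ≠ 0 := by
    by_contra! h
    rw [h.1, h.2] at hsum
    have hM := finrank_eq_one_of_isIrreducible_of_trivial hρ
      (apply_eq_of_finrank_weightSpace_zero_eq (ψ := ψ) (by omega))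
    omega
  have hocc (a : Fˣ) (ha : Module.finrank ℂ (weightSpace ρ ψ (2⁻¹ * a)) ≠ 0) :
      Occurs ρ ((stdSpace a 1).oscG hψ) :=
    occurs_oscG_stdSpace_one hψ hρ (fun h => ha (Submodule.finrank_eq_zero.2 h))
      (two_mul_mul_lt hq h3 hd hsum hweight ha)
  exact hweight.imp (hocc 1) (hocc ε)

end Half

/-! ### Changing the model of the oscillator representation -/

section Models

section Prod

variable {F : Type u} [Field F] {U : Type v} [AddCommGroup U] [Module F U] {U' : Type w}
  [AddCommGroup U'] [Module F U'] (Q : QuadSpace F U) (Q' : QuadSpace F U')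

/-- The orthogonal direct sum of two quadratic spaces. -/
def QuadSpace.prod : QuadSpace F (U × U') where
  form := Q.form.compl₁₂ (LinearMap.fst F U U') (LinearMap.fst F U U') +
    Q'.form.compl₁₂ (LinearMap.snd F U U') (LinearMap.snd F U U')
  symm x y := by simp [Q.symm x.1, Q'.symm x.2]
  nondeg x hx := Prod.ext (Q.nondeg _ fun y => by simpa using hx (y, 0))
    (Q'.nondeg _ fun y => by simpa using hx (0, y))

lemma QuadSpace.prod_form (x y : U × U') :
    (Q.prod Q').form x y = Q.form x.1 y.1 + Q'.form x.2 y.2 := rfl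

end Prod

section TensorFun

variable (U : Type v) (U' : Type w) [Finite U] [Finite U']

/-- The identification of the functions on a product with a tensor product, the pure tensor of
`f` and `f'` being `(u, u') ↦ f u * f' u'`. -/
def tensorFun : (U → ℂ) ⊗[ℂ] (U' → ℂ) ≃ₗ[ℂ] (U × U' → ℂ) :=
  ((Pi.basisFun ℂ U).tensorProduct (Pi.basisFun ℂ U')).equivFun

variable {U U'}

lemma tensorFun_tmul (f : U → ℂ) (f' : U' → ℂ) (p : U × U') :
    tensorFun U U' (f ⊗ₜ f') p = f p.1 * f' p.2 := by
  obtain ⟨i, j⟩ := p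
  rw [tensorFun, Module.Basis.equivFun_apply, Module.Basis.tensorProduct_repr_tmul_apply,
    Pi.basisFun_repr, Pi.basisFun_repr, smul_eq_mul, mul_comm]

end TensorFun

variable {F : Type u} [Field F] [Finite F] [NeZero (2 : F)] {U : Type v} [AddCommGroup U]
  [Module F U] [Finite U] {U' : Type w} [AddCommGroup U'] [Module F U'] [Finite U']

lemma nonempty_equiv_oscG (Q : QuadSpace F U) {ψ : AddChar F ℂ} (hψ : ψ ≠ 1) {N : Type*}
    [AddCommGroup N] [Module ℂ N] (κ : Representation ℂ SL(2, F) N)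
    (C : N ≃ₗ[ℂ] (U → ℂ)) (H : U → U → Module.End ℂ N)
    (hH : ∀ x y n, C (H x y n) = Q.heisOp ψ x y (C n))
    (hκ : ∀ g x y n, κ g (H x y n) =
      H (g.1 0 0 • x + g.1 0 1 • y) (g.1 1 0 • x + g.1 1 1 • y) (κ g n))
    (hu : ∀ t n u, C (κ (upper t) n) u = ψ (2⁻¹ * (t * Q.form u u)) * C n u) :
    Nonempty (κ.Equiv (Q.oscG hψ)) := by
  have hC (g : SL(2, F)) (n : N) : transport κ C g (C n) = C (κ g n) :=
    ((transportEquiv κ C).toIntertwiningMap.isIntertwining κ (transport κ C) g n).symm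
  have heq : transport κ C = Q.oscG hψ := by
    refine eq_oscG hψ _ (fun g x y => LinearMap.ext fun f => ?_) fun t f u => ?_
    · obtain ⟨n, rfl⟩ := C.surjective f
      rw [Module.End.mul_apply, Module.End.mul_apply, ← hH, hC, hκ, hH, hC]
    · obtain ⟨n, rfl⟩ := C.surjective f
      rw [hC, hu]
  exact heq ▸ ⟨transportEquiv κ C⟩

lemma nonempty_equiv_oscG_of_linearEquiv {Q : QuadSpace F U} {Q' : QuadSpace F U'}
    {ψ ψ' : AddChar F ℂ} (hψ : ψ ≠ 1) (hψ' : ψ' ≠ 1) (L : U ≃ₗ[F] U')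
    (h : ∀ x y, ψ' (Q'.form (L x) (L y)) = ψ (Q.form x y)) :
    Nonempty ((Q'.oscG hψ').Equiv (Q.oscG hψ)) := by
  refine nonempty_equiv_oscG Q hψ _ (LinearEquiv.funCongrLeft ℂ ℂ L.toEquiv)
    (fun x y => Q'.heisOp ψ' (L x) (L y)) (fun x y f => funext fun u => ?_) (fun g x y f => ?_)
    fun t f u => ?_
  · change Q'.heisOp ψ' (L x) (L y) f (L u) = Q.heisOp ψ x y (f ∘ L) u
    have hchar := h x (-u - (2⁻¹ : F) • y)
    simp only [map_sub, map_neg, map_smul, smul_eq_mul] at hchar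
    rw [heisOp_apply, heisOp_apply, Function.comp_apply, map_add, hchar]
  · have hegorov := LinearMap.congr_fun (oscG_mul_heisOp (Q := Q') hψ' g (L x) (L y)) f
    rw [Module.End.mul_apply, Module.End.mul_apply] at hegorov
    simp only [hegorov, map_add, map_smul]
  · change Q'.oscG hψ' (upper t) f (L u) = ψ (2⁻¹ * (t * Q.form u u)) * f (L u)
    have hchar := h u (((2⁻¹ : F) * t) • u)
    simp only [map_smul, smul_eq_mul, mul_assoc] at hchar
    rw [oscG_upper_apply, hchar]

section TensorProduct

variable (Q : QuadSpace F U) (Q' : QuadSpace F U') {ψ : AddChar F ℂ} (hψ : ψ ≠ 1)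

omit [Finite F] in
lemma tensorFun_map_heisOp (x y : U × U') (n : (U → ℂ) ⊗[ℂ] (U' → ℂ)) :
    tensorFun U U' (TensorProduct.map (Q.heisOp ψ x.1 y.1) (Q'.heisOp ψ x.2 y.2) n) =
      (Q.prod Q').heisOp ψ x y (tensorFun U U' n) := by
  have h : (tensorFun U U').toLinearMap ∘ₗ
      TensorProduct.map (Q.heisOp ψ x.1 y.1) (Q'.heisOp ψ x.2 y.2) =
        (Q.prod Q').heisOp ψ x y ∘ₗ (tensorFun U U').toLinearMap := by
    refine TensorProduct.ext' fun f f' => funext fun p => ?_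
    rw [LinearMap.comp_apply, LinearMap.comp_apply, LinearEquiv.coe_coe, TensorProduct.map_tmul,
      tensorFun_tmul, heisOp_apply, heisOp_apply, heisOp_apply, tensorFun_tmul,
      mul_mul_mul_comm, ← AddChar.map_add_eq_mul, QuadSpace.prod_form, QuadSpace.prod_form]
    congr 2
    ring
  exact LinearMap.congr_fun h n

lemma tensorFun_tprod_oscG_upper (t : F) (n : (U → ℂ) ⊗[ℂ] (U' → ℂ)) (p : U × U') :
    tensorFun U U' ((Q.oscG hψ).tprod (Q'.oscG hψ) (upper t) n) p =
      ψ (2⁻¹ * (t * (Q.prod Q').form p p)) * tensorFun U U' n p := by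
  revert n
  refine LinearMap.congr_fun
    (f := LinearMap.proj p ∘ₗ (tensorFun U U').toLinearMap ∘ₗ
      (Q.oscG hψ).tprod (Q'.oscG hψ) (upper t))
    (g := ψ (2⁻¹ * (t * (Q.prod Q').form p p)) • LinearMap.proj p ∘ₗ (tensorFun U U').toLinearMap)
    (TensorProduct.ext' fun f f' => ?_)
  change tensorFun U U' ((Q.oscG hψ).tprod (Q'.oscG hψ) (upper t) (f ⊗ₜ f')) p =
    ψ _ * tensorFun U U' (f ⊗ₜ f') p
  rw [Representation.tprod_apply, TensorProduct.map_tmul, tensorFun_tmul, tensorFun_tmul,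
    oscG_upper_apply, oscG_upper_apply, mul_mul_mul_comm, ← AddChar.map_add_eq_mul,
    QuadSpace.prod_form, mul_add, mul_add]

lemma nonempty_tprod_equiv_oscG_prod :
    Nonempty (((Q.oscG hψ).tprod (Q'.oscG hψ)).Equiv ((Q.prod Q').oscG hψ)) := by
  refine nonempty_equiv_oscG _ hψ _ (tensorFun U U')
    (fun x y => TensorProduct.map (Q.heisOp ψ x.1 y.1) (Q'.heisOp ψ x.2 y.2))
    (tensorFun_map_heisOp Q Q') (fun g x y => ?_) (tensorFun_tprod_oscG_upper Q Q' hψ)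
  have hegorov : (Q.oscG hψ).tprod (Q'.oscG hψ) g *
      TensorProduct.map (Q.heisOp ψ x.1 y.1) (Q'.heisOp ψ x.2 y.2) =
        TensorProduct.map
            (Q.heisOp ψ (g.1 0 0 • x.1 + g.1 0 1 • y.1) (g.1 1 0 • x.1 + g.1 1 1 • y.1))
            (Q'.heisOp ψ (g.1 0 0 • x.2 + g.1 0 1 • y.2) (g.1 1 0 • x.2 + g.1 1 1 • y.2)) *
          (Q.oscG hψ).tprod (Q'.oscG hψ) g := by
    rw [Representation.tprod_apply, ← TensorProduct.map_mul, oscG_mul_heisOp, oscG_mul_heisOp,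
      TensorProduct.map_mul]
  exact LinearMap.congr_fun hegorov

end TensorProduct

end Models

section BinaryForms

variable {F : Type u} [Field F] [Finite F] [NeZero (2 : F)]

lemma exists_mul_sq_add_mul_sq_eq_one (a b : Fˣ) : ∃ x y : F, a * x ^ 2 + b * y ^ 2 = 1 := by
  have := Fintype.ofFinite F
  have ha : (Polynomial.C (a : F) * Polynomial.X ^ 2 - 1).degree = 2 := by
    compute_degree!
  have hb : (Polynomial.C (b : F) * Polynomial.X ^ 2).degree = 2 := by
    compute_degree!
  obtain ⟨x, y, h⟩ := FiniteField.exists_root_sum_quadratic ha hb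
    (FiniteField.odd_card_of_char_ne_two (ringChar_ne_two F))
  simp only [Polynomial.eval_sub, Polynomial.eval_mul, Polynomial.eval_C, Polynomial.eval_pow,
    Polynomial.eval_X, Polynomial.eval_one] at h
  exact ⟨x, y, by linear_combination h⟩

-- The first basis vector has value `1` and the second, orthogonal to it, has value `-δ`, where `δ`
-- represents the class of `-a * b` modulo squares.
lemma exists_linearEquiv_stdSpace_two {ε : Fˣ} (hε : ¬ IsSquare ε) (a b : Fˣ) :
    ∃ δ : Fˣ, (δ = 1 ∨ δ = ε) ∧ ∃ L : (Fin 2 → F) ≃ₗ[F] (Fin 1 → F) × (Fin 1 → F), ∀ x y,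
      ((stdSpace a 1).prod (stdSpace b 1)).form (L x) (L y) = (stdSpace δ 2).form x y := by
  obtain ⟨x₀, y₀, hunit⟩ := exists_mul_sq_add_mul_sq_eq_one a b
  obtain ⟨δ, hδ, s, hs⟩ : ∃ δ : Fˣ, (δ = 1 ∨ δ = ε) ∧ ∃ s : Fˣ, -(a * b) = δ * (s * s) := by
    obtain ⟨s, hs | hs⟩ := exists_eq_mul_self_or_eq_mul_mul_self hε (-(a * b))
    · exact ⟨1, Or.inl rfl, s, by rw [hs, one_mul]⟩
    · exact ⟨ε, Or.inr rfl, s, hs⟩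
  have hdet : (a : F) * b * ((s : F)⁻¹ * (s : F)⁻¹) = -δ := by
    have hs' : -((a : F) * b) = δ * (s * s) := by exact_mod_cast congrArg Units.val hs
    rw [← neg_neg ((a : F) * b), hs']
    field_simp
  let L : (Fin 2 → F) →ₗ[F] (Fin 1 → F) × (Fin 1 → F) :=
    { toFun x := (fun _ => x₀ * x 0 - (s : F)⁻¹ * b * y₀ * x 1,
        fun _ => y₀ * x 0 + (s : F)⁻¹ * a * x₀ * x 1)
      map_add' x y := by ext <;> simp <;> ring
      map_smul' c x := by ext <;> simp <;> ring }
  have hL (x y) : ((stdSpace a 1).prod (stdSpace b 1)).form (L x) (L y) =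
      (stdSpace δ 2).form x y := by
    rw [QuadSpace.prod_form, stdSpace_one, stdSpace_one, stdSpace_two]
    simp only [L, LinearMap.coe_mk, AddHom.coe_mk]
    linear_combination (x 0 * y 0 + (a : F) * b * ((s : F)⁻¹ * (s : F)⁻¹) * (x 1 * y 1)) *
      hunit + x 1 * y 1 * hdet
  have hinj : Function.Injective L := (injective_iff_map_eq_zero L).2 fun x hx =>
    (stdSpace δ 2).nondeg x fun y => by
      rw [← hL, hx, map_zero, LinearMap.zero_apply]
  exact ⟨δ, hδ, L.linearEquivOfInjective hinj (by simp), hL⟩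

end BinaryForms

lemma exists_eq_mulShift {F : Type u} [Field F] [Finite F] {ψ ψ' : AddChar F ℂ}
    (hψ : ψ ≠ 1) (hψ' : ψ' ≠ 1) : ∃ c : Fˣ, ψ' = ψ.mulShift c := by
  classical
  have := Fintype.ofFinite F
  have hinj : Function.Injective (AddChar.mulShift ψ) :=
    AddChar.to_mulShift_inj_of_isPrimitive (AddChar.IsPrimitive.of_ne_one hψ)
  obtain ⟨c, rfl⟩ := ((Fintype.bijective_iff_injective_and_card _).2
    ⟨hinj, AddChar.card_eq.symm⟩).2 ψ'
  have hc : c ≠ 0 := by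
    rintro rfl
    exact hψ' (AddChar.mulShift_zero ψ)
  exact ⟨Units.mk0 c hc, rfl⟩

section TensorProduct

variable {G : Type*} [Group G] {M M' N N' : Type*} [AddCommGroup M] [Module ℂ M]
  [AddCommGroup M'] [Module ℂ M'] [AddCommGroup N] [Module ℂ N] [AddCommGroup N'] [Module ℂ N']

lemma Occurs.tprod {ρ : Representation ℂ G M} {ρ' : Representation ℂ G M'}
    {σ : Representation ℂ G N} {σ' : Representation ℂ G N'} (h : Occurs ρ σ)
    (h' : Occurs ρ' σ') : Occurs (ρ.tprod ρ') (σ.tprod σ') := by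
  obtain ⟨f, hf⟩ := h
  obtain ⟨f', hf'⟩ := h'
  refine ⟨f.tensor f', ?_⟩
  exact TensorProduct.map_injective_of_flat_flat _ _ hf hf'

lemma occurs_tprod_trivial (ρ : Representation ℂ G M) :
    Occurs (ρ.tprod (Representation.trivial ℂ G ℂ)) ρ :=
  .of_equiv (Representation.TensorProduct.rid ℂ ρ)

end TensorProduct

section Occurrence

variable {F : Type u} [Field F] [Finite F] [NeZero (2 : F)] {ψ : AddChar F ℂ} (hψ : ψ ≠ 1)

lemma occurs_oscG_stdSpace_of_mulShift {M : Type*} [AddCommGroup M] [Module ℂ M]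
    {ρ : Representation ℂ SL(2, F) M} {c : Fˣ} (hc : ψ.mulShift c ≠ 1)
    (ho : Occurs ρ ((stdSpace 1 1).oscG hc)) {a s : Fˣ} (hs : c = a * (s * s)) :
    Occurs ρ ((stdSpace a 1).oscG hψ) := by
  obtain ⟨e⟩ := nonempty_equiv_oscG_of_linearEquiv (Q := stdSpace a 1) (Q' := stdSpace 1 1)
    hψ hc (LinearEquiv.smulOfUnit s⁻¹) fun x y => by
      rw [AddChar.mulShift_apply, hs, stdSpace_one, stdSpace_one]
      congr 1
      change ((a * (s * s) : Fˣ) : F) * ((1 : Fˣ) * (((s⁻¹ : Fˣ) : F) * x 0 *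
        (((s⁻¹ : Fˣ) : F) * y 0))) = _
      push_cast
      field_simp
  exact ho.trans (.of_equiv e)

lemma IsHalf.occurs {M : Type*} [AddCommGroup M] [Module ℂ M] {ρ : Representation ℂ SL(2, F) M}
    (h : IsHalf ρ) {ε : Fˣ} (hε : ¬ IsSquare ε) :
    Occurs ρ ((stdSpace 1 1).oscG hψ) ∨ Occurs ρ ((stdSpace ε 1).oscG hψ) := by
  obtain ⟨hρ, hdim, h3⟩ := h
  by_cases hq : Nat.card F = 3
  · obtain ⟨ψ', hψ', ho⟩ := h3 hq
    obtain ⟨c, rfl⟩ := exists_eq_mulShift hψ hψ'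
    obtain ⟨s, hs | hs⟩ := exists_eq_mul_self_or_eq_mul_mul_self hε c
    · exact Or.inl (occurs_oscG_stdSpace_of_mulShift hψ hψ' ho (hs.trans (one_mul _).symm))
    · exact Or.inr (occurs_oscG_stdSpace_of_mulShift hψ hψ' ho hs)
  · exact occurs_oscG_stdSpace_one_or hψ hε hρ hdim hq

lemma occurs_trivial_oscG (Q : QuadSpace F (Fin 0 → F)) :
    Occurs (Representation.trivial ℂ SL(2, F) ℂ) (Q.oscG hψ) := by
  obtain ⟨e⟩ := nonempty_equiv_oscG Q hψ (Representation.trivial ℂ SL(2, F) ℂ)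
    (LinearEquiv.funUnique (Fin 0 → F) ℂ ℂ).symm (fun _ _ => 1)
    (fun x y n => funext fun u => by
      rw [heisOp_apply, Subsingleton.elim x 0, map_zero, LinearMap.zero_apply,
        LinearMap.zero_apply]
      simp)
    (fun _ _ _ _ => rfl)
    (fun t n u => by
      rw [Subsingleton.elim u 0, map_zero]
      simp)
  exact .of_equiv e

lemma Occurs.tprod_oscG {M M' : Type*} [AddCommGroup M] [Module ℂ M] [AddCommGroup M']
    [Module ℂ M'] {ρ : Representation ℂ SL(2, F) M} {ρ' : Representation ℂ SL(2, F) M'}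
    {ε : Fˣ} (hε : ¬ IsSquare ε) {a b : Fˣ} (h : Occurs ρ ((stdSpace a 1).oscG hψ))
    (h' : Occurs ρ' ((stdSpace b 1).oscG hψ)) :
    Occurs (ρ.tprod ρ') ((stdSpace 1 2).oscG hψ) ∨
      Occurs (ρ.tprod ρ') ((stdSpace ε 2).oscG hψ) := by
  obtain ⟨δ, hδ, L, hL⟩ := exists_linearEquiv_stdSpace_two hε a b
  obtain ⟨e⟩ := nonempty_tprod_equiv_oscG_prod (stdSpace a 1) (stdSpace b 1) hψ
  obtain ⟨e'⟩ := nonempty_equiv_oscG_of_linearEquiv hψ hψ L fun x y => by rw [hL]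
  have ho : Occurs (ρ.tprod ρ') ((stdSpace δ 2).oscG hψ) :=
    ((h.tprod h').trans (.of_equiv e)).trans (.of_equiv e')
  rcases hδ with rfl | rfl
  · exact Or.inl ho
  · exact Or.inr ho

theorem IsHalfProduct.occurs {k : ℕ} (hk : k ≤ 2) {N : Type} [AddCommGroup N] [Module ℂ N]
    {σ : Representation ℂ SL(2, F) N} (h : IsHalfProduct F k N σ) {ε : Fˣ}
    (hε : ¬ IsSquare ε) :
    Occurs σ ((stdSpace 1 k).oscG hψ) ∨ Occurs σ ((stdSpace ε k).oscG hψ) := by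
  cases h with
  | zero => exact Or.inl (occurs_trivial_oscG hψ _)
  | succ l M₁ ρ₁ N₁ σ₁ hρ₁ hσ₁ =>
    cases hσ₁ with
    | zero =>
      exact (hρ₁.occurs hψ hε).imp (occurs_tprod_trivial ρ₁).trans (occurs_tprod_trivial ρ₁).trans
    | succ l M₂ ρ₂ N₂ σ₂ hρ₂ hσ₂ =>
      cases hσ₂ with
      | zero =>
        have h₂ := (hρ₂.occurs hψ hε).imp (occurs_tprod_trivial ρ₂).trans
          (occurs_tprod_trivial ρ₂).trans
        rcases hρ₁.occurs hψ hε with h₁ | h₁ <;> rcases h₂ with h₂ | h₂ <;>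
          exact h₁.tprod_oscG hψ hε h₂
      | succ l M₃ ρ₃ N₃ σ₃ hρ₃ hσ₃ => omega

theorem IsIrrepOfRank.occurs {k : ℕ} (hk : k ≤ 2) {M : Type*} [AddCommGroup M] [Module ℂ M]
    {ρ : Representation ℂ SL(2, F) M} (h : IsIrrepOfRank k ρ) {ε : Fˣ} (hε : ¬ IsSquare ε) :
    Occurs ρ ((stdSpace 1 k).oscG hψ) ∨ Occurs ρ ((stdSpace ε k).oscG hψ) := by
  obtain ⟨-, ⟨l, hl, N, _, _, σ, hσ, ho⟩, hlt⟩ := h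
  obtain rfl : l = k := by
    by_contra hne
    exact hlt l (by omega) ⟨l, le_rfl, N, _, _, σ, hσ, ho⟩
  exact (hσ.occurs hψ hk hε).imp ho.trans ho.trans

end Occurrence

end EtaCorrespondence

end

theorem theorem4 {F : Type*} [Field F] [Finite F] [NeZero (2 : F)]
    {ψ : AddChar F ℂ} (hψ : ψ ≠ 1) (k : ℕ) (hk : k ≤ 2) :
    (∀ Q : QuadSpace F (Fin k → F),
      Subalgebra.centralizer ℂ (Q.algO hψ k : Set (Module.End ℂ (Q.spec hψ k))) = Q.algG hψ k ∧
      Subalgebra.centralizer ℂ (Q.algG hψ k : Set (Module.End ℂ (Q.spec hψ k))) = Q.algO hψ k ∧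
      (∀ (T : Type) [AddCommGroup T] [Module ℂ T] (τ : Representation ℂ Q.O T),
        τ.IsIrreducible → Occurs τ (Q.specO hψ k) →
          IsIrrepOfRank (M := Q.etaSpace hψ k τ) k (Q.eta hψ k τ)) ∧
      (∀ (T T' : Type) [AddCommGroup T] [Module ℂ T] [AddCommGroup T'] [Module ℂ T']
        (τ : Representation ℂ Q.O T) (τ' : Representation ℂ Q.O T'),
        τ.IsIrreducible → τ'.IsIrreducible →
        Occurs τ (Q.specO hψ k) → Occurs τ' (Q.specO hψ k) →
        (Nonempty ((Q.eta hψ k τ).Equiv (Q.eta hψ k τ')) ↔ Nonempty (τ.Equiv τ')))) ∧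
    (∀ ε : Fˣ, ¬ IsSquare ε →
      ∀ (M : Type) [AddCommGroup M] [Module ℂ M]
        (ρ : Representation ℂ (Matrix.SpecialLinearGroup (Fin 2) F) M),
        ((stdSpace 1 k).InEtaImage hψ k ρ ∨ (stdSpace ε k).InEtaImage hψ k ρ) ↔
          IsIrrepOfRank k ρ) := by
  have hC (Q : QuadSpace F (Fin k → F)) : HasSpecCommutant Q hψ k := hasSpecCommutant hψ hk Q
  refine ⟨fun Q => ⟨centralizer_algO hψ (hC Q), centralizer_algG hψ (hC Q),
    fun T _ _ τ hτ ho => eta_isIrrepOfRank hψ (hC Q) hτ ho,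
    fun T T' _ _ _ _ τ τ' hτ hτ' ho _ =>
      ⟨fun ⟨e⟩ => nonempty_equiv_of_eta_equiv hψ (hC Q) hτ hτ' ho e,
        fun ⟨e⟩ => ⟨etaCongr hψ e⟩⟩⟩, fun ε hε M _ _ ρ => ⟨fun h => ?_, fun hρ => ?_⟩⟩
  · exact h.elim (isIrrepOfRank_of_inEtaImage hψ (hC _)) (isIrrepOfRank_of_inEtaImage hψ (hC _))
  · exact (hρ.occurs hψ hk hε).imp (inEtaImage_of_occurs hψ (hC _) hρ)
      (inEtaImage_of_occurs hψ (hC _) hρ)
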